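/- Let $K$ be a commutative $\mathbb Q$-algebra (for instance a field of characteristic $0$) and let $V$ be a $\mathbb Z_2\times\mathbb Z$-graded $K$-module (the $\mathbb Z_2$-grading is called parity and denoted by a tilde, the $\mathbb Z$-grading is called weight and denoted $\mathrm w$) with a homogeneous basis $(e_i)_{i\in I}$, finite or infinite (over a field such a basis always exists). Only parity produces signs. Fix $\varepsilon\in\mathbb Z_2$ and $k\in\mathbb Z$. An $(\varepsilon,k)$-shifted $L_\infty$-algebra structure on $V$ is a sequence of $K$-multilinear operations $[-,\dots,-]\colon V^{n}\to V$, $n=0,1,2,\dots$, of parity $\varepsilon(n+1)+n$ and weight $2-n+k(n-1)$, which for $\varepsilon=0$ are antisymmetric (in the super sense) and for $\varepsilon=1$ are symmetric (in the super sense), and which satisfy, for all $n\ge 0$ and all homogeneous $x_1,\dots,x_n\in V$, $$\sum_{r+s=n}\ \sum_{\sigma}(-1)^{\beta}\,[[x_{\sigma(1)},\dots,x_{\sigma(r)}],x_{\sigma(r+1)},\dots,x_{\sigma(r+s)}]=0,$$ the inner sum being over $(r,s)$-shuffles $\sigma$, where $(-1)^\beta=(-1)^{\alpha}$ is the Koszul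 sign of $\sigma$ if $\varepsilon=1$, and $(-1)^\beta=(-1)^{rs}\,\mathrm{sign}(\sigma)\,(-1)^\alpha$ if $\varepsilon=0$. Let $\Pi^{1+\varepsilon}V[1-k]$ be the graded superspace with coordinates $y^i$, $i\in I$, of parity $\tilde e_i+1+\varepsilon$ and weight $-\mathrm w(e_i)+1-k$. Its formal functions are the formal power series in the supercommuting $y^i$ with coefficients in $K$, and its formal vector fields are the continuous $K$-linear superderivations of this algebra (for the product topology on coefficients, $K$ being discrete), i.e. $X=\sum_i X^i\,\partial/\partial y^i$ where each monomial occurs in only finitely many $X^i$. A vector field $Q$ is homological if it is odd and $Q^2=0$. For $u=\sum u^ie_i\in V$ homogeneous, let $i_u$ be the constant vector field $\sum_i u^i\,\partial/\partial y^i$ if $\varepsilon=1$, and $(-1)^{\tilde u}\sum_i u^i\,\partial/\partial y^i$ if $\varepsilon=0$; extend $i$ linearly to $V$. Then there is a unique bijection between the set of homological formal vector fields $Q$ of weight $+1$ on $\Pi^{1+\varepsilon}V[1-k]$ and the set of $(\varepsilon,k)$-shifted $L_\infty$-algebra structures on $V$ such that the brackets $[-,\dots,-]_Q$ corresponding to $Q$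 satisfy, for all $n\ge 0$ and all homogeneous $u_1,\dots,u_n\in V$, $$i_{[u_1,\dots,u_n]_Q}=(-1)^{\tilde u_1(n-1)+\tilde u_2(n-2)+\dots+\tilde u_{n-1}}\,[\dots[Q,i_{u_1}],\dots,i_{u_n}](0)\quad\text{if }\varepsilon=0,$$ $$i_{[u_1,\dots,u_n]_Q}=[\dots[Q,i_{u_1}],\dots,i_{u_n}](0)\quad\text{if }\varepsilon=1.$$ Here $[\cdot,\cdot]$ is the supercommutator of vector fields, and the value of a vector field at $0$ is regarded as a constant vector field. -/

import Mathlib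

/-! ## Formal functions on a graded superspace

A graded superspace is described by linear coordinates `y i`, `i : ι`, of parities `p i : ZMod 2` and
weights `w i : ℤ`.  Coordinates commute according to parity only.  Monomials are written in the order
of `ι`, an odd coordinate having exponent at most one. -/

/-- Exponents of monomials in the coordinates: odd coordinates occur at most once. -/
def SuperMonomial {ι : Type*} (p : ι → ZMod 2) : Type _ :=
  {m : ι →₀ ℕ // ∀ i, p i = 1 → m i ≤ 1}

/-- Formal functions: arbitrary formal power series `∑ₘ f m • y ^ m` in the coordinates. -/
def FormalFun (K : Type*) {ι : Type*} (p : ι → ZMod 2) : Type _ :=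
  SuperMonomial p → K

namespace FormalFun

variable {K ι : Type*} [CommRing K] {p : ι → ZMod 2}

instance : AddCommGroup (FormalFun K p) := inferInstanceAs (AddCommGroup (SuperMonomial p → K))

instance : Module K (FormalFun K p) := inferInstanceAs (Module K (SuperMonomial p → K))

open Classical in
/-- The coefficient of `y ^ m`, with value `0` if an odd coordinate occurs twice in `m`. -/
noncomputable def coeff (f : FormalFun K p) (m : ι →₀ ℕ) : K :=
  if h : ∀ i, p i = 1 → m i ≤ 1 then f ⟨m, h⟩ else 0

open Classical in
/-- The coordinate `y j` as a formal function. -/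
noncomputable def coord (K : Type*) [CommRing K] (p : ι → ZMod 2) (j : ι) : FormalFun K p :=
  fun m => if m.1 = Finsupp.single j 1 then 1 else 0

/-- The value of a formal function at the origin. -/
noncomputable def evalZero (f : FormalFun K p) : K := f.coeff 0

/-- All monomials of `f` have parity `a`. -/
def HasParity (f : FormalFun K p) (a : ZMod 2) : Prop :=
  ∀ m : SuperMonomial p, f m ≠ 0 → m.1.sum (fun i n => (n : ZMod 2) * p i) = a

/-- All monomials of `f` have weight `b`, the coordinates having weights `w`. -/
def HasWeight (w : ι → ℤ) (f : FormalFun K p) (b : ℤ) : Prop :=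
  ∀ m : SuperMonomial p, f m ≠ 0 → m.1.sum (fun i n => (n : ℤ) * w i) = b

variable [LinearOrder ι]

/-- The sign in `y ^ a * y ^ b = ± y ^ (a + b)`: every odd `y j` of the second factor moves to the left
past the odd `y i` with `j < i` of the first one. -/
def mulSign (p : ι → ZMod 2) (a b : ι →₀ ℕ) : ℤˣ :=
  (-1 : ℤˣ) ^ (∑ i ∈ a.support, ∑ j ∈ b.support with j < i,
    (a i : ZMod 2) * p i * ((b j : ZMod 2) * p j))

/-- The supercommutative product of formal power series. -/
noncomputable instance : Mul (FormalFun K p) where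
  mul f g := fun m => ∑ ab ∈ Finset.HasAntidiagonal.antidiagonal m.1,
    mulSign p ab.1 ab.2 • (f.coeff ab.1 * g.coeff ab.2)

/-- The sign produced when `∂/∂y i` moves past the factors `y j`, `j < i`, of `y ^ m`. -/
def derivSign (p : ι → ZMod 2) (i : ι) (m : ι →₀ ℕ) : ℤˣ :=
  (-1 : ℤˣ) ^ (∑ j ∈ m.support with j < i, p i * ((m j : ZMod 2) * p j))

/-- The left partial derivative `∂/∂y i`. -/
noncomputable def partialDeriv (K : Type*) [CommRing K] (p : ι → ZMod 2) (i : ι) :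
    FormalFun K p →ₗ[K] FormalFun K p where
  toFun f := fun m =>
    derivSign p i m.1 • (((m.1 i + 1 : ℕ) : K) * f.coeff (m.1 + Finsupp.single i 1))
  map_add' f g := by
    funext m
    change _ = derivSign p i m.1 • (_ * f.coeff _) + derivSign p i m.1 • (_ * g.coeff _)
    rw [← smul_add, ← mul_add]
    congr 2
    unfold coeff
    split_ifs
    · rfl
    · simp
  map_smul' c f := by
    funext m
    change _ = c * (derivSign p i m.1 • (_ * f.coeff _))
    rw [mul_smul_comm, mul_left_comm]
    congr 2
    unfold coeff
    split_ifs
    · rfl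
    · simp

end FormalFun

/-! ## Formal vector fields -/

section VectorFields

variable {K ι : Type*} [CommRing K] [LinearOrder ι] {p : ι → ZMod 2}

/-- A formal vector field of parity `c`: a `K`-linear superderivation of parity `c` of the algebra of
formal functions which is continuous, that is, each coefficient of `X f` depends on finitely many
coefficients of `f` only (product topology, `K` being discrete).  Equivalently, `X = ∑ Xʲ ∂/∂y j` where,
for each monomial, only finitely many of the formal functions `Xʲ` contain it. -/
structure IsFormalVectorField (X : FormalFun K p →ₗ[K] FormalFun K p) (c : ZMod 2) : Prop where
  parity : ∀ (f : FormalFun K p) (a : ZMod 2), f.HasParity a → (X f).HasParity (a + c)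
  leibniz : ∀ (f g : FormalFun K p) (a : ZMod 2), f.HasParity a →
    X (f * g) = X f * g + ((-1 : ℤˣ) ^ (c * a)) • (f * X g)
  continuous : ∀ m : SuperMonomial p, ∃ S : Finset (ι →₀ ℕ), ∀ f : FormalFun K p,
    (∀ s ∈ S, f.coeff s = 0) → X f m = 0

/-- `X` has weight `r`. -/
def VectorFieldHasWeight (w : ι → ℤ) (X : FormalFun K p →ₗ[K] FormalFun K p) (r : ℤ) : Prop :=
  ∀ (f : FormalFun K p) (b : ℤ), f.HasWeight w b → (X f).HasWeight w (b + r)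

/-- The commutator `[X, Y] = X Y - (-1) ^ (c d) Y X` of vector fields of parities `c` and `d`. -/
def superCommutator (X : FormalFun K p →ₗ[K] FormalFun K p) (c : ZMod 2)
    (Y : FormalFun K p →ₗ[K] FormalFun K p) (d : ZMod 2) : FormalFun K p →ₗ[K] FormalFun K p :=
  X ∘ₗ Y - ((-1 : ℤˣ) ^ (c * d)) • (Y ∘ₗ X)

/-- The iterated commutator `[…[[X, Y 0], Y 1], …, Y (n-1)]`, where `X` has parity `c` and `Y i` has
parity `d i`. -/
def iteratedCommutator (X : FormalFun K p →ₗ[K] FormalFun K p) (c : ZMod 2) :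
    (n : ℕ) → (Fin n → (FormalFun K p →ₗ[K] FormalFun K p)) → (Fin n → ZMod 2) →
      (FormalFun K p →ₗ[K] FormalFun K p)
  | 0, _, _ => X
  | n + 1, Y, d =>
      superCommutator (iteratedCommutator X c n (fun i => Y i.castSucc) (fun i => d i.castSucc))
        (c + ∑ i : Fin n, d i.castSucc) (Y (Fin.last n)) (d (Fin.last n))

/-- The value of a vector field at the origin: the components `Xʲ(0) = (X (y j))(0)` of the tangent
vector (equivalently, of the constant vector field) `∑ Xʲ(0) ∂/∂y j`. -/
noncomputable def valueAtZero (X : FormalFun K p →ₗ[K] FormalFun K p) : ι → K :=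
  fun j => (X (FormalFun.coord K p j)).evalZero

/-- Homological vector fields of weight `+1`: odd formal vector fields `Q` of weight `+1`, `Q² = 0`. -/
structure HomologicalVectorField (K : Type*) [CommRing K] {ι : Type*} [LinearOrder ι]
    (p : ι → ZMod 2) (w : ι → ℤ) where
  field : FormalFun K p →ₗ[K] FormalFun K p
  isVectorField : IsFormalVectorField field 1
  weight : VectorFieldHasWeight w field 1
  square : field ∘ₗ field = 0

end VectorFields

/-! ## Shifted `L∞`-algebras -/

section LInfinity

/-- The Koszul sign of `x_{σ(1)} ⋯ x_{σ(n)} = ± x_1 ⋯ x_n`, the `x_i` having parities `a i`. -/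
def koszulSign {n : ℕ} (a : Fin n → ZMod 2) (σ : Equiv.Perm (Fin n)) : ℤˣ :=
  (-1 : ℤˣ) ^ (∑ i : Fin n, ∑ j : Fin n with i < j ∧ σ j < σ i, a (σ i) * a (σ j))

/-- The `(r, n - r)`-shuffles: `σ` is increasing on the first `r` and on the last `n - r` indices. -/
def shuffles (n r : ℕ) : Finset (Equiv.Perm (Fin n)) :=
  Finset.univ.filter fun σ =>
    ∀ i j : Fin n, i < j → ((j : ℕ) < r ∨ r ≤ (i : ℕ)) → σ i < σ j

variable {K V : Type*} [CommRing K] [AddCommGroup V] [Module K V]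

/-- `[[x_{σ(1)}, …, x_{σ(r)}], x_{σ(r+1)}, …, x_{σ(n)}]`. -/
def nestedBracket (br : (n : ℕ) → MultilinearMap K (fun _ : Fin n => V) V) {n : ℕ}
    (r : Fin (n + 1)) (σ : Equiv.Perm (Fin n)) (x : Fin n → V) : V :=
  br (n - (r : ℕ) + 1) (Fin.cons
    (br (r : ℕ) (fun i : Fin (r : ℕ) => x (σ ⟨i, by omega⟩)))
    (fun j : Fin (n - (r : ℕ)) => x (σ ⟨(r : ℕ) + (j : ℕ), by omega⟩)))

/-- An `(ε, k)`-shifted `L∞`-algebra structure on a graded module `V`; here `𝒱 (a, b)` is the part of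
parity `a` and weight `b`. -/
structure ShiftedLInfinity (𝒱 : ZMod 2 × ℤ → Submodule K V) (ε : ZMod 2) (k : ℤ) where
  bracket : (n : ℕ) → MultilinearMap K (fun _ : Fin n => V) V
  /-- The `n`-th bracket has parity `ε(n+1)+n` and weight `2-n+k(n-1)`. -/
  degree : ∀ (n : ℕ) (x : Fin n → V) (d : Fin n → ZMod 2 × ℤ), (∀ i, x i ∈ 𝒱 (d i)) →
    bracket n x ∈ 𝒱 ((∑ i, d i) +
      (ε * ((n : ZMod 2) + 1) + (n : ZMod 2), 2 - (n : ℤ) + k * ((n : ℤ) - 1)))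
  antisymm : ε = 0 → ∀ (n : ℕ) (x : Fin n → V) (d : Fin n → ZMod 2 × ℤ), (∀ i, x i ∈ 𝒱 (d i)) →
    ∀ σ : Equiv.Perm (Fin n), bracket n (fun i => x (σ i)) =
      (Equiv.Perm.sign σ * koszulSign (fun i => (d i).1) σ) • bracket n x
  symm : ε = 1 → ∀ (n : ℕ) (x : Fin n → V) (d : Fin n → ZMod 2 × ℤ), (∀ i, x i ∈ 𝒱 (d i)) →
    ∀ σ : Equiv.Perm (Fin n), bracket n (fun i => x (σ i)) =
      koszulSign (fun i => (d i).1) σ • bracket n x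
  jacobi_even : ε = 0 → ∀ (n : ℕ) (x : Fin n → V) (d : Fin n → ZMod 2 × ℤ),
    (∀ i, x i ∈ 𝒱 (d i)) →
    ∑ r : Fin (n + 1), ∑ σ ∈ shuffles n (r : ℕ),
      ((-1 : ℤˣ) ^ ((r : ℕ) * (n - (r : ℕ))) * Equiv.Perm.sign σ * koszulSign (fun i => (d i).1) σ) •
        nestedBracket bracket r σ x = 0
  jacobi_odd : ε = 1 → ∀ (n : ℕ) (x : Fin n → V) (d : Fin n → ZMod 2 × ℤ),
    (∀ i, x i ∈ 𝒱 (d i)) →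
    ∑ r : Fin (n + 1), ∑ σ ∈ shuffles n (r : ℕ),
      koszulSign (fun i => (d i).1) σ • nestedBracket bracket r σ x = 0

end LInfinity

/-! ## The superspace `Π^{1+ε} V[1-k]` and constant vector fields on it -/

section ShiftedSpace

variable {K ι V : Type*} [CommRing K] [LinearOrder ι] [AddCommGroup V] [Module K V]

/-- Parities of the coordinates on `Π^{1+ε} V[1-k]` for a basis of `V` with parities `p`. -/
def shiftedParity (ε : ZMod 2) (p : ι → ZMod 2) : ι → ZMod 2 := fun i => p i + (1 + ε)

/-- Weights of the coordinates on `Π^{1+ε} V[1-k]` for a basis of `V` with weights `w`. -/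
def shiftedWeight (k : ℤ) (w : ι → ℤ) : ι → ℤ := fun i => -w i + (1 - k)

/-- The constant vector field `i_u` on `Π^{1+ε} V[1-k]`, for `u = ∑ uⁱ eᵢ`: it is `∑ uⁱ ∂/∂yⁱ` if `ε = 1`,
and `∑ (-1) ^ (parity of eᵢ) uⁱ ∂/∂yⁱ` if `ε = 0`, which is `(-1) ^ (parity of u) ∑ uⁱ ∂/∂yⁱ` for
homogeneous `u`. -/
noncomputable def constantField (e : Module.Basis ι K V) (ε : ZMod 2) (p : ι → ZMod 2) (u : V) :
    FormalFun K (shiftedParity ε p) →ₗ[K] FormalFun K (shiftedParity ε p) :=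
  (e.repr u).sum fun i c =>
    ((-1 : ℤˣ) ^ ((1 + ε) * p i)) • (c • FormalFun.partialDeriv K (shiftedParity ε p) i)

/-- `[…[Q, i_{u_1}], …, i_{u_n}]` for `u_i` of parity `a i`; the parity of `i_u` is that of `u` plus
`1 + ε`, and `Q` is odd. -/
noncomputable def higherDerivedField (e : Module.Basis ι K V) (ε : ZMod 2) (p : ι → ZMod 2)
    (Q : FormalFun K (shiftedParity ε p) →ₗ[K] FormalFun K (shiftedParity ε p)) {n : ℕ}
    (u : Fin n → V) (a : Fin n → ZMod 2) :
    FormalFun K (shiftedParity ε p) →ₗ[K] FormalFun K (shiftedParity ε p) :=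
  iteratedCommutator Q 1 n (fun i => constantField e ε p (u i)) (fun i => a i + (1 + ε))

end ShiftedSpace

/-! ## Koszul signs -/

section KoszulSigns

/-! Both sets are encoded by the same data, `SymmetricConstants`: families c_n(i_1, …, i_n)^j,
finitely supported in j, which for the shifted parities and weights are supersymmetric, odd and of
weight one, and which satisfy the Jacobi identity. The bijection is the composite of
`homologicalEquivConstants` and `constantsEquivShiftedLInfinity`.

Vector fields and constants. The constants of Q are the values at the origin of its iterated
commutators with the coordinate fields ∂_i. A derivation kills the constant ∂_i y^j, so on y^j such
a commutator is, up to sign, an iterated derivative of the component Q^j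
(`IsFormalVectorField.coordCommutator_coord`), and its value at the origin is a Taylor coefficient.
Over a ℚ-algebra Taylor coefficients determine Q^j, and every supersymmetric family occurs
(`FormalFun.ext_iterDeriv`, `FormalFun.exists_iterDeriv_eq`). Finite support in j corresponds to
continuity of Q. Expanding the iterated commutator of Q ∘ Q by the Leibniz rule gives one term for
each subset of the arguments, that is, for each shuffle; at the origin that term is a nested
bracket. Hence the Jacobiator consists of the constants of the even vector field Q²
(`jacobiator_commutatorConst`), and the Jacobi identity says exactly that Q² = 0.

Constants and brackets. On basis vectors the n-th bracket is c_n times the sign with exponent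
`bracketExp`, which is trivial if ε = 1. If ε = 0 this is décalage: shifting all parities by one
multiplies the Koszul sign by the sign of the permutation and by a coboundary (`koszulExp_add_one`).
Absorbing the coboundary turns symmetric operations into antisymmetric ones and produces the
(-1)^(rs) of the Jacobi identity (`bracketExp_nested`). The degree conditions correspond by
`degree_iff`. Identities on homogeneous vectors reduce to basis vectors of the same degrees by
`MultilinearMap.eq_zero_of_basis`.

The derived bracket formula is multilinear in the arguments of given degrees, so it too is checked
on basis vectors (`valueAtZero_constantField_bracket`). Since u ↦ i_u is injective, the formula
determines the brackets, which gives uniqueness. -/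

theorem Finset.sum_pairs_comp_perm {n : ℕ} {M : Type*} [AddCommMonoid M] (g : Fin n → Fin n → M)
    (hg : ∀ i j, g i j = g j i) (τ : Equiv.Perm (Fin n)) :
    (∑ i, ∑ j, if i < j then g (τ i) (τ j) else 0) = ∑ i, ∑ j, if i < j then g i j else 0 := by
  have h1 : (∑ i, ∑ j, if i < j then g i j else 0) =
      ∑ i, ∑ j, if τ i < τ j then g (τ i) (τ j) else 0 := by
    rw [← Equiv.sum_comp τ]
    refine Finset.sum_congr rfl fun i _ => ?_
    rw [← Equiv.sum_comp τ]
  -- Pairs are split according to whether τ keeps or reverses their order; the reversed ones agree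
  -- after exchanging i and j, by the symmetry of g.
  have h2 : ∀ i j, (if i < j then g (τ i) (τ j) else 0) =
      (if i < j ∧ τ i < τ j then g (τ i) (τ j) else 0) +
        if i < j ∧ τ j < τ i then g (τ i) (τ j) else 0 := by
    intro i j
    by_cases hij : i < j
    · rcases lt_trichotomy (τ i) (τ j) with h | h | h
      · simp [hij, h, h.not_gt]
      · exact absurd (τ.injective h) hij.ne
      · simp [hij, h, h.not_gt]
    · simp [hij]
  have h3 : ∀ i j, (if τ i < τ j then g (τ i) (τ j) else 0) =
      (if i < j ∧ τ i < τ j then g (τ i) (τ j) else 0) +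
        if j < i ∧ τ i < τ j then g (τ j) (τ i) else 0 := by
    intro i j
    by_cases hij : τ i < τ j
    · rcases lt_trichotomy i j with h | h | h
      · simp [hij, h, h.not_gt]
      · simp [h] at hij
      · simp [hij, h, h.not_gt, hg (τ i) (τ j)]
    · simp [hij]
  rw [h1]
  simp only [h2, h3, Finset.sum_add_distrib]
  congr 1
  exact Finset.sum_comm

/-- The exponent of the Koszul sign. -/
def koszulExp {n : ℕ} (a : Fin n → ZMod 2) (σ : Equiv.Perm (Fin n)) : ZMod 2 :=
  ∑ i : Fin n, ∑ j : Fin n with i < j ∧ σ j < σ i, a (σ i) * a (σ j)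

theorem koszulSign_eq {n : ℕ} (a : Fin n → ZMod 2) (σ : Equiv.Perm (Fin n)) :
    koszulSign a σ = (-1 : ℤˣ) ^ koszulExp a σ := rfl

theorem koszulExp_eq {n : ℕ} (a : Fin n → ZMod 2) (σ : Equiv.Perm (Fin n)) :
    koszulExp a σ = ∑ i, ∑ j, if i < j then (if σ j < σ i then a (σ i) * a (σ j) else 0) else 0 := by
  simp only [koszulExp, Finset.sum_filter, ite_and]

theorem ZMod.two_add_self (a : ZMod 2) : a + a = 0 := by
  revert a; decide

/-- A cocycle identity: a pair is inverted by σ * τ exactly when one, but not both, of the following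
happens: τ inverts it, or σ inverts its image under τ. -/
theorem koszulExp_mul {n : ℕ} (a : Fin n → ZMod 2) (σ τ : Equiv.Perm (Fin n)) :
    koszulExp a (σ * τ) = koszulExp a σ + koszulExp (fun i => a (σ i)) τ := by
  -- The contribution of an inversion of σ, made symmetric in i and j so that the sum over pairs may
  -- be reindexed by τ.
  let g : Fin n → Fin n → ZMod 2 := fun i j =>
    if (i < j ∧ σ j < σ i) ∨ (j < i ∧ σ i < σ j) then a (σ i) * a (σ j) else 0
  have hg : ∀ i j, g i j = g j i := by
    intro i j
    simp only [g]
    rw [mul_comm]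
    congr 1
    exact propext or_comm
  have h1 : koszulExp a σ = ∑ i, ∑ j, if i < j then g i j else 0 := by
    rw [koszulExp_eq]
    refine Finset.sum_congr rfl fun i _ => Finset.sum_congr rfl fun j _ => ?_
    by_cases hij : i < j
    · simp [g, hij, hij.not_gt]
    · simp [hij]
  rw [h1, ← Finset.sum_pairs_comp_perm g hg τ, koszulExp_eq, koszulExp_eq, ← Finset.sum_add_distrib]
  refine Finset.sum_congr rfl fun i _ => ?_
  rw [← Finset.sum_add_distrib]
  refine Finset.sum_congr rfl fun j _ => ?_
  by_cases hij : i < j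
  · have hne : τ i ≠ τ j := fun h => hij.ne (τ.injective h)
    have hne' : σ (τ i) ≠ σ (τ j) := fun h => hne (σ.injective h)
    simp only [hij, if_true, g, Equiv.Perm.mul_apply]
    rcases lt_or_gt_of_ne hne with h | h <;> rcases lt_or_gt_of_ne hne' with h' | h' <;>
      simp [h, h', h.not_gt, h'.not_gt, ZMod.two_add_self]
  · simp [hij]

@[simp] theorem koszulExp_one {n : ℕ} (a : Fin n → ZMod 2) : koszulExp a 1 = 0 := by
  rw [koszulExp_eq]
  refine Finset.sum_eq_zero fun i _ => Finset.sum_eq_zero fun j _ => ?_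
  by_cases hij : i < j
  · simp [hij.not_gt]
  · simp [hij]

theorem koszulExp_swap {n : ℕ} (a : Fin (n + 1) → ZMod 2) (k : Fin n) :
    koszulExp a (Equiv.swap k.castSucc k.succ) = a k.castSucc * a k.succ := by
  rw [koszulExp_eq, Finset.sum_eq_single k.castSucc, Finset.sum_eq_single k.succ]
  · simp [mul_comm]
  · intro j _ hj
    rw [Equiv.swap_apply_left]
    split_ifs with h1 h2
    · exfalso
      rw [Equiv.swap_apply_of_ne_of_ne h1.ne' hj] at h2
      simp only [Fin.lt_def, Fin.val_castSucc, Fin.val_succ] at h1 h2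
      exact hj (Fin.ext (by simp only [Fin.val_succ]; omega))
    · rfl
    · rfl
  · simp
  · intro i _ hi
    refine Finset.sum_eq_zero fun j _ => ?_
    split_ifs with h1 h2
    · exfalso
      simp only [Equiv.swap_apply_def] at h2
      split_ifs at h2 <;> simp_all only [Fin.lt_def, Fin.val_castSucc, Fin.val_succ, Fin.ext_iff,
        lt_self_iff_false] <;> omega
    · rfl
    · rfl
  · simp

theorem Equiv.Perm.adjacent_swap_induction {n : ℕ} {motive : Equiv.Perm (Fin (n + 1)) → Prop}
    (one : motive 1) (swap : ∀ k : Fin n, motive (Equiv.swap k.castSucc k.succ))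
    (mul : ∀ σ τ, motive σ → motive τ → motive (σ * τ)) (σ : Equiv.Perm (Fin (n + 1))) :
    motive σ := by
  have h : σ ∈ Submonoid.closure
      (Set.range fun i : Fin n => Equiv.swap i.castSucc i.succ) := by
    rw [Equiv.Perm.mclosure_swap_castSucc_succ]; trivial
  induction h using Submonoid.closure_induction with
  | mem x hx => obtain ⟨k, rfl⟩ := hx; exact swap k
  | one => exact one
  | mul x y _ _ hx hy => exact mul x y hx hy

theorem sign_eq_koszulExp {n : ℕ} (σ : Equiv.Perm (Fin n)) :
    Equiv.Perm.sign σ = (-1 : ℤˣ) ^ koszulExp (fun _ => 1) σ := by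
  cases n with
  | zero => rw [Subsingleton.elim σ 1]; simp
  | succ n =>
    induction σ using Equiv.Perm.adjacent_swap_induction with
    | one => simp
    | swap k =>
      rw [koszulExp_swap, Equiv.Perm.sign_swap (Fin.castSucc_lt_succ).ne]; simp
    | mul σ τ hσ hτ => rw [Equiv.Perm.sign_mul, koszulExp_mul, uzpow_add, hσ, hτ]

/-- The exponent of the décalage sign. -/
def decalageExp {n : ℕ} (a : Fin n → ZMod 2) : ZMod 2 :=
  ∑ i : Fin n, a i * ((n : ZMod 2) - 1 - ((i : ℕ) : ZMod 2))

/-- Décalage. From (x + 1)(y + 1) = 1 + xy + (x + y), the Koszul exponent splits into the exponent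
of the sign of σ, the unshifted exponent, and a sum of x + y over inversions, which is the
coboundary of `decalageExp`. -/
theorem koszulExp_add_one {n : ℕ} (a : Fin n → ZMod 2) (σ : Equiv.Perm (Fin n)) :
    koszulExp (fun i => a i + 1) σ = koszulExp (fun _ => 1) σ + koszulExp a σ +
      (decalageExp (fun i => a (σ i)) + decalageExp a) := by
  have hc : ∀ i : Fin n, (∑ j : Fin n, if j < i then (1 : ZMod 2) else 0) = ((i : ℕ) : ZMod 2) := by
    intro i
    rw [← Finset.sum_filter, Finset.sum_const, Finset.filter_gt_eq_Iio, Fin.card_Iio]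
    simp
  -- The number of inversions involving position i is congruent to i + σ i modulo 2: it counts the j
  -- lying below i in exactly one of the orders before and after σ.
  have h1 : (∑ i, ∑ j, if i < j then (if σ j < σ i then a (σ i) + a (σ j) else 0) else 0) =
      ∑ i, a (σ i) * (((i : ℕ) : ZMod 2) + ((σ i : ℕ) : ZMod 2)) := by
    have e1 : ∀ i j, (if i < j then (if σ j < σ i then a (σ i) + a (σ j) else 0) else 0) =
        (if i < j ∧ σ j < σ i then a (σ i) else 0) +
          (if i < j ∧ σ j < σ i then a (σ j) else 0) := by
      intro i j
      by_cases h : i < j <;> by_cases h' : σ j < σ i <;> simp [h, h']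
    simp only [e1, Finset.sum_add_distrib]
    rw [Finset.sum_comm (f := fun i j => if i < j ∧ σ j < σ i then a (σ j) else 0),
      ← Finset.sum_add_distrib]
    refine Finset.sum_congr rfl fun i _ => ?_
    rw [← Finset.sum_add_distrib, ← hc i, ← hc (σ i), ← Equiv.sum_comp σ (fun j => if j < σ i then _ else _),
      ← Finset.sum_add_distrib, Finset.mul_sum]
    refine Finset.sum_congr rfl fun j _ => ?_
    rcases lt_trichotomy i j with h | h | h
    · rcases lt_or_gt_of_ne (fun h' => h.ne (σ.injective h') : σ i ≠ σ j) with h' | h' <;>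
        simp [h, h', h.not_gt, h'.not_gt]
    · simp [h]
    · rcases lt_or_gt_of_ne (fun h' => h.ne (σ.injective h').symm : σ i ≠ σ j) with h' | h' <;>
        simp [h, h', h.not_gt, h'.not_gt, show (1 : ZMod 2) + 1 = 0 from rfl]
  have h2 : decalageExp (fun i => a (σ i)) + decalageExp a =
      ∑ i, a (σ i) * (((i : ℕ) : ZMod 2) + ((σ i : ℕ) : ZMod 2)) := by
    unfold decalageExp
    rw [← Equiv.sum_comp σ (fun i => a i * _), ← Finset.sum_add_distrib]
    refine Finset.sum_congr rfl fun i _ => ?_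
    beta_reduce
    generalize a (σ i) = x
    generalize ((i : ℕ) : ZMod 2) = y
    generalize ((σ i : ℕ) : ZMod 2) = z
    generalize (n : ZMod 2) = t
    revert x y z t; decide
  rw [h2, ← h1]
  simp only [koszulExp_eq, ← Finset.sum_add_distrib]
  refine Finset.sum_congr rfl fun i _ => Finset.sum_congr rfl fun j _ => ?_
  split_ifs
  · ring
  · simp
  · simp

theorem koszulSign_mul {n : ℕ} (a : Fin n → ZMod 2) (σ τ : Equiv.Perm (Fin n)) :
    koszulSign a (σ * τ) = koszulSign a σ * koszulSign (fun i => a (σ i)) τ := by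
  simp only [koszulSign_eq, koszulExp_mul, uzpow_add]

/-- The permutation moving the last index to the front. -/
def lastToFront (n : ℕ) : Equiv.Perm (Fin (n + 1)) := (finRotate (n + 1))⁻¹

@[simp] theorem lastToFront_zero (n : ℕ) : lastToFront n 0 = Fin.last n := by
  rw [lastToFront, Equiv.Perm.inv_eq_iff_eq, finRotate_last]

@[simp] theorem lastToFront_succ {n : ℕ} (i : Fin n) : lastToFront n i.succ = i.castSucc := by
  rw [lastToFront, Equiv.Perm.inv_eq_iff_eq]
  rw [finRotate_apply, Fin.coeSucc_eq_succ]

theorem koszulExp_lastToFront {n : ℕ} (a : Fin (n + 1) → ZMod 2) :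
    koszulExp a (lastToFront n) = a (Fin.last n) * ∑ i : Fin n, a i.castSucc := by
  rw [koszulExp_eq, Fin.sum_univ_succ, Fin.sum_univ_succ]
  simp only [Fin.sum_univ_succ (n := n)]
  simp [Fin.castSucc_lt_last, Finset.mul_sum]
  refine Finset.sum_eq_zero fun i _ => Finset.sum_eq_zero fun j _ => ?_
  by_cases h : i < j
  · simp [h.not_gt]
  · simp [h]

/-- A repeated odd entry makes the Koszul sign of a suitable permutation fixing `a` equal to `-1`. -/
theorem exists_perm_koszulSign_eq_neg_one {n : ℕ} {α : Type*} (P : α → ZMod 2) (I : Fin n → α)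
    {x y : Fin n} (hxy : x ≠ y) (hI : I x = I y) (hP : P (I x) = 1) :
    ∃ σ : Equiv.Perm (Fin n), (fun i => I (σ i)) = I ∧ koszulSign (fun i => P (I i)) σ = -1 := by
  obtain _ | _ | n := n
  · exact x.elim0
  · exact absurd (Subsingleton.elim (α := Fin 1) x y) hxy
  -- The transposition of x and y is written as a conjugate of the swap of 0 and 1, whose Koszul
  -- sign is a single product.
  obtain ⟨ρ, h0, h1⟩ : ∃ ρ : Equiv.Perm (Fin (n + 2)), ρ 0 = x ∧ ρ 1 = y := by
    refine ⟨Equiv.swap 0 x * Equiv.swap 1 (Equiv.swap 0 x y), ?_, ?_⟩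
    · rw [Equiv.Perm.mul_apply, Equiv.swap_apply_of_ne_of_ne (a := 1), Equiv.swap_apply_left]
      · exact Fin.zero_ne_one
      · intro h
        rw [eq_comm, Equiv.swap_apply_eq_iff, Equiv.swap_apply_left] at h
        exact hxy h.symm
    · rw [Equiv.Perm.mul_apply, Equiv.swap_apply_left, Equiv.swap_apply_self]
  set s : Equiv.Perm (Fin (n + 2)) := Equiv.swap 0 1 with hs
  have hIs : (fun i => I (ρ (s i))) = fun i => I (ρ i) := by
    funext i
    rw [hs, Equiv.swap_apply_def]
    split_ifs with h h'
    · rw [h, h0, h1, hI]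
    · rw [h', h0, h1, hI]
    · rfl
  refine ⟨ρ * s * ρ⁻¹, ?_, ?_⟩
  · funext i
    have := congrFun hIs (ρ⁻¹ i)
    simpa using this
  · have hP' : ∀ i, P (I (ρ (s i))) = P (I (ρ i)) := fun i => congrArg P (congrFun hIs i)
    -- The parities along ρ are unchanged by s, so the contributions of ρ and ρ⁻¹ to the cocycle
    -- cancel.
    have e1 : koszulSign (fun i => P (I i)) (ρ * s * ρ⁻¹) =
        koszulSign (fun i => P (I (ρ i))) s * koszulSign (fun i => P (I i)) (ρ * ρ⁻¹) := by
      rw [koszulSign_mul, koszulSign_mul, koszulSign_mul]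
      simp only [Equiv.Perm.mul_apply, hP']
      rw [mul_right_comm, mul_comm]
    have e2 : koszulSign (fun i => P (I (ρ i))) s = -1 := by
      have := koszulExp_swap (fun i => P (I (ρ i))) (0 : Fin (n + 1))
      rw [koszulSign_eq, hs]
      change koszulExp _ (Equiv.swap 0 1) = _ at this
      rw [this]
      change (-1 : ℤˣ) ^ (P (I (ρ 0)) * P (I (ρ 1))) = -1
      rw [h0, h1, ← hI, hP]; simp
    rw [e1, e2, mul_inv_cancel, koszulSign_eq, koszulExp_one]
    simp

end KoszulSigns

/-! ### Shuffles as subsets of the index set -/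

section Shuffles

/-- The indices that `σ` puts into one of the first `r` positions. -/
def shuffleMask {n : ℕ} (r : ℕ) (σ : Equiv.Perm (Fin n)) : Fin n → Bool :=
  fun i => decide (((σ⁻¹ i : Fin n) : ℕ) < r)

theorem mem_shuffles {n r : ℕ} {σ : Equiv.Perm (Fin n)} :
    σ ∈ shuffles n r ↔ ∀ i j : Fin n, i < j → ((j : ℕ) < r ∨ r ≤ (i : ℕ)) → σ i < σ j := by
  simp [shuffles]

theorem shuffleMask_apply {n : ℕ} (r : ℕ) (σ : Equiv.Perm (Fin n)) (i : Fin n) :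
    shuffleMask r σ (σ i) = decide ((i : ℕ) < r) := by
  simp [shuffleMask]

theorem card_shuffleMask {n r : ℕ} (hr : r ≤ n) (σ : Equiv.Perm (Fin n)) :
    (Finset.univ.filter fun i => shuffleMask r σ i = true).card = r := by
  have : (Finset.univ.filter fun i => shuffleMask r σ i = true) =
      (Finset.univ.filter fun i : Fin n => (i : ℕ) < r).map σ.toEmbedding := by
    ext i
    simp only [Finset.mem_filter, Finset.mem_univ, true_and, Finset.mem_map_equiv]
    simp [shuffleMask, Equiv.Perm.inv_def]
  rw [this, Finset.card_map]
  rw [← Fintype.card_subtype, Fintype.card_congr (Fin.castLEquiv hr).symm]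
  simp

/-- A shuffle is the increasing enumeration of its mask followed by that of the complement, and
increasing enumerations are unique. -/
theorem eq_of_shuffleMask_eq {n r : ℕ} (hr : r ≤ n) {σ τ : Equiv.Perm (Fin n)}
    (hσ : σ ∈ shuffles n r) (hτ : τ ∈ shuffles n r) (h : shuffleMask r σ = shuffleMask r τ) :
    σ = τ := by
  rw [mem_shuffles] at hσ hτ
  set S := Finset.univ.filter fun i => shuffleMask r σ i = true with hS
  have hcard : S.card = r := card_shuffleMask hr σ
  have hcard' : Sᶜ.card = n - r := by rw [Finset.card_compl, hcard, Fintype.card_fin]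
  have key : ∀ ρ : Equiv.Perm (Fin n), (∀ i j : Fin n, i < j → ((j : ℕ) < r ∨ r ≤ (i : ℕ)) →
      ρ i < ρ j) → shuffleMask r σ = shuffleMask r ρ →
      (∀ i : Fin r, ρ ⟨i, by omega⟩ = S.orderEmbOfFin hcard i) ∧
      (∀ i : Fin (n - r), ρ ⟨r + i, by omega⟩ = Sᶜ.orderEmbOfFin hcard' i) := by
    intro ρ hρ hm
    constructor
    · refine congrFun (Finset.orderEmbOfFin_unique hcard (f := fun i : Fin r => ρ ⟨i, by omega⟩)
        (fun x => ?_) (fun x y hxy => ?_))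
      · simp [hS, hm, shuffleMask_apply]
      · exact hρ _ _ hxy (Or.inl y.2)
    · refine congrFun (Finset.orderEmbOfFin_unique hcard'
        (f := fun i : Fin (n - r) => ρ ⟨r + i, by omega⟩) (fun x => ?_) (fun x y hxy => ?_))
      · simp [hS, hm, shuffleMask_apply]
      · refine hρ _ _ ?_ (Or.inr (by simp))
        exact Nat.add_lt_add_left hxy r
  obtain ⟨a1, a2⟩ := key σ hσ rfl
  obtain ⟨b1, b2⟩ := key τ hτ h
  ext1 i
  by_cases hi : (i : ℕ) < r
  · exact (a1 ⟨i, hi⟩).trans (b1 ⟨i, hi⟩).symm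
  · have e : (⟨r + (i - r : ℕ), by omega⟩ : Fin n) = i := Fin.ext (by simp; omega)
    have := (a2 ⟨i - r, by omega⟩).trans (b2 ⟨i - r, by omega⟩).symm
    simpa only [e] using this

theorem exists_shuffle_of_mask {n : ℕ} (s : Fin n → Bool) :
    ∃ r : Fin (n + 1), ∃ σ ∈ shuffles n (r : ℕ), shuffleMask (r : ℕ) σ = s := by
  set S := Finset.univ.filter fun i => s i = true with hS
  have hle : S.card ≤ n := by simpa using Finset.card_le_univ S
  have hcard' : Sᶜ.card = n - S.card := by rw [Finset.card_compl, Fintype.card_fin]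
  let f : Fin n → Fin n := fun i =>
    if h : (i : ℕ) < S.card then S.orderEmbOfFin rfl ⟨i, h⟩
    else Sᶜ.orderEmbOfFin hcard' ⟨i - S.card, by omega⟩
  have hf1 : ∀ (i : Fin n) (h : (i : ℕ) < S.card), f i = S.orderEmbOfFin rfl ⟨i, h⟩ :=
    fun i h => dif_pos h
  have hf2 : ∀ (i : Fin n) (h : ¬ (i : ℕ) < S.card),
      f i = Sᶜ.orderEmbOfFin hcard' ⟨i - S.card, by omega⟩ := fun i h => dif_neg h
  have hmem : ∀ i : Fin n, f i ∈ S ↔ (i : ℕ) < S.card := by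
    intro i
    by_cases h : (i : ℕ) < S.card
    · simp only [h, iff_true, hf1 i h]
      exact Finset.orderEmbOfFin_mem _ _ _
    · simp only [h, iff_false, hf2 i h]
      exact Finset.mem_compl.1 (Finset.orderEmbOfFin_mem _ _ _)
  have hmono : ∀ i j : Fin n, i < j → ((j : ℕ) < S.card ∨ S.card ≤ (i : ℕ)) → f i < f j := by
    intro i j hij hor
    have hij' : (i : ℕ) < j := hij
    rcases hor with h | h
    · rw [hf1 i (by omega), hf1 j h]
      exact (OrderEmbedding.lt_iff_lt _).2 hij'
    · rw [hf2 i (by omega), hf2 j (by omega)]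
      simp only [OrderEmbedding.lt_iff_lt, Fin.lt_def]
      omega
  have hinj : Function.Injective f := by
    intro i j hij
    have h1 := (hmem i).symm.trans ((by rw [hij] : f i ∈ S ↔ f j ∈ S).trans (hmem j))
    rcases lt_trichotomy i j with h | h | h
    · exact absurd hij (hmono i j h (by omega)).ne
    · exact h
    · exact absurd hij (hmono j i h (by omega)).ne'
  refine ⟨⟨S.card, by omega⟩, Equiv.ofBijective f (Finite.injective_iff_bijective.1 hinj), ?_, ?_⟩
  · rw [mem_shuffles]
    exact hmono
  · funext i
    obtain ⟨j, rfl⟩ := (Finite.injective_iff_bijective.1 hinj).2 i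
    have := shuffleMask_apply S.card
      (Equiv.ofBijective f (Finite.injective_iff_bijective.1 hinj)) j
    rw [Equiv.ofBijective_apply] at this
    rw [this]
    rw [← Bool.coe_iff_coe, decide_eq_true_iff, ← hmem j]
    simp [S]

/-- Shuffles of all types (r, n - r) together correspond to all subsets of the indices. This matches
the Jacobi sum with the expansion of an iterated commutator of a product. -/
theorem sum_shuffles_eq_sum_masks {n : ℕ} {M : Type*} [AddCommMonoid M]
    (F : Fin (n + 1) → Equiv.Perm (Fin n) → M) (G : (Fin n → Bool) → M)
    (h : ∀ (r : Fin (n + 1)), ∀ σ ∈ shuffles n (r : ℕ), F r σ = G (shuffleMask (r : ℕ) σ)) :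
    ∑ r : Fin (n + 1), ∑ σ ∈ shuffles n (r : ℕ), F r σ = ∑ s : Fin n → Bool, G s := by
  rw [Finset.sum_sigma']
  refine Finset.sum_bij (fun x _ => shuffleMask (x.1 : ℕ) x.2) (fun _ _ => Finset.mem_univ _)
    ?_ ?_ ?_
  · rintro ⟨r, σ⟩ h1 ⟨r', σ'⟩ h2 heq
    simp only [Finset.mem_sigma, Finset.mem_univ, true_and] at h1 h2 heq
    have hr : (r : ℕ) = r' := by
      rw [← card_shuffleMask (Nat.lt_succ_iff.1 r.2) σ, heq,
        card_shuffleMask (Nat.lt_succ_iff.1 r'.2) σ']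
    obtain rfl := Fin.ext hr
    rw [eq_of_shuffleMask_eq (Nat.lt_succ_iff.1 r.2) h1 h2 heq]
  · intro s _
    obtain ⟨r, σ, hσ, rfl⟩ := exists_shuffle_of_mask s
    exact ⟨⟨r, σ⟩, by simpa using hσ, rfl⟩
  · rintro ⟨r, σ⟩ h1
    simp only [Finset.mem_sigma, Finset.mem_univ, true_and] at h1
    exact h r σ h1

/-- The exponent of the sign of the shuffle moving the indices in `s` to the front. -/
def maskExp {n : ℕ} (a : Fin n → ZMod 2) (s : Fin n → Bool) : ZMod 2 :=
  ∑ x, ∑ y, if y < x then (if s x = true ∧ s y = false then a x * a y else 0) else 0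

/-- A shuffle is increasing on both blocks, so its inversions are precisely the pairs where an
element outside the mask is smaller than an element inside it. -/
theorem koszulExp_eq_maskExp {n : ℕ} (a : Fin n → ZMod 2) {r : ℕ} {σ : Equiv.Perm (Fin n)}
    (hσ : σ ∈ shuffles n r) : koszulExp a σ = maskExp a (shuffleMask r σ) := by
  rw [mem_shuffles] at hσ
  rw [koszulExp_eq, maskExp, ← Equiv.sum_comp σ (fun x => ∑ y, if y < x then _ else _)]
  refine Finset.sum_congr rfl fun i _ => ?_
  rw [← Equiv.sum_comp σ (fun y => if y < σ i then _ else _)]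
  refine Finset.sum_congr rfl fun j _ => ?_
  rw [shuffleMask_apply, shuffleMask_apply]
  simp only [decide_eq_true_eq, decide_eq_false_iff_not, not_lt]
  by_cases h1 : i < j
  · by_cases h2 : σ j < σ i
    · have : (i : ℕ) < r ∧ r ≤ j := by
        by_contra hc
        exact absurd (hσ i j h1 (by omega)) h2.not_gt
      simp [h1, h2, this]
    · simp [h2]
  · have : ¬ ((i : ℕ) < r ∧ r ≤ j) := by
      rw [Fin.lt_def] at h1; omega
    simp [h1, this]

theorem maskExp_succ {n : ℕ} (a : Fin (n + 1) → ZMod 2) (s : Fin (n + 1) → Bool) :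
    maskExp a s = maskExp (fun i => a i.castSucc) (fun i => s i.castSucc) +
      if s (Fin.last n) = true then
        a (Fin.last n) * ∑ i : Fin n, if s i.castSucc = false then a i.castSucc else 0 else 0 := by
  simp only [maskExp, Fin.sum_univ_castSucc (n := n)]
  simp [Fin.castSucc_lt_last, Finset.mul_sum, (Fin.castSucc_lt_last _).not_gt]
  split_ifs with h <;> simp [h]

end Shuffles

/-! ## Signs as scalars -/

section Signs

/-- The sign `(-1) ^ a` as an element of `K`. -/
def sg (K : Type*) [CommRing K] (a : ZMod 2) : K := ((((-1 : ℤˣ) ^ a : ℤˣ) : ℤ) : K)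

variable {K : Type*} [CommRing K]

@[simp] theorem sg_zero : sg K 0 = 1 := by simp [sg]

@[simp] theorem sg_one : sg K 1 = -1 := by simp [sg]

theorem sg_add (a b : ZMod 2) : sg K (a + b) = sg K a * sg K b := by
  simp [sg, uzpow_add]

theorem sg_mul_self (a : ZMod 2) : sg K a * sg K a = 1 := by
  rw [← sg_add, ZMod.two_add_self, sg_zero]

theorem sg_sum {α : Type*} (s : Finset α) (f : α → ZMod 2) :
    sg K (∑ i ∈ s, f i) = ∏ i ∈ s, sg K (f i) := by
  classical
  induction s using Finset.induction_on with
  | empty => simp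
  | insert a s ha ih => rw [Finset.sum_insert ha, Finset.prod_insert ha, sg_add, ih]

theorem intUnits_smul {M : Type*} [AddCommGroup M] [Module K M] (u : ℤˣ) (x : M) :
    u • x = (((u : ℤˣ) : ℤ) : K) • x := by
  rw [Units.smul_def, Int.cast_smul_eq_zsmul]

theorem uzpow_smul {M : Type*} [AddCommGroup M] [Module K M] (a : ZMod 2) (x : M) :
    ((-1 : ℤˣ) ^ a) • x = sg K a • x := intUnits_smul _ _

theorem sg_smul_smul_self {M : Type*} [AddCommGroup M] [Module K M] (a : ZMod 2) (x : M) :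
    sg K a • sg K a • x = x := by
  rw [smul_smul, sg_mul_self, one_smul]

theorem ZMod.two_eq_zero_or_one (a : ZMod 2) : a = 0 ∨ a = 1 := by
  revert a; decide

end Signs

/-! ## Sign exponents of products of monomials -/

section MonomialSigns

variable {ι : Type*} (p : ι → ZMod 2)

/-- The parity of `y ^ a`. -/
def monoParity (a : ι →₀ ℕ) : ZMod 2 := a.sum fun i n => (n : ZMod 2) * p i

@[simp] theorem monoParity_single (i : ι) : monoParity p (Finsupp.single i 1) = p i := by
  simp [monoParity]

/-- Monomials without odd squares. -/
def IsSuper (m : ι →₀ ℕ) : Prop := ∀ i, p i = 1 → m i ≤ 1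

variable {p}

theorem IsSuper.mono {a b : ι →₀ ℕ} (hb : IsSuper p b) (h : a ≤ b) : IsSuper p a :=
  fun i hi => (h i).trans (hb i hi)

theorem IsSuper.left {a b : ι →₀ ℕ} (h : IsSuper p (a + b)) : IsSuper p a :=
  h.mono le_self_add

theorem IsSuper.right {a b : ι →₀ ℕ} (h : IsSuper p (a + b)) : IsSuper p b :=
  h.mono le_add_self

variable (p)

theorem isSuper_zero : IsSuper p (0 : ι →₀ ℕ) := fun _ _ => Nat.zero_le _

theorem isSuper_single (i : ι) : IsSuper p (Finsupp.single i 1) := fun j _ => by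
  classical
  rw [Finsupp.single_apply]; split_ifs <;> simp

variable [LinearOrder ι]

/-- The exponent of `mulSign`. -/
def mulExp (a b : ι →₀ ℕ) : ZMod 2 :=
  a.sum fun i m => b.sum fun j n => if j < i then (m : ZMod 2) * p i * ((n : ZMod 2) * p j) else 0

theorem mulSign_eq (a b : ι →₀ ℕ) : FormalFun.mulSign p a b = (-1 : ℤˣ) ^ mulExp p a b := by
  simp only [FormalFun.mulSign, mulExp, Finsupp.sum, Finset.sum_filter]

theorem mulExp_add_left (a a' b : ι →₀ ℕ) :
    mulExp p (a + a') b = mulExp p a b + mulExp p a' b := by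
  refine Finsupp.sum_add_index' (by simp) ?_
  intro i m n
  rw [← Finsupp.sum_add]
  refine Finset.sum_congr rfl fun j _ => ?_
  dsimp only
  split_ifs
  · push_cast; ring
  · simp

theorem mulExp_add_right (a b b' : ι →₀ ℕ) :
    mulExp p a (b + b') = mulExp p a b + mulExp p a b' := by
  rw [mulExp, mulExp, mulExp, ← Finsupp.sum_add]
  refine Finset.sum_congr rfl fun i _ => ?_
  refine Finsupp.sum_add_index' (by simp) ?_
  intro j m n
  split_ifs
  · push_cast; ring
  · simp

@[simp] theorem mulExp_zero_left (b : ι →₀ ℕ) : mulExp p 0 b = 0 := by simp [mulExp]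

@[simp] theorem mulExp_zero_right (a : ι →₀ ℕ) : mulExp p a 0 = 0 := by simp [mulExp]

@[simp] theorem mulExp_single_single_self (i : ι) :
    mulExp p (Finsupp.single i 1) (Finsupp.single i 1) = 0 := by
  simp [mulExp]

theorem derivSign_eq (i : ι) (m : ι →₀ ℕ) :
    FormalFun.derivSign p i m = (-1 : ℤˣ) ^ mulExp p (Finsupp.single i 1) m := by
  rw [FormalFun.derivSign, mulExp, Finsupp.sum_single_index]
  · simp only [Finsupp.sum, Finset.sum_filter, Nat.cast_one, one_mul]
  · simp

/-- The parity of the number of odd squares in `y ^ a * y ^ b`. -/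
def dotExp (a b : ι →₀ ℕ) : ZMod 2 :=
  a.sum fun i m => b.sum fun j n => if j = i then (m : ZMod 2) * p i * ((n : ZMod 2) * p j) else 0

/-- The product of the two parities sums over all pairs of factors; pairs with i ≠ j are counted by
exactly one of the two `mulExp`, and the diagonal is `dotExp`, which vanishes when the product has
no odd square. -/
theorem mulExp_comm (a b : ι →₀ ℕ) :
    mulExp p a b = mulExp p b a + monoParity p a * monoParity p b + dotExp p a b := by
  have h : mulExp p b a = a.sum fun i m => b.sum fun j n =>
      if i < j then (m : ZMod 2) * p i * ((n : ZMod 2) * p j) else 0 := by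
    rw [mulExp, Finsupp.sum, Finsupp.sum, Finset.sum_congr rfl fun _ _ => Finsupp.sum.eq_1 _ _,
      Finset.sum_comm]
    refine Finset.sum_congr rfl fun i _ => Finset.sum_congr rfl fun j _ => ?_
    simp only [mul_comm]
  rw [h, mulExp, dotExp, monoParity, monoParity, Finsupp.sum_mul, ← Finsupp.sum_add,
    ← Finsupp.sum_add]
  refine Finset.sum_congr rfl fun i _ => ?_
  dsimp only
  rw [Finsupp.mul_sum, ← Finsupp.sum_add, ← Finsupp.sum_add]
  refine Finset.sum_congr rfl fun j _ => ?_
  generalize ((a i : ZMod 2) * p i * ((b j : ZMod 2) * p j)) = x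
  rcases lt_trichotomy i j with h | h | h
  · simp [h, h.not_gt, h.ne', ZMod.two_add_self]
  · simp [h, ZMod.two_add_self]
  · simp [h, h.not_gt, h.ne]

theorem dotExp_single (a : ι →₀ ℕ) (i : ι) :
    dotExp p a (Finsupp.single i 1) = (a i : ZMod 2) * p i := by
  have h : ∀ j, ((Finsupp.single i 1 : ι →₀ ℕ).sum fun l n =>
      if l = j then ((a j : ℕ) : ZMod 2) * p j * ((n : ZMod 2) * p l) else 0) =
      if i = j then ((a j : ℕ) : ZMod 2) * p j * p i else 0 := by
    intro j
    rw [Finsupp.sum_single_index] <;> simp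
  rw [dotExp, Finsupp.sum]
  simp only [h]
  rw [Finset.sum_ite_eq]
  split_ifs with hi
  · rcases ZMod.two_eq_zero_or_one (p i) with h | h <;> simp [h]
  · rw [Finsupp.notMem_support_iff.1 hi]; simp

theorem dotExp_eq_zero {a b : ι →₀ ℕ} (h : IsSuper p (a + b)) : dotExp p a b = 0 := by
  refine Finset.sum_eq_zero fun i hi => Finset.sum_eq_zero fun j hj => ?_
  rw [Finsupp.mem_support_iff] at hi hj
  dsimp only
  split_ifs with hij
  · subst hij
    rcases ZMod.two_eq_zero_or_one (p j) with h' | h'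
    · simp [h']
    · have := h j h'
      rw [Finsupp.add_apply] at this
      omega
  · rfl

end MonomialSigns

/-! ## The algebra of formal functions -/

namespace FormalFun

variable {K ι : Type*} [CommRing K] {p : ι → ZMod 2}

theorem coeff_of_isSuper (f : FormalFun K p) {m : ι →₀ ℕ} (h : IsSuper p m) :
    f.coeff m = f ⟨m, h⟩ := dif_pos h

theorem coeff_of_not_isSuper (f : FormalFun K p) {m : ι →₀ ℕ} (h : ¬ IsSuper p m) :
    f.coeff m = 0 := dif_neg h

theorem coeff_coe (f : FormalFun K p) (m : SuperMonomial p) : f.coeff m.1 = f m :=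
  dif_pos m.2

theorem isSuper_of_coeff_ne_zero {f : FormalFun K p} {m : ι →₀ ℕ} (h : f.coeff m ≠ 0) :
    IsSuper p m := by
  by_contra hc
  exact h (f.coeff_of_not_isSuper hc)

theorem ext_coeff {f g : FormalFun K p} (h : ∀ m, IsSuper p m → f.coeff m = g.coeff m) : f = g := by
  funext m
  exact (coeff_coe f m).symm.trans ((h _ m.2).trans (coeff_coe g m))

/-- The coefficient of a monomial as a linear functional. -/
noncomputable def coeffLin (K : Type*) [CommRing K] (p : ι → ZMod 2) (m : ι →₀ ℕ) :
    FormalFun K p →ₗ[K] K where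
  toFun f := f.coeff m
  map_add' f g := by
    by_cases h : IsSuper p m
    · simp only [coeff_of_isSuper _ h]; rfl
    · simp only [coeff_of_not_isSuper _ h, add_zero]
  map_smul' c f := by
    by_cases h : IsSuper p m
    · simp only [coeff_of_isSuper _ h]; rfl
    · simp only [coeff_of_not_isSuper _ h, smul_zero]

theorem coeffLin_apply (m : ι →₀ ℕ) (f : FormalFun K p) : coeffLin K p m f = f.coeff m := rfl

theorem coeff_add (f g : FormalFun K p) (m : ι →₀ ℕ) : (f + g).coeff m = f.coeff m + g.coeff m :=
  (coeffLin K p m).map_add f g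

theorem coeff_sub (f g : FormalFun K p) (m : ι →₀ ℕ) : (f - g).coeff m = f.coeff m - g.coeff m :=
  (coeffLin K p m).map_sub f g

theorem coeff_smul (c : K) (f : FormalFun K p) (m : ι →₀ ℕ) : (c • f).coeff m = c * f.coeff m :=
  (coeffLin K p m).map_smul c f

theorem coeff_zero (m : ι →₀ ℕ) : (0 : FormalFun K p).coeff m = 0 :=
  (coeffLin K p m).map_zero

theorem coeff_sum {α : Type*} (s : Finset α) (f : α → FormalFun K p) (m : ι →₀ ℕ) :
    (∑ i ∈ s, f i).coeff m = ∑ i ∈ s, (f i).coeff m :=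
  map_sum (coeffLin K p m) f s

theorem monoParity_eq_of_hasParity {f : FormalFun K p} {a : ZMod 2} (hf : f.HasParity a)
    {m : ι →₀ ℕ} (h : f.coeff m ≠ 0) : monoParity p m = a := by
  have hm := isSuper_of_coeff_ne_zero h
  rw [coeff_of_isSuper _ hm] at h
  exact hf ⟨m, hm⟩ h

variable [LinearOrder ι]

theorem coeff_mul (f g : FormalFun K p) {m : ι →₀ ℕ} (h : IsSuper p m) :
    (f * g).coeff m = ∑ ab ∈ Finset.HasAntidiagonal.antidiagonal m,
      sg K (mulExp p ab.1 ab.2) * (f.coeff ab.1 * g.coeff ab.2) := by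
  rw [coeff_of_isSuper _ h]
  change ∑ ab ∈ Finset.HasAntidiagonal.antidiagonal m, _ = _
  refine Finset.sum_congr rfl fun ab _ => ?_
  rw [mulSign_eq, uzpow_smul (K := K), smul_eq_mul]

/-- Since `mulExp` is additive in each variable, both bracketings of a triple product of monomials
carry the sum of the three pairwise exponents. -/
protected theorem mul_assoc (f g h : FormalFun K p) : f * g * h = f * (g * h) := by
  refine ext_coeff fun m hm => ?_
  have e1 : (f * g * h).coeff m = ∑ x ∈ Finset.HasAntidiagonal.antidiagonal m,
      ∑ y ∈ Finset.HasAntidiagonal.antidiagonal x.1,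
        sg K (mulExp p x.1 x.2) * ((sg K (mulExp p y.1 y.2) * (f.coeff y.1 * g.coeff y.2)) *
          h.coeff x.2) := by
    rw [coeff_mul _ _ hm]
    refine Finset.sum_congr rfl fun x hx => ?_
    rw [Finset.HasAntidiagonal.mem_antidiagonal] at hx
    rw [coeff_mul _ _ (IsSuper.left (hx ▸ hm)), Finset.sum_mul, Finset.mul_sum]
  have e2 : (f * (g * h)).coeff m = ∑ x ∈ Finset.HasAntidiagonal.antidiagonal m,
      ∑ y ∈ Finset.HasAntidiagonal.antidiagonal x.2,
        sg K (mulExp p x.1 x.2) * (f.coeff x.1 * (sg K (mulExp p y.1 y.2) *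
          (g.coeff y.1 * h.coeff y.2))) := by
    rw [coeff_mul _ _ hm]
    refine Finset.sum_congr rfl fun x hx => ?_
    rw [Finset.HasAntidiagonal.mem_antidiagonal] at hx
    rw [coeff_mul _ _ (IsSuper.right (hx ▸ hm)), Finset.mul_sum, Finset.mul_sum]
  rw [e1, e2, Finset.sum_sigma', Finset.sum_sigma']
  refine Finset.sum_nbij' (fun ⟨⟨_, j⟩, ⟨k, l⟩⟩ => ⟨(k, l + j), (l, j)⟩)
    (fun ⟨⟨i, _⟩, ⟨k, l⟩⟩ => ⟨(i + k, l), (i, k)⟩) ?_ ?_ ?_ ?_ ?_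
  · rintro ⟨⟨i, j⟩, ⟨k, l⟩⟩ h
    simp only [Finset.mem_sigma, Finset.HasAntidiagonal.mem_antidiagonal] at h ⊢
    rw [← h.1, ← h.2, add_assoc]; simp
  · rintro ⟨⟨i, j⟩, ⟨k, l⟩⟩ h
    simp only [Finset.mem_sigma, Finset.HasAntidiagonal.mem_antidiagonal] at h ⊢
    rw [← h.1, ← h.2, add_assoc]; simp
  · rintro ⟨⟨i, j⟩, ⟨k, l⟩⟩ h
    simp only [Finset.mem_sigma, Finset.HasAntidiagonal.mem_antidiagonal] at h
    simp [h.2]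
  · rintro ⟨⟨i, j⟩, ⟨k, l⟩⟩ h
    simp only [Finset.mem_sigma, Finset.HasAntidiagonal.mem_antidiagonal] at h
    simp [h.2]
  · rintro ⟨⟨i, j⟩, ⟨k, l⟩⟩ h
    simp only [Finset.mem_sigma, Finset.HasAntidiagonal.mem_antidiagonal] at h
    dsimp only
    rw [← h.2, mulExp_add_left, mulExp_add_right, sg_add, sg_add]
    ring

noncomputable instance : NonUnitalRing (FormalFun K p) :=
  { (inferInstance : AddCommGroup (FormalFun K p)),
    (inferInstance : Mul (FormalFun K p)) with
    left_distrib := fun f g h => ext_coeff fun m hm => by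
      rw [coeff_add, coeff_mul _ _ hm, coeff_mul _ _ hm, coeff_mul _ _ hm, ← Finset.sum_add_distrib]
      refine Finset.sum_congr rfl fun x _ => ?_
      rw [coeff_add]; ring
    right_distrib := fun f g h => ext_coeff fun m hm => by
      rw [coeff_add, coeff_mul _ _ hm, coeff_mul _ _ hm, coeff_mul _ _ hm, ← Finset.sum_add_distrib]
      refine Finset.sum_congr rfl fun x _ => ?_
      rw [coeff_add]; ring
    zero_mul := fun f => ext_coeff fun m hm => by
      rw [coeff_mul _ _ hm]
      simp [coeff_zero]
    mul_zero := fun f => ext_coeff fun m hm => by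
      rw [coeff_mul _ _ hm]
      simp [coeff_zero]
    mul_assoc := FormalFun.mul_assoc }

instance : IsScalarTower K (FormalFun K p) (FormalFun K p) where
  smul_assoc c f g := ext_coeff fun m hm => by
    rw [smul_eq_mul, smul_eq_mul, coeff_smul, coeff_mul _ _ hm, coeff_mul _ _ hm, Finset.mul_sum]
    refine Finset.sum_congr rfl fun x _ => ?_
    rw [coeff_smul]; ring

instance : SMulCommClass K (FormalFun K p) (FormalFun K p) where
  smul_comm c f g := ext_coeff fun m hm => by
    rw [smul_eq_mul, smul_eq_mul, coeff_smul, coeff_mul _ _ hm, coeff_mul _ _ hm, Finset.mul_sum]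
    refine Finset.sum_congr rfl fun x _ => ?_
    rw [coeff_smul]; ring

/-- Supercommutativity. -/
theorem mul_superComm {f g : FormalFun K p} {a b : ZMod 2} (hf : f.HasParity a)
    (hg : g.HasParity b) : f * g = sg K (a * b) • (g * f) := by
  refine ext_coeff fun m hm => ?_
  rw [coeff_smul, coeff_mul _ _ hm, coeff_mul _ _ hm,
    Finsupp.sum_antidiagonal_swap m fun a b => sg K (mulExp p a b) * (f.coeff a * g.coeff b),
    Finset.mul_sum]
  refine Finset.sum_congr rfl fun x hx => ?_
  rw [Finset.HasAntidiagonal.mem_antidiagonal] at hx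
  by_cases h1 : f.coeff x.2 = 0
  · simp [h1]
  by_cases h2 : g.coeff x.1 = 0
  · simp [h2]
  rw [mulExp_comm, dotExp_eq_zero p (by rw [add_comm, hx]; exact hm), monoParity_eq_of_hasParity hf h1,
    monoParity_eq_of_hasParity hg h2, add_zero, sg_add]
  ring

theorem coeff_partialDeriv (i : ι) (f : FormalFun K p) (m : ι →₀ ℕ) :
    (partialDeriv K p i f).coeff m = sg K (mulExp p (Finsupp.single i 1) m) *
      (((m i + 1 : ℕ) : K) * f.coeff (m + Finsupp.single i 1)) := by
  by_cases h : IsSuper p m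
  · rw [coeff_of_isSuper _ h]
    change derivSign p i m • (((m i + 1 : ℕ) : K) * f.coeff (m + Finsupp.single i 1)) = _
    rw [derivSign_eq, uzpow_smul (K := K), smul_eq_mul]
  · rw [coeff_of_not_isSuper _ h, coeff_of_not_isSuper f fun h' => h h'.left]
    simp

/-- Shifting the first exponent by y i misses only the decompositions in which y i does not occur in
the first factor, and those have weight zero on the right. -/
theorem sum_antidiagonal_add_single (m : ι →₀ ℕ) (i : ι) (F : (ι →₀ ℕ) → (ι →₀ ℕ) → K) :
    ∑ x ∈ Finset.HasAntidiagonal.antidiagonal m, ((x.1 i + 1 : ℕ) : K) *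
      F (x.1 + Finsupp.single i 1) x.2 =
    ∑ x ∈ Finset.HasAntidiagonal.antidiagonal (m + Finsupp.single i 1 : ι →₀ ℕ),
      ((x.1 i : ℕ) : K) * F x.1 x.2 := by
  refine Finset.sum_of_injOn (fun x => (x.1 + Finsupp.single i 1, x.2)) ?_ ?_ ?_ ?_
  · rintro ⟨a, b⟩ _ ⟨a', b'⟩ _ h
    simpa using h
  · rintro ⟨a, b⟩ h
    simp only [Finset.mem_coe, Finset.HasAntidiagonal.mem_antidiagonal] at h ⊢
    rw [← h, add_right_comm]
  · rintro ⟨a, b⟩ h h'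
    rw [Finset.HasAntidiagonal.mem_antidiagonal] at h
    suffices a i = 0 by simp [this]
    by_contra hne
    refine h' ⟨(a - Finsupp.single i 1, b), ?_, ?_⟩
    · rw [Finset.mem_coe, Finset.HasAntidiagonal.mem_antidiagonal]
      have hle : Finsupp.single i 1 ≤ a := by
        rw [Finsupp.single_le_iff]; omega
      dsimp only at h ⊢
      rw [← add_left_inj (Finsupp.single i 1), ← h, add_right_comm, tsub_add_cancel_of_le hle]
    · have hle : Finsupp.single i 1 ≤ a := by
        rw [Finsupp.single_le_iff]; omega
      simp [tsub_add_cancel_of_le hle]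
  · rintro ⟨a, b⟩ _
    simp

/-- `∂/∂y i` is a superderivation. -/
theorem partialDeriv_mul (i : ι) {f : FormalFun K p} {a : ZMod 2} (hf : f.HasParity a)
    (g : FormalFun K p) : partialDeriv K p i (f * g) =
      partialDeriv K p i f * g + sg K (p i * a) • (f * partialDeriv K p i g) := by
  refine ext_coeff fun m hm => ?_
  set δ : ι →₀ ℕ := Finsupp.single i 1 with hδ
  -- Both terms of the Leibniz rule are rewritten as sums over decompositions of m + δ, with weights
  -- x.1 i and x.2 i; these weights add up to the factor m i + 1 on the left.
  have e1 : (partialDeriv K p i f * g).coeff m =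
      ∑ x ∈ Finset.HasAntidiagonal.antidiagonal (m + δ), (x.1 i : K) *
        (sg K (mulExp p x.1 x.2 + mulExp p δ x.2 + mulExp p δ x.1) *
          (f.coeff x.1 * g.coeff x.2)) := by
    rw [coeff_mul _ _ hm, ← sum_antidiagonal_add_single m i fun a b =>
      sg K (mulExp p a b + mulExp p δ b + mulExp p δ a) * (f.coeff a * g.coeff b)]
    refine Finset.sum_congr rfl fun x _ => ?_
    rw [coeff_partialDeriv, ← hδ, mulExp_add_left, mulExp_add_right, hδ, mulExp_single_single_self,
      ← hδ, add_zero]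
    have : mulExp p x.1 x.2 + mulExp p δ x.2 + mulExp p δ x.2 + mulExp p δ x.1 =
        mulExp p x.1 x.2 + mulExp p δ x.1 := by
      rw [add_assoc (mulExp p x.1 x.2), ZMod.two_add_self, add_zero]
    rw [this, sg_add]
    ring
  have e2 : (sg K (p i * a) • (f * partialDeriv K p i g)).coeff m =
      ∑ x ∈ Finset.HasAntidiagonal.antidiagonal (m + δ), (x.2 i : K) *
        (sg K (mulExp p x.1 x.2 + mulExp p δ x.2 + mulExp p δ x.1 + (x.1 i : ZMod 2) * p i) *
          (f.coeff x.1 * g.coeff x.2)) := by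
    rw [coeff_smul, coeff_mul _ _ hm, Finsupp.sum_antidiagonal_swap m fun a b =>
        sg K (mulExp p a b) * (f.coeff a * (partialDeriv K p i g).coeff b),
      Finsupp.sum_antidiagonal_swap (m + δ) fun a b => (b i : K) *
        (sg K (mulExp p a b + mulExp p δ b + mulExp p δ a + (a i : ZMod 2) * p i) *
          (f.coeff a * g.coeff b))]
    rw [← sum_antidiagonal_add_single m i fun b a =>
      sg K (mulExp p a b + mulExp p δ b + mulExp p δ a + (a i : ZMod 2) * p i) *
        (f.coeff a * g.coeff b), Finset.mul_sum]
    refine Finset.sum_congr rfl fun x _ => ?_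
    rw [coeff_partialDeriv, ← hδ]
    by_cases h0 : f.coeff x.2 = 0
    · simp [h0]
    have h1 : monoParity p x.2 = a := monoParity_eq_of_hasParity hf h0
    have h2 := mulExp_comm p x.2 δ
    rw [hδ, dotExp_single, ← hδ, h1, hδ, monoParity_single, ← hδ] at h2
    rw [mulExp_add_right, mulExp_add_right, h2, hδ, mulExp_single_single_self, ← hδ, add_zero]
    have : mulExp p x.2 x.1 + (mulExp p δ x.2 + a * p i + (x.2 i : ZMod 2) * p i) + mulExp p δ x.1 +
        mulExp p δ x.2 + (x.2 i : ZMod 2) * p i = mulExp p x.2 x.1 + mulExp p δ x.1 + p i * a := by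
      generalize mulExp p x.2 x.1 = t1
      generalize mulExp p δ x.2 = t2
      generalize (x.2 i : ZMod 2) * p i = t3
      generalize mulExp p δ x.1 = t4
      rw [mul_comm a]
      generalize p i * a = t5
      revert t1 t2 t3 t4 t5; decide
    rw [this, sg_add, sg_add]
    ring
  rw [coeff_add, e1, e2, coeff_partialDeriv, ← hδ, ← Finset.sum_add_distrib]
  by_cases hs : IsSuper p (m + δ)
  · rw [coeff_mul _ _ hs, Finset.mul_sum, Finset.mul_sum]
    refine Finset.sum_congr rfl fun x hx => ?_
    rw [Finset.HasAntidiagonal.mem_antidiagonal] at hx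
    have h1 : ((m i + 1 : ℕ) : K) = (x.1 i : K) + (x.2 i : K) := by
      have : m i + 1 = x.1 i + x.2 i := by
        rw [← Finsupp.add_apply, hx, hδ]; simp
      rw [this]; push_cast; rfl
    have h2 : mulExp p δ m = mulExp p δ x.2 + mulExp p δ x.1 := by
      rw [add_comm, ← mulExp_add_right, hx, mulExp_add_right, hδ, mulExp_single_single_self,
        add_zero]
    -- If y i is odd, its total exponent is at most one, so whenever x.2 i is nonzero x.1 i is zero
    -- and the extra sign disappears.
    have h3 : (x.2 i : K) * sg K ((x.1 i : ZMod 2) * p i) = x.2 i := by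
      rcases ZMod.two_eq_zero_or_one (p i) with h | h
      · simp [h]
      · have h4 := hs i h
        rw [← hx, Finsupp.add_apply] at h4
        by_cases h5 : x.2 i = 0
        · simp [h5]
        · have : x.1 i = 0 := by omega
          simp [this]
    rw [h1, h2, sg_add _ ((x.1 i : ZMod 2) * p i), add_assoc (mulExp p x.1 x.2), sg_add (mulExp p x.1 x.2)]
    linear_combination -(sg K (mulExp p x.1 x.2) * sg K (mulExp p δ x.2 + mulExp p δ x.1) *
      (f.coeff x.1 * g.coeff x.2)) * h3
  -- Here y i is odd and already divides y ^ m. The left side is zero; on the right every surviving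
  -- decomposition has y i once in each factor, and its two contributions have opposite signs.
  · rw [coeff_of_not_isSuper _ hs, mul_zero, mul_zero, eq_comm]
    refine Finset.sum_eq_zero fun x hx => ?_
    rw [Finset.HasAntidiagonal.mem_antidiagonal] at hx
    by_cases h1 : f.coeff x.1 = 0
    · simp [h1]
    by_cases h2 : g.coeff x.2 = 0
    · simp [h2]
    have hp : p i = 1 ∧ m i = 1 := by
      unfold IsSuper at hs
      push Not at hs
      obtain ⟨j, hj, hj'⟩ := hs
      have h3 := hm j hj
      have : j = i := by
        by_contra hne
        rw [Finsupp.add_apply, hδ, Finsupp.single_apply, if_neg fun h => hne h.symm] at hj'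
        omega
      subst this
      rw [Finsupp.add_apply, hδ, Finsupp.single_apply, if_pos rfl] at hj'
      exact ⟨hj, by omega⟩
    have h3 := isSuper_of_coeff_ne_zero h1 i hp.1
    have h4 := isSuper_of_coeff_ne_zero h2 i hp.1
    have h5 : x.1 i + x.2 i = 2 := by
      rw [← Finsupp.add_apply, hx, hδ]; simp [hp.2]
    have h6 : x.1 i = 1 := by omega
    have h7 : x.2 i = 1 := by omega
    rw [h6, h7, hp.1, sg_add _ (((1 : ℕ) : ZMod 2) * 1)]
    simp

end FormalFun

/-! ## Degrees and monomials -/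

section Degrees

variable {ι R : Type*} [CommRing R]

/-- The degree of `y ^ m` when `y i` has degree `w i`. -/
def monoDeg (w : ι → R) (m : ι →₀ ℕ) : R := m.sum fun i n => (n : R) * w i

theorem monoDeg_add (w : ι → R) (a b : ι →₀ ℕ) : monoDeg w (a + b) = monoDeg w a + monoDeg w b := by
  classical
  refine Finsupp.sum_add_index' (by simp) ?_
  intro i m n; push_cast; ring

@[simp] theorem monoDeg_zero (w : ι → R) : monoDeg w 0 = 0 := Finsupp.sum_zero_index

@[simp] theorem monoDeg_single (w : ι → R) (i : ι) : monoDeg w (Finsupp.single i 1) = w i := by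
  simp [monoDeg]

end Degrees

namespace FormalFun

variable {K ι : Type*} [CommRing K] {p : ι → ZMod 2}

/-- All monomials of `f` have degree `b`. -/
def HasDeg {R : Type*} [CommRing R] (w : ι → R) (f : FormalFun K p) (b : R) : Prop :=
  ∀ m : ι →₀ ℕ, f.coeff m ≠ 0 → monoDeg w m = b

theorem hasParity_iff {f : FormalFun K p} {a : ZMod 2} : f.HasParity a ↔ f.HasDeg p a := by
  constructor
  · intro h m hm
    exact monoParity_eq_of_hasParity h hm
  · intro h m hm
    rw [← coeff_coe f m] at hm
    exact h m.1 hm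

theorem hasWeight_iff {w : ι → ℤ} {f : FormalFun K p} {a : ℤ} :
    f.HasWeight w a ↔ f.HasDeg w a := by
  constructor
  · intro h m hm
    have hs := isSuper_of_coeff_ne_zero hm
    rw [coeff_of_isSuper _ hs] at hm
    have := h ⟨m, hs⟩ hm
    simpa [monoDeg] using this
  · intro h m hm
    rw [← coeff_coe f m] at hm
    have := h m.1 hm
    simpa [monoDeg] using this

section

variable {R : Type*} [CommRing R] {w : ι → R}

theorem HasDeg.add {f g : FormalFun K p} {b : R} (hf : f.HasDeg w b) (hg : g.HasDeg w b) :
    (f + g).HasDeg w b := by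
  intro m hm
  by_cases h : f.coeff m = 0
  · refine hg m fun h' => hm ?_
    rw [coeff_add, h, h', add_zero]
  · exact hf m h

theorem HasDeg.smul {f : FormalFun K p} {b : R} (hf : f.HasDeg w b) (c : K) :
    (c • f).HasDeg w b := by
  intro m hm
  refine hf m fun h' => hm ?_
  rw [coeff_smul, h', mul_zero]

end

open Classical in
/-- The monomial `y ^ s`, zero if `s` contains an odd square. -/
noncomputable def mono (K : Type*) [CommRing K] (p : ι → ZMod 2) (s : ι →₀ ℕ) : FormalFun K p :=
  fun m => if m.1 = s then 1 else 0

open Classical in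
theorem coeff_mono {s : ι →₀ ℕ} (hs : IsSuper p s) (m : ι →₀ ℕ) :
    (mono K p s).coeff m = if m = s then 1 else 0 := by
  by_cases h : IsSuper p m
  · rw [coeff_of_isSuper _ h]; rfl
  · rw [coeff_of_not_isSuper _ h, if_neg]
    rintro rfl
    exact h hs

theorem coord_eq_mono (j : ι) : coord K p j = mono K p (Finsupp.single j 1) := rfl

variable [LinearOrder ι]

section

variable {R : Type*} [CommRing R] {w : ι → R}

theorem HasDeg.mul {f g : FormalFun K p} {b c : R} (hf : f.HasDeg w b) (hg : g.HasDeg w c) :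
    (f * g).HasDeg w (b + c) := by
  intro m hm
  rw [coeff_mul _ _ (isSuper_of_coeff_ne_zero hm)] at hm
  obtain ⟨x, hx, hne⟩ := Finset.exists_ne_zero_of_sum_ne_zero hm
  rw [Finset.HasAntidiagonal.mem_antidiagonal] at hx
  rw [← hx, monoDeg_add, hf x.1 fun h => hne (by simp [h]), hg x.2 fun h => hne (by simp [h])]

theorem HasDeg.partialDeriv {f : FormalFun K p} {b : R} (hf : f.HasDeg w b) (i : ι) :
    (FormalFun.partialDeriv K p i f).HasDeg w (b - w i) := by
  intro m hm
  rw [coeff_partialDeriv] at hm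
  have := hf (m + Finsupp.single i 1) fun h => hm (by simp [h])
  rw [monoDeg_add, monoDeg_single] at this
  rw [← this, add_sub_cancel_right]

end

theorem hasDeg_mono {R : Type*} [CommRing R] {w : ι → R} {s : ι →₀ ℕ} (hs : IsSuper p s) :
    (mono K p s).HasDeg w (monoDeg w s) := by
  classical
  intro m hm
  rw [coeff_mono hs] at hm
  split_ifs at hm with h
  · rw [h]
  · exact absurd rfl hm

theorem hasDeg_coord {R : Type*} [CommRing R] {w : ι → R} (j : ι) :
    (coord K p j).HasDeg w (w j) := by
  have := hasDeg_mono (K := K) (w := w) (isSuper_single p j)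
  rwa [monoDeg_single] at this

theorem mono_mul_mono {a b : ι →₀ ℕ} (h : IsSuper p (a + b)) :
    mono K p a * mono K p b = sg K (mulExp p a b) • mono K p (a + b) := by
  classical
  refine ext_coeff fun m hm => ?_
  rw [coeff_smul, coeff_mul _ _ hm, coeff_mono h]
  split_ifs with hma
  · rw [Finset.sum_eq_single (a, b)]
    · rw [coeff_mono h.left, coeff_mono h.right]; simp
    · rintro ⟨x, y⟩ _ hne
      rw [coeff_mono h.left, coeff_mono h.right]
      by_cases h1 : x = a
      · by_cases h2 : y = b
        · exact absurd (Prod.ext h1 h2) hne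
        · simp [h2]
      · simp [h1]
    · intro h'
      rw [Finset.HasAntidiagonal.mem_antidiagonal] at h'
      exact absurd hma.symm h'
  · rw [mul_zero]
    refine Finset.sum_eq_zero ?_
    rintro ⟨x, y⟩ hxy
    rw [Finset.HasAntidiagonal.mem_antidiagonal] at hxy
    rw [coeff_mono h.left, coeff_mono h.right]
    by_cases h1 : x = a
    · by_cases h2 : y = b
      · exact absurd (by rw [← hxy, h1, h2]) hma
      · simp [h2]
    · simp [h1]

theorem mono_zero_mul (f : FormalFun K p) : mono K p 0 * f = f := by
  classical
  refine ext_coeff fun m hm => ?_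
  rw [coeff_mul _ _ hm, Finset.sum_eq_single (0, m)]
  · rw [coeff_mono (isSuper_zero p)]; simp
  · rintro ⟨x, y⟩ hxy hne
    rw [Finset.HasAntidiagonal.mem_antidiagonal] at hxy
    rw [coeff_mono (isSuper_zero p), if_neg]
    · simp
    · rintro rfl
      rw [zero_add] at hxy
      exact hne (by rw [← hxy])
  · simp

theorem mul_mono_zero (f : FormalFun K p) : f * mono K p 0 = f := by
  classical
  refine ext_coeff fun m hm => ?_
  rw [coeff_mul _ _ hm, Finset.sum_eq_single (m, 0)]
  · rw [coeff_mono (isSuper_zero p)]; simp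
  · rintro ⟨x, y⟩ hxy hne
    rw [Finset.HasAntidiagonal.mem_antidiagonal] at hxy
    rw [coeff_mono (isSuper_zero p), if_neg]
    · simp
    · rintro rfl
      rw [add_zero] at hxy
      exact hne (by rw [← hxy])
  · simp

theorem coeff_mul_zero (f g : FormalFun K p) : (f * g).coeff 0 = f.coeff 0 * g.coeff 0 := by
  rw [coeff_mul _ _ (isSuper_zero p)]
  simp

theorem partialDeriv_coord (i j : ι) :
    partialDeriv K p i (coord K p j) = (if i = j then (1 : K) else 0) • mono K p 0 := by
  classical
  refine ext_coeff fun m _ => ?_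
  rw [coeff_partialDeriv, coord_eq_mono, coeff_mono (isSuper_single p j), coeff_smul,
    coeff_mono (isSuper_zero p)]
  by_cases hm : m = 0
  · subst hm
    simp [Finsupp.single_left_inj]
  · have : m + Finsupp.single i 1 ≠ Finsupp.single j 1 := by
      intro h
      have h1 := congrArg (fun x => Finsupp.degree x) h
      simp only [map_add, Finsupp.degree_single] at h1
      exact hm ((Finsupp.degree_eq_zero_iff m).1 (by omega))
    rw [if_neg this, if_neg hm]; simp

theorem partialDeriv_comm (i j : ι) (f : FormalFun K p) :
    partialDeriv K p i (partialDeriv K p j f) =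
      sg K (p i * p j) • partialDeriv K p j (partialDeriv K p i f) := by
  refine ext_coeff fun m _ => ?_
  rw [coeff_smul, coeff_partialDeriv, coeff_partialDeriv, coeff_partialDeriv, coeff_partialDeriv]
  by_cases hij : i = j
  · subst hij
    rcases ZMod.two_eq_zero_or_one (p i) with h | h
    · simp [h]
    -- An odd coordinate cannot occur twice, so the second derivative vanishes.
    · rw [coeff_of_not_isSuper f]
      · simp
      · intro h'
        have := h' i h
        simp at this
  · have h := mulExp_comm p (Finsupp.single j 1) (Finsupp.single i 1)
    rw [dotExp_single, monoParity_single, monoParity_single, Finsupp.single_apply,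
      if_neg (Ne.symm hij)] at h
    rw [mulExp_add_right, mulExp_add_right, h, add_right_comm m]
    simp only [Finsupp.add_apply, Finsupp.single_apply, if_neg hij, if_neg (Ne.symm hij), sg_add,
      Nat.cast_zero, zero_mul, add_zero, mul_comm (p j)]
    ring

end FormalFun

/-! ## Vector fields -/

section VectorFieldLemmas

open FormalFun

variable {K ι : Type*} [CommRing K] {p : ι → ZMod 2}

theorem Finsupp.exists_single_add {s : ι →₀ ℕ} (hs : s ≠ 0) :
    ∃ i t, s = Finsupp.single i 1 + t := by
  obtain ⟨i, hi⟩ := Finsupp.support_nonempty_iff.2 hs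
  refine ⟨i, s - Finsupp.single i 1, ?_⟩
  rw [add_tsub_cancel_of_le]
  rw [Finsupp.single_le_iff]
  exact Nat.one_le_iff_ne_zero.2 (Finsupp.mem_support_iff.1 hi)

/-- Each coefficient of `X f` depends on finitely many coefficients of `f`. -/
def FinDep (X : FormalFun K p →ₗ[K] FormalFun K p) : Prop :=
  ∀ m : ι →₀ ℕ, ∃ S : Finset (ι →₀ ℕ), ∀ f : FormalFun K p,
    (∀ s ∈ S, f.coeff s = 0) → (X f).coeff m = 0

theorem finDep_iff {X : FormalFun K p →ₗ[K] FormalFun K p} : FinDep X ↔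
    ∀ m : SuperMonomial p, ∃ S : Finset (ι →₀ ℕ), ∀ f : FormalFun K p,
      (∀ s ∈ S, f.coeff s = 0) → X f m = 0 := by
  constructor
  · intro h m
    obtain ⟨S, hS⟩ := h m.1
    exact ⟨S, fun f hf => by rw [← coeff_coe (X f) m]; exact hS f hf⟩
  · intro h m
    by_cases hm : IsSuper p m
    · obtain ⟨S, hS⟩ := h ⟨m, hm⟩
      exact ⟨S, fun f hf => by rw [coeff_of_isSuper _ hm]; exact hS f hf⟩
    · exact ⟨∅, fun f _ => coeff_of_not_isSuper _ hm⟩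

theorem FinDep.comp {X Y : FormalFun K p →ₗ[K] FormalFun K p} (hX : FinDep X) (hY : FinDep Y) :
    FinDep (X ∘ₗ Y) := by
  classical
  intro m
  obtain ⟨S, hS⟩ := hX m
  choose T hT using hY
  refine ⟨S.biUnion T, fun f hf => hS _ fun s hs => hT s f fun t ht => hf t ?_⟩
  exact Finset.mem_biUnion.2 ⟨s, hs, ht⟩

theorem FinDep.sub {X Y : FormalFun K p →ₗ[K] FormalFun K p} (hX : FinDep X) (hY : FinDep Y) :
    FinDep (X - Y) := by
  classical
  intro m
  obtain ⟨S, hS⟩ := hX m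
  obtain ⟨T, hT⟩ := hY m
  refine ⟨S ∪ T, fun f hf => ?_⟩
  rw [LinearMap.sub_apply, coeff_sub, hS f fun s hs => hf s (Finset.mem_union_left _ hs),
    hT f fun s hs => hf s (Finset.mem_union_right _ hs), sub_zero]

theorem FinDep.smul {X : FormalFun K p →ₗ[K] FormalFun K p} (hX : FinDep X) (c : K) :
    FinDep (c • X) := by
  intro m
  obtain ⟨S, hS⟩ := hX m
  exact ⟨S, fun f hf => by rw [LinearMap.smul_apply, coeff_smul, hS f hf, mul_zero]⟩

variable [LinearOrder ι]

theorem finDep_partialDeriv (i : ι) : FinDep (partialDeriv K p i) := by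
  intro m
  refine ⟨{m + Finsupp.single i 1}, fun f hf => ?_⟩
  rw [coeff_partialDeriv, hf _ (Finset.mem_singleton_self _)]
  simp

/-- A functional depending on finitely many coefficients is determined by its values on monomials. -/
theorem eq_zero_of_mono {L : FormalFun K p →ₗ[K] K}
    (hL : ∃ S : Finset (ι →₀ ℕ), ∀ f : FormalFun K p, (∀ s ∈ S, f.coeff s = 0) → L f = 0)
    (h : ∀ s, IsSuper p s → L (mono K p s) = 0) : L = 0 := by
  classical
  ext f
  obtain ⟨S, hS⟩ := hL
  set S' := S.filter (IsSuper p)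
  have h1 : L (f - ∑ s ∈ S', f.coeff s • mono K p s) = 0 := by
    refine hS _ fun s hs => ?_
    by_cases hs' : IsSuper p s
    · rw [coeff_sub, coeff_sum, Finset.sum_eq_single s, coeff_smul, coeff_mono hs', if_pos rfl,
        mul_one, sub_self]
      · intro t ht hts
        rw [coeff_smul, coeff_mono (Finset.mem_filter.1 ht).2, if_neg (Ne.symm hts), mul_zero]
      · intro hs''
        exact absurd (Finset.mem_filter.2 ⟨hs, hs'⟩) hs''
    · exact coeff_of_not_isSuper _ hs'
  rw [map_sub, map_sum, Finset.sum_eq_zero fun s hs => by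
    rw [map_smul, h s (Finset.mem_filter.1 hs).2, smul_zero], sub_zero] at h1
  exact h1

theorem superCommutator_eq (X Y : FormalFun K p →ₗ[K] FormalFun K p) (c d : ZMod 2) :
    superCommutator X c Y d = X ∘ₗ Y - sg K (c * d) • (Y ∘ₗ X) := by
  rw [superCommutator, uzpow_smul (K := K)]

namespace IsFormalVectorField

variable {X Y : FormalFun K p →ₗ[K] FormalFun K p} {c d : ZMod 2}

theorem finDep (hX : IsFormalVectorField X c) : FinDep X := finDep_iff.2 hX.continuous

theorem map_mul (hX : IsFormalVectorField X c) {f : FormalFun K p} {a : ZMod 2}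
    (hf : f.HasParity a) (g : FormalFun K p) :
    X (f * g) = X f * g + sg K (c * a) • (f * X g) := by
  rw [hX.leibniz f g a hf, uzpow_smul (K := K)]

theorem partialDeriv (i : ι) : IsFormalVectorField (partialDeriv K p i) (p i) where
  parity f a hf := by
    have := (hasParity_iff.1 hf).partialDeriv i
    rw [sub_eq_add_neg, ZMod.neg_eq_self_mod_two] at this
    exact hasParity_iff.2 this
  leibniz f g a hf := by
    rw [partialDeriv_mul i hf, uzpow_smul (K := K)]
  continuous := finDep_iff.1 (finDep_partialDeriv i)

theorem superCommutator (hX : IsFormalVectorField X c) (hY : IsFormalVectorField Y d) :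
    IsFormalVectorField (superCommutator X c Y d) (c + d) where
  parity f a hf := by
    rw [superCommutator_eq, LinearMap.sub_apply, sub_eq_add_neg, ← neg_one_smul K]
    have h1 := hasParity_iff.1 (hX.parity _ _ (hY.parity f a hf))
    have h2 := hasParity_iff.1 (hY.parity _ _ (hX.parity f a hf))
    rw [add_assoc, add_comm d] at h1
    rw [add_assoc] at h2
    exact hasParity_iff.2 (h1.add ((h2.smul _).smul _))
  leibniz f g a hf := by
    rw [superCommutator_eq, uzpow_smul (K := K)]
    simp only [LinearMap.sub_apply, LinearMap.comp_apply, LinearMap.smul_apply]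
    rw [hY.map_mul hf, hX.map_mul hf, map_add, map_add, map_smul, map_smul,
      hX.map_mul (hY.parity f a hf), hX.map_mul hf, hY.map_mul (hX.parity f a hf), hY.map_mul hf]
    have e1 : sg K (c * (a + d)) = sg K (c * a) * sg K (c * d) := by rw [mul_add, sg_add]
    have e2 : sg K (d * (a + c)) = sg K (d * a) * sg K (c * d) := by
      rw [mul_add, sg_add, mul_comm d c]
    have e3 : sg K ((c + d) * a) = sg K (c * a) * sg K (d * a) := by rw [add_mul, sg_add]
    rw [e1, e2, e3, sub_mul, mul_sub, smul_mul_assoc, mul_smul_comm]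
    have e4 : sg K (c * d) • (sg K (d * a) * sg K (c * d)) • (X f * Y g) =
        sg K (d * a) • (X f * Y g) := by
      rw [smul_smul, mul_left_comm, sg_mul_self, mul_one]
    simp only [smul_add, smul_sub]
    rw [e4]
    module
  continuous := by
    rw [← finDep_iff, superCommutator_eq]
    exact (hX.finDep.comp hY.finDep).sub ((hY.finDep.comp hX.finDep).smul _)

/-- The mixed terms X f * X g arise with signs (-1)^a and (-1)^(a+1) and cancel, so no division of
[X, X] by two is involved. -/
theorem square (hX : IsFormalVectorField X 1) : IsFormalVectorField (X ∘ₗ X) 0 where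
  parity f a hf := by
    have := hX.parity _ _ (hX.parity f a hf)
    rwa [add_assoc, ZMod.two_add_self] at this
  leibniz f g a hf := by
    simp only [LinearMap.comp_apply]
    rw [hX.map_mul hf, map_add, map_smul, hX.map_mul (hX.parity f a hf), hX.map_mul hf]
    rw [one_mul, one_mul, sg_add, sg_one, smul_add, sg_smul_smul_self, zero_mul, uzpow_zero,
      one_smul]
    module
  continuous := finDep_iff.1 (hX.finDep.comp hX.finDep)

theorem map_mono_zero (hX : IsFormalVectorField X c) : X (mono K p 0) = 0 := by
  have h0 : (mono K p 0).HasParity 0 := by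
    have := hasDeg_mono (K := K) (w := p) (isSuper_zero p)
    rw [monoDeg_zero] at this
    exact hasParity_iff.2 this
  have h := hX.map_mul h0 (mono K p 0)
  rw [mono_zero_mul, mul_mono_zero, mono_zero_mul, mul_zero, sg_zero, one_smul] at h
  simpa using h

theorem map_coord_mul (hX : IsFormalVectorField X c) (i : ι) (f : FormalFun K p) :
    X (coord K p i * f) = X (coord K p i) * f + sg K (c * p i) • (coord K p i * X f) :=
  hX.map_mul (hasParity_iff.2 (hasDeg_coord i)) f

theorem mono_single_add {i : ι} {t : ι →₀ ℕ} (hs : IsSuper p (Finsupp.single i 1 + t)) :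
    mono K p (Finsupp.single i 1 + t) =
      sg K (mulExp p (Finsupp.single i 1) t) • (coord K p i * mono K p t) := by
  rw [coord_eq_mono, mono_mul_mono hs, sg_smul_smul_self]

/-- A vector field is determined by its components. -/
theorem ext (hX : IsFormalVectorField X c) (hY : IsFormalVectorField Y c)
    (h : ∀ j, X (coord K p j) = Y (coord K p j)) : X = Y := by
  -- Agreement on coordinates passes to monomials by the Leibniz rule; continuity then passes from
  -- monomials to power series.
  have key : ∀ n (s : ι →₀ ℕ), s.degree = n → IsSuper p s → X (mono K p s) = Y (mono K p s) := by
    intro n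
    induction n with
    | zero =>
      intro s hs _
      rw [Finsupp.degree_eq_zero_iff] at hs
      rw [hs, hX.map_mono_zero, hY.map_mono_zero]
    | succ n ih =>
      intro s hs hsup
      obtain ⟨i, t, rfl⟩ := Finsupp.exists_single_add (s := s) (by rintro rfl; simp at hs)
      rw [map_add, Finsupp.degree_single] at hs
      rw [mono_single_add hsup, map_smul, map_smul, hX.map_coord_mul, hY.map_coord_mul, h,
        ih t (by omega) hsup.right]
  have hD := hX.finDep.sub hY.finDep
  have h2 : ∀ m, coeffLin K p m ∘ₗ (X - Y) = 0 := by
    intro m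
    refine eq_zero_of_mono (hD m) fun s hs => ?_
    rw [LinearMap.comp_apply, LinearMap.sub_apply, key _ s rfl hs, sub_self, map_zero]
  refine LinearMap.ext fun f => ext_coeff fun m _ => ?_
  have := LinearMap.congr_fun (h2 m) f
  rw [LinearMap.comp_apply, LinearMap.sub_apply, coeffLin_apply, coeff_sub] at this
  exact sub_eq_zero.1 this

end IsFormalVectorField

/-- By continuity only coordinates whose exponent belongs to one finite set can contribute to a
given coefficient. This is what makes the structure constants finitely supported. -/
theorem FinDep.finite_valueAtZero {X : FormalFun K p →ₗ[K] FormalFun K p} (hX : FinDep X)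
    (m : ι →₀ ℕ) : {j | (X (coord K p j)).coeff m ≠ 0}.Finite := by
  classical
  obtain ⟨S, hS⟩ := hX m
  have hinj : Function.Injective fun j : ι => (Finsupp.single j 1 : ι →₀ ℕ) :=
    Finsupp.single_left_injective one_ne_zero
  refine (S.finite_toSet.preimage hinj.injOn).subset fun j hj => ?_
  by_contra hc
  refine hj (hS _ fun s hs => ?_)
  rw [coord_eq_mono, coeff_mono (isSuper_single p j), if_neg]
  rintro rfl
  exact hc hs

/-- The value of `X f` at the origin depends on the tangent vector of `X` at the origin only. -/
theorem IsFormalVectorField.evalZero_apply {X : FormalFun K p →ₗ[K] FormalFun K p} {c : ZMod 2}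
    (hX : IsFormalVectorField X c) (v : ι →₀ K) (hv : ∀ j, v j = valueAtZero X j)
    (f : FormalFun K p) :
    (X f).coeff 0 = v.sum fun l a => a * f.coeff (Finsupp.single l 1) := by
  classical
  let L : FormalFun K p →ₗ[K] K := coeffLin K p 0 ∘ₗ X -
    ∑ l ∈ v.support, v l • coeffLin K p (Finsupp.single l 1)
  have hL : L = 0 := by
    refine eq_zero_of_mono ?_ ?_
    · obtain ⟨S, hS⟩ := hX.finDep 0
      refine ⟨S ∪ v.support.image fun l => Finsupp.single l 1, fun f hf => ?_⟩
      simp only [L, LinearMap.sub_apply, LinearMap.comp_apply, LinearMap.sum_apply,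
        LinearMap.smul_apply, coeffLin_apply]
      rw [hS f fun s hs => hf s (Finset.mem_union_left _ hs), Finset.sum_eq_zero, sub_zero]
      intro l hl
      rw [hf _ (Finset.mem_union_right _ (Finset.mem_image_of_mem _ hl)), smul_zero]
    -- On monomials: X kills the constant 1, the coordinates give the tangent vector, and for degree
    -- at least two the Leibniz rule leaves a factor vanishing at the origin in each term.
    · intro s hs
      simp only [L, LinearMap.sub_apply, LinearMap.comp_apply, LinearMap.sum_apply,
        LinearMap.smul_apply, coeffLin_apply]
      rw [sub_eq_zero]
      by_cases h0 : s = 0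
      · subst h0
        rw [hX.map_mono_zero, coeff_zero, eq_comm]
        refine Finset.sum_eq_zero fun l _ => ?_
        rw [coeff_mono (isSuper_zero p), if_neg, smul_zero]
        simp
      obtain ⟨i, t, rfl⟩ := Finsupp.exists_single_add h0
      by_cases ht : t = 0
      · subst ht
        rw [add_zero, ← coord_eq_mono]
        have h1 : (X (coord K p i)).coeff 0 = v i := (hv i).symm
        rw [h1]
        rw [add_zero] at hs
        simp only [coord_eq_mono, coeff_mono hs, smul_eq_mul, mul_ite, mul_one, mul_zero]
        rw [Finset.sum_congr rfl fun l _ => if_congr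
          (Finsupp.single_left_inj (one_ne_zero (α := ℕ)) (a := l) (a' := i)) rfl rfl,
          Finset.sum_ite_eq']
        split_ifs with h
        · rfl
        · exact Finsupp.notMem_support_iff.1 h
      · rw [IsFormalVectorField.mono_single_add hs, map_smul, hX.map_coord_mul, coeff_smul, coeff_add,
          coeff_smul, coeff_mul_zero, coeff_mul_zero, coord_eq_mono, coeff_mono hs.right,
          coeff_mono hs.left, if_neg (Ne.symm ht), if_neg (by rw [eq_comm]; simp)]
        rw [← coord_eq_mono, eq_comm]
        simp only [mul_zero, zero_mul, add_zero]
        refine Finset.sum_eq_zero fun l _ => ?_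
        rw [coord_eq_mono, mono_mul_mono hs, sg_smul_smul_self, coeff_mono hs, if_neg,
          smul_zero]
        intro h
        have h1 := congrArg (fun x => Finsupp.degree x) h
        simp only [map_add, Finsupp.degree_single] at h1
        exact ht ((Finsupp.degree_eq_zero_iff t).1 (by omega))
  have := LinearMap.congr_fun hL f
  simp only [L, LinearMap.sub_apply, LinearMap.comp_apply, LinearMap.sum_apply,
    LinearMap.smul_apply, coeffLin_apply, LinearMap.zero_apply, smul_eq_mul] at this
  exact sub_eq_zero.1 this

end VectorFieldLemmas

/-! ## Iterated derivatives and Taylor coefficients -/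

section IteratedDerivatives

open FormalFun

variable {K ι : Type*} [CommRing K]

/-- The exponent of the monomial `∏ y (I k)`. -/
noncomputable def indexMono {n : ℕ} (I : Fin n → ι) : ι →₀ ℕ := ∑ k, Finsupp.single (I k) 1

theorem indexMono_succ {n : ℕ} (I : Fin (n + 1) → ι) :
    indexMono I = indexMono (fun i => I i.castSucc) + Finsupp.single (I (Fin.last n)) 1 :=
  Fin.sum_univ_castSucc _

theorem monoDeg_indexMono {R : Type*} [CommRing R] (w : ι → R) {n : ℕ} (I : Fin n → ι) :
    monoDeg w (indexMono I) = ∑ k, w (I k) := by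
  induction n with
  | zero => simp [indexMono]
  | succ n ih => rw [indexMono_succ, monoDeg_add, ih, monoDeg_single, Fin.sum_univ_castSucc]

theorem exists_indexMono_eq (m : ι →₀ ℕ) : ∃ (n : ℕ) (I : Fin n → ι), indexMono I = m := by
  induction h : m.degree generalizing m with
  | zero =>
    rw [Finsupp.degree_eq_zero_iff] at h
    exact ⟨0, Fin.elim0, by simp [indexMono, h]⟩
  | succ n ih =>
    obtain ⟨i, t, rfl⟩ := Finsupp.exists_single_add (s := m) (by rintro rfl; simp at h)
    rw [map_add, Finsupp.degree_single] at h
    obtain ⟨n', I, hI⟩ := ih t (by omega)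
    refine ⟨n' + 1, Fin.snoc I i, ?_⟩
    rw [indexMono_succ]
    simp [hI, add_comm]

theorem indexMono_apply [DecidableEq ι] {n : ℕ} (I : Fin n → ι) (a : ι) :
    indexMono I a = Fintype.card {k // I k = a} := by
  rw [indexMono, Finsupp.finsetSum_apply, Fintype.card_subtype]
  simp [Finsupp.single_apply]

theorem exists_perm_of_indexMono_eq {n n' : ℕ} {I : Fin n → ι} {J : Fin n' → ι}
    (h : indexMono I = indexMono J) : ∃ e : Fin n ≃ Fin n', ∀ k, J (e k) = I k := by
  classical
  have hc : ∀ a, Nonempty ({k // I k = a} ≃ {k // J k = a}) := fun a => by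
    have := DFunLike.congr_fun h a
    rw [indexMono_apply, indexMono_apply] at this
    exact Fintype.card_eq.1 this
  exact ⟨Equiv.ofFiberEquiv fun a => (hc a).some, fun k => Equiv.ofFiberEquiv_map _ k⟩

theorem not_isSuper_indexMono {p : ι → ZMod 2} {n : ℕ} {I : Fin n → ι}
    (h : ¬ IsSuper p (indexMono I)) : ∃ x y, x ≠ y ∧ I x = I y ∧ p (I x) = 1 := by
  classical
  unfold IsSuper at h
  push Not at h
  obtain ⟨a, ha, h1⟩ := h
  rw [indexMono_apply, Fintype.one_lt_card_iff] at h1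
  obtain ⟨x, y, hxy⟩ := h1
  exact ⟨x, y, fun h => hxy (Subtype.ext h), x.2.trans y.2.symm, by rw [x.2, ha]⟩

variable [LinearOrder ι]

/-- `∂_{I (n-1)} ⋯ ∂_{I 0}`. -/
noncomputable def iterDeriv (K : Type*) [CommRing K] (p : ι → ZMod 2) : (n : ℕ) → (Fin n → ι) →
    FormalFun K p →ₗ[K] FormalFun K p
  | 0, _ => LinearMap.id
  | n + 1, I => partialDeriv K p (I (Fin.last n)) ∘ₗ iterDeriv K p n fun i => I i.castSucc

variable {p : ι → ZMod 2}

theorem iterDeriv_succ {n : ℕ} (I : Fin (n + 1) → ι) (f : FormalFun K p) :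
    iterDeriv K p (n + 1) I f =
      partialDeriv K p (I (Fin.last n)) (iterDeriv K p n (fun i => I i.castSucc) f) := rfl

theorem iterDeriv_swap {n : ℕ} (k : Fin n) (I : Fin (n + 1) → ι) (f : FormalFun K p) :
    iterDeriv K p (n + 1) (fun i => I (Equiv.swap k.castSucc k.succ i)) f =
      sg K (p (I k.castSucc) * p (I k.succ)) • iterDeriv K p (n + 1) I f := by
  induction n with
  | zero => exact k.elim0
  | succ n ih =>
    rw [iterDeriv_succ]
    induction k using Fin.lastCases with
    | last =>
      rw [iterDeriv_succ, iterDeriv_succ, iterDeriv_succ, ← Fin.succ_last, Equiv.swap_apply_right,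
        Equiv.swap_apply_left, partialDeriv_comm]
      have h : ∀ i : Fin n, Equiv.swap (Fin.last n).castSucc (Fin.last n).succ i.castSucc.castSucc =
          i.castSucc.castSucc := by
        intro i
        refine Equiv.swap_apply_of_ne_of_ne ?_ ?_
        · simp [Fin.castSucc_inj, (Fin.castSucc_lt_last i).ne]
        · rw [Fin.succ_last]
          exact (Fin.castSucc_lt_last _).ne
      simp only [h]
    | cast k =>
      have h1 : Equiv.swap k.castSucc.castSucc k.castSucc.succ (Fin.last (n + 1)) =
          Fin.last (n + 1) := by
        refine Equiv.swap_apply_of_ne_of_ne (Fin.castSucc_lt_last _).ne' ?_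
        rw [Fin.succ_castSucc]
        exact (Fin.castSucc_lt_last _).ne'
      have h2 : ∀ i : Fin (n + 1), Equiv.swap k.castSucc.castSucc k.castSucc.succ i.castSucc =
          (Equiv.swap k.castSucc k.succ i).castSucc := by
        intro i
        rw [Fin.succ_castSucc]
        exact (Function.Injective.swap_apply (Fin.castSucc_injective _) _ _ _)
      rw [h1]
      simp only [h2]
      rw [ih k fun i => I i.castSucc, map_smul, Fin.succ_castSucc]
      rfl

theorem iterDeriv_perm {n : ℕ} (σ : Equiv.Perm (Fin n)) (I : Fin n → ι) (f : FormalFun K p) :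
    iterDeriv K p n (fun i => I (σ i)) f =
      sg K (koszulExp (fun i => p (I i)) σ) • iterDeriv K p n I f := by
  cases n with
  | zero => rw [Subsingleton.elim σ 1]; simp
  | succ n =>
    induction σ using Equiv.Perm.adjacent_swap_induction generalizing I with
    | one => simp
    | swap k => rw [iterDeriv_swap, koszulExp_swap]
    | mul σ τ hσ hτ =>
      simp only [Equiv.Perm.mul_apply]
      rw [hτ fun i => I (σ i), hσ, koszulExp_mul, sg_add, smul_smul, mul_comm]

theorem isUnit_natCast_succ [Algebra ℚ K] (n : ℕ) : IsUnit ((n + 1 : ℕ) : K) := by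
  have : ((n + 1 : ℕ) : K) = algebraMap ℚ K ((n + 1 : ℕ) : ℚ) := by simp
  rw [this]
  exact (IsUnit.mk0 _ (by positivity)).map _

theorem isUnit_sg (a : ZMod 2) : IsUnit (sg K a) :=
  IsUnit.of_mul_eq_one _ (sg_mul_self a)

/-- The factor κ is a sign times a product of positive integers, hence invertible over ℚ, and it
depends on I and m but not on f. -/
theorem exists_coeff_iterDeriv [Algebra ℚ K] {n : ℕ} (I : Fin n → ι) (m : ι →₀ ℕ) :
    ∃ κ : K, IsUnit κ ∧ ∀ f : FormalFun K p,
      (iterDeriv K p n I f).coeff m = κ * f.coeff (m + indexMono I) := by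
  induction n generalizing m with
  | zero => exact ⟨1, isUnit_one, fun f => by simp [iterDeriv, indexMono]⟩
  | succ n ih =>
    obtain ⟨κ, hκ, h⟩ := ih (fun i => I i.castSucc) (m + Finsupp.single (I (Fin.last n)) 1)
    refine ⟨sg K (mulExp p (Finsupp.single (I (Fin.last n)) 1) m) *
      ((m (I (Fin.last n)) + 1 : ℕ) : K) * κ,
      ((isUnit_sg _).mul (isUnit_natCast_succ _)).mul hκ, fun f => ?_⟩
    rw [iterDeriv_succ, coeff_partialDeriv, h, indexMono_succ, add_right_comm, add_assoc m]
    rw [← mul_assoc, ← mul_assoc]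

theorem exists_coeff_zero_iterDeriv [Algebra ℚ K] {n : ℕ} (I : Fin n → ι) :
    ∃ κ : K, IsUnit κ ∧ ∀ f : FormalFun K p,
      (iterDeriv K p n I f).coeff 0 = κ * f.coeff (indexMono I) := by
  simpa using exists_coeff_iterDeriv (p := p) I 0

/-- A formal function is determined by its iterated derivatives at the origin. -/
theorem FormalFun.ext_iterDeriv [Algebra ℚ K] {f g : FormalFun K p}
    (h : ∀ (n : ℕ) (I : Fin n → ι), (iterDeriv K p n I f).coeff 0 = (iterDeriv K p n I g).coeff 0) :
    f = g := by
  refine ext_coeff fun m _ => ?_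
  obtain ⟨n, I, rfl⟩ := exists_indexMono_eq m
  obtain ⟨κ, hκ, h'⟩ := exists_coeff_zero_iterDeriv (K := K) (p := p) I
  have := h n I
  rw [h', h'] at this
  exact hκ.mul_left_cancel this

/-- Supersymmetric families are the iterated derivatives at the origin of formal functions. -/
theorem FormalFun.exists_iterDeriv_eq [Algebra ℚ K] (T : (n : ℕ) → (Fin n → ι) → K)
    (hT : ∀ (n : ℕ) (I : Fin n → ι) (σ : Equiv.Perm (Fin n)),
      T n (fun i => I (σ i)) = sg K (koszulExp (fun i => p (I i)) σ) * T n I) :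
    ∃ f : FormalFun K p, ∀ (n : ℕ) (I : Fin n → ι), (iterDeriv K p n I f).coeff 0 = T n I := by
  -- Each coefficient is prescribed through one chosen enumeration of its monomial. Any other
  -- enumeration differs by a permutation, which changes the derivative and T by the same Koszul
  -- sign.
  choose N J hJ using fun m : ι →₀ ℕ => exists_indexMono_eq m
  choose κ hκ hκ' using fun (n : ℕ) (I : Fin n → ι) => exists_coeff_zero_iterDeriv (K := K) (p := p) I
  let f : FormalFun K p := fun m => (hκ (N m.1) (J m.1)).unit⁻¹ * T (N m.1) (J m.1)
  refine ⟨f, fun n I => ?_⟩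
  by_cases hs : IsSuper p (indexMono I)
  · have h1 : (iterDeriv K p _ (J (indexMono I)) f).coeff 0 = T _ (J (indexMono I)) := by
      rw [hκ', hJ, coeff_of_isSuper _ hs]
      change _ * ((hκ (N (indexMono I)) (J (indexMono I))).unit⁻¹ *
        T (N (indexMono I)) (J (indexMono I))) = _
      rw [← mul_assoc, IsUnit.mul_val_inv, one_mul]
    obtain ⟨e, he⟩ := exists_perm_of_indexMono_eq (hJ (indexMono I)).symm
    revert h1 he e
    generalize J (indexMono I) = J'
    revert J'
    generalize N (indexMono I) = n'
    intro J' h1 e he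
    obtain rfl : n = n' := by simpa using Fintype.card_congr e
    obtain rfl : I = fun k => J' (e k) := funext fun k => (he k).symm
    rw [iterDeriv_perm, hT, coeff_smul, h1]
  -- A repeated odd index forces T = -T, so T vanishes because 2 is invertible.
  · rw [hκ', coeff_of_not_isSuper _ hs, mul_zero]
    obtain ⟨x, y, hxy, hI, hp⟩ := not_isSuper_indexMono hs
    obtain ⟨σ, hσ, hk⟩ := exists_perm_koszulSign_eq_neg_one p I hxy hI hp
    have h1 := hT n I σ
    have h2 : sg K (koszulExp (fun i => p (I i)) σ) = -1 := by
      rw [sg, ← koszulSign_eq, hk]; simp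
    rw [hσ, h2] at h1
    have h3 : ((1 + 1 : ℕ) : K) * T n I = ((1 + 1 : ℕ) : K) * 0 := by
      push_cast; linear_combination h1
    exact ((isUnit_natCast_succ 1).mul_left_cancel h3).symm

end IteratedDerivatives

/-! ## Iterated commutators with coordinate vector fields -/

section IteratedCommutators

open FormalFun

variable {K ι : Type*} [CommRing K] [LinearOrder ι] {p : ι → ZMod 2}

/-- `[…[X, ∂_{I 0}], …, ∂_{I (n-1)}]`. -/
noncomputable def coordCommutator (X : FormalFun K p →ₗ[K] FormalFun K p) (c : ZMod 2) {n : ℕ}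
    (I : Fin n → ι) : FormalFun K p →ₗ[K] FormalFun K p :=
  iteratedCommutator X c n (fun k => partialDeriv K p (I k)) (fun k => p (I k))

theorem coordCommutator_succ (X : FormalFun K p →ₗ[K] FormalFun K p) (c : ZMod 2) {n : ℕ}
    (I : Fin (n + 1) → ι) : coordCommutator X c I =
      superCommutator (coordCommutator X c fun i => I i.castSucc) (c + ∑ i : Fin n, p (I i.castSucc))
        (partialDeriv K p (I (Fin.last n))) (p (I (Fin.last n))) := rfl

theorem IsFormalVectorField.coordCommutator {X : FormalFun K p →ₗ[K] FormalFun K p} {c : ZMod 2}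
    (hX : IsFormalVectorField X c) {n : ℕ} (I : Fin n → ι) :
    IsFormalVectorField (coordCommutator X c I) (c + ∑ k, p (I k)) := by
  induction n with
  | zero => simpa [_root_.coordCommutator, iteratedCommutator] using hX
  | succ n ih =>
    rw [coordCommutator_succ, Fin.sum_univ_castSucc, ← add_assoc]
    exact (ih _).superCommutator (IsFormalVectorField.partialDeriv _)

/-- The exponent of the sign between iterated commutators and iterated derivatives. -/
def commExp {n : ℕ} (c : ZMod 2) (a : Fin n → ZMod 2) : ZMod 2 :=
  (n : ZMod 2) + c * ∑ i, a i + ∑ i, ∑ j, if i < j then a i * a j else 0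

theorem commExp_succ {n : ℕ} (c : ZMod 2) (a : Fin (n + 1) → ZMod 2) :
    commExp c a = commExp c (fun i => a i.castSucc) + 1 +
      (c + ∑ i : Fin n, a i.castSucc) * a (Fin.last n) := by
  simp only [commExp, Fin.sum_univ_castSucc (n := n), Finset.sum_add_distrib]
  simp [Fin.castSucc_lt_last, (Fin.castSucc_lt_last _).not_gt, Finset.sum_mul, add_mul, mul_add]
  ring

/-- The exponent is a symmetric function of the parities, so iterated commutators inherit the
supersymmetry of iterated derivatives unchanged. -/
theorem commExp_perm {n : ℕ} (c : ZMod 2) (a : Fin n → ZMod 2) (σ : Equiv.Perm (Fin n)) :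
    commExp c (fun i => a (σ i)) = commExp c a := by
  simp only [commExp]
  rw [Equiv.sum_comp σ a, Finset.sum_pairs_comp_perm (fun i j => a i * a j)
    (fun i j => mul_comm _ _) σ]

theorem IsFormalVectorField.map_partialDeriv_coord {X : FormalFun K p →ₗ[K] FormalFun K p}
    {c : ZMod 2} (hX : IsFormalVectorField X c) (i j : ι) :
    X (FormalFun.partialDeriv K p i (coord K p j)) = 0 := by
  rw [partialDeriv_coord, map_smul, hX.map_mono_zero, smul_zero]

/-- In each commutator the term applying ∂_i first gives a derivation of a constant, hence zero on y
j; only the derivative of the previous component survives, with the sign recorded by `commExp_succ`.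
-/
theorem IsFormalVectorField.coordCommutator_coord {X : FormalFun K p →ₗ[K] FormalFun K p}
    {c : ZMod 2} (hX : IsFormalVectorField X c) {n : ℕ} (I : Fin n → ι) (j : ι) :
    _root_.coordCommutator X c I (coord K p j) =
      sg K (commExp c fun k => p (I k)) • iterDeriv K p n I (X (coord K p j)) := by
  induction n with
  | zero => simp [_root_.coordCommutator, iteratedCommutator, iterDeriv, commExp]
  | succ n ih =>
    rw [coordCommutator_succ, superCommutator_eq, commExp_succ]
    simp only [LinearMap.sub_apply, LinearMap.comp_apply, LinearMap.smul_apply]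
    rw [(hX.coordCommutator _).map_partialDeriv_coord, ih, map_smul, iterDeriv_succ, sg_add, sg_add,
      sg_one]
    module

variable (X Y : FormalFun K p →ₗ[K] FormalFun K p) (c c' : ZMod 2)

/-- The iterated commutator of `X` with those `Y i` for which `s i` is true. -/
def maskCommutator (X : FormalFun K p →ₗ[K] FormalFun K p) (c : ZMod 2) :
    (n : ℕ) → (Fin n → (FormalFun K p →ₗ[K] FormalFun K p)) → (Fin n → ZMod 2) → (Fin n → Bool) →
      (FormalFun K p →ₗ[K] FormalFun K p)
  | 0, _, _, _ => X
  | n + 1, Y, d, s =>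
      if s (Fin.last n) = true then
        superCommutator
          (maskCommutator X c n (fun i => Y i.castSucc) (fun i => d i.castSucc) fun i => s i.castSucc)
          (c + ∑ i : Fin n, if s i.castSucc = true then d i.castSucc else 0) (Y (Fin.last n))
          (d (Fin.last n))
      else maskCommutator X c n (fun i => Y i.castSucc) (fun i => d i.castSucc) fun i => s i.castSucc

theorem sum_mask_eq {M : Type*} [AddCommMonoid M] {n r : ℕ} (d : Fin n → M) (s : Fin n → Bool)
    {φ : Fin r → Fin n} (hφ : Function.Injective φ) (hs : ∀ i, s i = true ↔ i ∈ Set.range φ) :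
    (∑ i, if s i = true then d i else 0) = ∑ k, d (φ k) := by
  classical
  rw [← Finset.sum_filter, ← Finset.sum_image (g := φ) (f := d) fun x _ y _ h => hφ h]
  congr 1
  ext i
  simp [hs]

/-- Translates the recursion over a subset into an iterated commutator along its increasing
enumeration φ, the form in which a shuffle presents its blocks. -/
theorem maskCommutator_eq {n r : ℕ} (Z : Fin n → (FormalFun K p →ₗ[K] FormalFun K p))
    (d : Fin n → ZMod 2) (s : Fin n → Bool) {φ : Fin r → Fin n} (hφ : StrictMono φ)
    (hs : ∀ i, s i = true ↔ i ∈ Set.range φ) :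
    maskCommutator X c n Z d s =
      iteratedCommutator X c r (fun k => Z (φ k)) (fun k => d (φ k)) := by
  induction n generalizing r with
  | zero =>
    cases r with
    | zero => rfl
    | succ r => exact (φ 0).elim0
  | succ n ih =>
    rw [maskCommutator]
    have hdown : ∀ {r' : ℕ} (ψ : Fin r' → Fin (n + 1)) (hψ : StrictMono ψ)
        (hlt : ∀ k, ψ k ≠ Fin.last n), ∃ ψ' : Fin r' → Fin n, StrictMono ψ' ∧
          ∀ k, (ψ' k).castSucc = ψ k := by
      intro r' ψ hψ hlt
      refine ⟨fun k => (ψ k).castPred (hlt k), fun x y hxy => ?_, fun k => Fin.castSucc_castPred _ _⟩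
      exact Fin.castPred_lt_castPred (hψ hxy) _
    by_cases hl : s (Fin.last n) = true
    · rw [if_pos hl]
      obtain ⟨k0, hk0⟩ := (hs _).1 hl
      obtain _ | r := r
      · exact k0.elim0
      have hlast : φ (Fin.last r) = Fin.last n := by
        refine le_antisymm (Fin.le_last _) ?_
        rw [← hk0]
        exact hφ.monotone (Fin.le_last _)
      obtain ⟨ψ, hψ, hψ'⟩ := hdown (fun k : Fin r => φ k.castSucc)
        (fun x y hxy => hφ (by simpa using hxy))
        (fun k h => by
          rw [← hlast] at h
          exact (Fin.castSucc_lt_last k).ne (hφ.injective h))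
      have hs' : ∀ i : Fin n, s i.castSucc = true ↔ i ∈ Set.range ψ := by
        intro i
        rw [hs]
        constructor
        · rintro ⟨k, hk⟩
          induction k using Fin.lastCases with
          | last => rw [hlast] at hk; exact absurd hk (Fin.castSucc_lt_last i).ne'
          | cast k => exact ⟨k, Fin.castSucc_injective _ (by rw [hψ', hk])⟩
        · rintro ⟨k, rfl⟩
          exact ⟨k.castSucc, (hψ' k).symm⟩
      rw [ih _ _ _ hψ hs', iteratedCommutator, hlast, sum_mask_eq _ _ hψ.injective hs']
      simp only [hψ']
    · rw [if_neg hl]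
      obtain ⟨ψ, hψ, hψ'⟩ := hdown φ hφ fun k h => hl ((hs _).2 ⟨k, h⟩)
      have hs' : ∀ i : Fin n, s i.castSucc = true ↔ i ∈ Set.range ψ := by
        intro i
        rw [hs]
        constructor
        · rintro ⟨k, hk⟩
          exact ⟨k, Fin.castSucc_injective _ (by rw [hψ', hk])⟩
        · rintro ⟨k, rfl⟩
          exact ⟨k, (hψ' k).symm⟩
      rw [ih _ _ _ hψ hs']
      simp only [hψ']

/-- A formal identity between linear operators: inserting and removing ± A Z B gives the Leibniz
rule for commutators of a composite. -/
theorem superCommutator_comp (A B Z : FormalFun K p →ₗ[K] FormalFun K p) (a b z : ZMod 2) :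
    superCommutator (A ∘ₗ B) (a + b) Z z =
      A ∘ₗ superCommutator B b Z z + sg K (z * b) • (superCommutator A a Z z ∘ₗ B) := by
  ext1 f
  simp only [superCommutator_eq, LinearMap.sub_apply, LinearMap.add_apply, LinearMap.comp_apply,
    LinearMap.smul_apply, map_sub, map_smul]
  have : sg K ((a + b) * z) = sg K (a * z) * sg K (b * z) := by rw [add_mul, sg_add]
  rw [this, mul_comm z b]
  module

theorem superCommutator_sum_smul {α : Type*} (s : Finset α) (x : α → K)
    (A : α → (FormalFun K p →ₗ[K] FormalFun K p)) (a : ZMod 2)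
    (Z : FormalFun K p →ₗ[K] FormalFun K p) (z : ZMod 2) :
    superCommutator (∑ i ∈ s, x i • A i) a Z z = ∑ i ∈ s, x i • superCommutator (A i) a Z z := by
  ext1 f
  simp only [superCommutator_eq, LinearMap.sub_apply, LinearMap.sum_apply, LinearMap.comp_apply,
    LinearMap.smul_apply, map_sum, map_smul, Finset.smul_sum, ← Finset.sum_sub_distrib, smul_sub]
  refine Finset.sum_congr rfl fun i _ => ?_
  rw [smul_comm (sg K _) (x i)]

/-- Each Z i is absorbed by one of the two factors. When X absorbs it, it has to pass Y and those
earlier Z j already absorbed by Y, which accounts for the two summands of the exponent. -/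
theorem iteratedCommutator_comp {n : ℕ} (Z : Fin n → (FormalFun K p →ₗ[K] FormalFun K p))
    (d : Fin n → ZMod 2) :
    iteratedCommutator (X ∘ₗ Y) (c + c') n Z d = ∑ s : Fin n → Bool,
      sg K (c' * (∑ i, if s i = true then d i else 0) + maskExp d s) •
        (maskCommutator X c n Z d s ∘ₗ maskCommutator Y c' n Z d fun i => !(s i)) := by
  induction n with
  | zero =>
    simp [iteratedCommutator, maskCommutator, maskExp]
  | succ n ih =>
    rw [iteratedCommutator, ih, superCommutator_sum_smul,
      ← Equiv.sum_comp (Fin.snocEquiv fun _ => Bool), Fintype.sum_prod_type, Fintype.sum_bool,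
      ← Finset.sum_add_distrib]
    refine Finset.sum_congr rfl fun s _ => ?_
    have hd : c + c' + ∑ i : Fin n, d i.castSucc =
        (c + ∑ i : Fin n, if s i = true then d i.castSucc else 0) +
          (c' + ∑ i : Fin n, if (!s i) = true then d i.castSucc else 0) := by
      have : ∑ i : Fin n, d i.castSucc = (∑ i : Fin n, if s i = true then d i.castSucc else 0) +
          ∑ i : Fin n, if (!s i) = true then d i.castSucc else 0 := by
        rw [← Finset.sum_add_distrib]
        refine Finset.sum_congr rfl fun i _ => ?_
        cases s i <;> simp
      rw [this]; ring
    rw [hd, superCommutator_comp]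
    simp only [Fin.snocEquiv_apply, maskCommutator, Fin.snoc_last, Fin.snoc_castSucc, Bool.not_true,
      Bool.not_false, if_true, maskExp_succ, Fin.sum_univ_castSucc (n := n), Bool.false_eq_true,
      if_false, add_zero]
    rw [smul_add, add_comm]
    congr 1
    rw [smul_smul, ← sg_add]
    congr 2
    have : (∑ i : Fin n, if s i = false then d i.castSucc else 0) =
        ∑ i : Fin n, if (!s i) = true then d i.castSucc else 0 := by
      refine Finset.sum_congr rfl fun i _ => ?_
      cases s i <;> simp
    rw [this]
    ring

end IteratedCommutators

/-! ## Vector fields with given components -/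

section Components

open FormalFun

variable {K ι : Type*} [CommRing K] [LinearOrder ι] {p : ι → ZMod 2}

theorem FormalFun.coeff_mul_congr {f f' g g' : FormalFun K p} {m : ι →₀ ℕ}
    (hf : ∀ a ≤ m, f.coeff a = f'.coeff a) (hg : ∀ a ≤ m, g.coeff a = g'.coeff a) :
    (f * g).coeff m = (f' * g').coeff m := by
  by_cases hm : IsSuper p m
  · rw [coeff_mul _ _ hm, coeff_mul _ _ hm]
    refine Finset.sum_congr rfl fun x hx => ?_
    rw [Finset.HasAntidiagonal.mem_antidiagonal] at hx
    rw [hf x.1 (hx ▸ le_self_add), hg x.2 (hx ▸ le_add_self)]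
  · rw [coeff_of_not_isSuper _ hm, coeff_of_not_isSuper _ hm]

/-- Each monomial occurs in finitely many of the `g j`. -/
def LocallyFiniteComponents (g : ι → FormalFun K p) : Prop :=
  ∀ m : ι →₀ ℕ, {j | (g j).coeff m ≠ 0}.Finite

namespace LocallyFiniteComponents

variable {g : ι → FormalFun K p} (hg : LocallyFiniteComponents g)

include hg in
theorem finite_le (m : ι →₀ ℕ) : {j | ∃ a ≤ m, (g j).coeff a ≠ 0}.Finite := by
  have : {j | ∃ a ≤ m, (g j).coeff a ≠ 0} = ⋃ a ∈ Set.Iic m, {j | (g j).coeff a ≠ 0} := by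
    ext j; simp
  rw [this]
  exact (Set.finite_Iic m).biUnion fun a _ => hg a

/-- The components containing a monomial dividing `y ^ m`. -/
noncomputable def relevant (m : ι →₀ ℕ) : Finset ι := (hg.finite_le m).toFinset

theorem coeff_eq_zero {m : ι →₀ ℕ} {j : ι} (hj : j ∉ hg.relevant m) {a : ι →₀ ℕ} (ha : a ≤ m) :
    (g j).coeff a = 0 := by
  by_contra h
  exact hj ((hg.finite_le m).mem_toFinset.2 ⟨a, ha, h⟩)

theorem relevant_mono {a m : ι →₀ ℕ} (h : a ≤ m) : hg.relevant a ⊆ hg.relevant m := by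
  intro j hj
  obtain ⟨b, hb, hne⟩ := (hg.finite_le a).mem_toFinset.1 hj
  exact (hg.finite_le m).mem_toFinset.2 ⟨b, hb.trans h, hne⟩

/-- The vector field `∑ g j ∂/∂y j`. -/
noncomputable def field : FormalFun K p →ₗ[K] FormalFun K p where
  toFun f := fun m => ∑ j ∈ hg.relevant m.1, (g j * partialDeriv K p j f).coeff m.1
  map_add' f f' := by
    funext m
    refine (Finset.sum_congr rfl fun j _ => ?_).trans Finset.sum_add_distrib
    rw [map_add, mul_add, coeff_add]
  map_smul' c f := by
    funext m
    refine (Finset.sum_congr rfl fun j _ => ?_).trans (Finset.mul_sum _ _ _).symm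
    rw [map_smul, mul_smul_comm, coeff_smul]
    rfl

/-- Terms outside `relevant m` do not affect this coefficient. The freedom in J lets a single finite
sum serve for all monomials dividing y ^ m. -/
theorem coeff_field (f : FormalFun K p) {m : ι →₀ ℕ} {J : Finset ι} (hJ : hg.relevant m ⊆ J) :
    (hg.field f).coeff m = (∑ j ∈ J, g j * partialDeriv K p j f).coeff m := by
  rw [coeff_sum]
  by_cases hm : IsSuper p m
  · rw [coeff_of_isSuper _ hm, ← Finset.sum_subset hJ]
    · rfl
    · intro j _ hj
      rw [coeff_mul_congr (f' := 0) (g' := partialDeriv K p j f) _ fun _ _ => rfl, zero_mul,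
        coeff_zero]
      intro a ha
      rw [hg.coeff_eq_zero hj ha, coeff_zero]
  · rw [coeff_of_not_isSuper _ hm, Finset.sum_eq_zero fun j _ => coeff_of_not_isSuper _ hm]

theorem field_coord (j : ι) : hg.field (coord K p j) = g j := by
  refine ext_coeff fun m _ => ?_
  classical
  rw [hg.coeff_field _ (Finset.subset_insert j (hg.relevant m)), coeff_sum,
    Finset.sum_eq_single j]
  · rw [partialDeriv_coord, if_pos rfl, one_smul, mul_mono_zero]
  · intro l _ hl
    rw [partialDeriv_coord, if_neg hl, zero_smul, mul_zero, coeff_zero]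
  · intro h
    exact absurd (Finset.mem_insert_self _ _) h

theorem hasDeg_field {R : Type*} [CommRing R] {w : ι → R} {r : R}
    (hw : ∀ j, (g j).HasDeg w (w j + r)) {f : FormalFun K p} {b : R} (hf : f.HasDeg w b) :
    (hg.field f).HasDeg w (b + r) := by
  intro m hm
  rw [hg.coeff_field f subset_rfl, coeff_sum] at hm
  obtain ⟨j, _, hj⟩ := Finset.exists_ne_zero_of_sum_ne_zero hm
  rw [((hw j).mul (hf.partialDeriv j)) m hj]
  ring

theorem finDep_field : FinDep hg.field := by
  classical
  intro m
  refine ⟨(hg.relevant m).biUnion fun j =>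
    (Set.finite_Iic m).toFinset.image fun b => b + Finsupp.single j 1, fun f hf => ?_⟩
  rw [hg.coeff_field f subset_rfl, coeff_sum]
  refine Finset.sum_eq_zero fun j hj => ?_
  rw [coeff_mul_congr (f' := g j) (g' := 0) (fun _ _ => rfl), mul_zero, coeff_zero]
  intro b hb
  rw [coeff_partialDeriv, hf, coeff_zero, mul_zero, mul_zero]
  exact Finset.mem_biUnion.2 ⟨j, hj, Finset.mem_image.2 ⟨b, by simpa using hb, rfl⟩⟩

theorem isFormalVectorField {c : ZMod 2} (hp : ∀ j, (g j).HasDeg p (p j + c)) :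
    IsFormalVectorField hg.field c where
  parity f a hf := hasParity_iff.2 (hg.hasDeg_field hp (hasParity_iff.1 hf))
  leibniz f h a hf := by
    rw [uzpow_smul (K := K)]
    refine ext_coeff fun m _ => ?_
    -- Both sides at m involve only coefficients at divisors of m, so the field may be replaced by
    -- the finite sum over J, and the Leibniz rule for ∂_j applies termwise.
    set J := hg.relevant m
    have key : ∀ j, g j * partialDeriv K p j (f * h) = (g j * partialDeriv K p j f) * h +
        sg K (c * a) • (f * (g j * partialDeriv K p j h)) := by
      intro j
      rw [partialDeriv_mul j hf, mul_add, mul_smul_comm, ← mul_assoc, ← mul_assoc, ← mul_assoc,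
        mul_superComm (hasParity_iff.2 (hp j)) hf, smul_mul_assoc, smul_smul, ← sg_add]
      congr 3
      rw [add_mul, ← add_assoc, ZMod.two_add_self, zero_add]
    have e1 : (hg.field f * h).coeff m = ((∑ j ∈ J, g j * partialDeriv K p j f) * h).coeff m :=
      coeff_mul_congr (fun a ha => hg.coeff_field f (hg.relevant_mono ha)) fun _ _ => rfl
    have e2 : (f * hg.field h).coeff m = (f * ∑ j ∈ J, g j * partialDeriv K p j h).coeff m :=
      coeff_mul_congr (fun _ _ => rfl) fun a ha => hg.coeff_field h (hg.relevant_mono ha)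
    rw [hg.coeff_field _ subset_rfl, coeff_add, coeff_smul, e1, e2, ← coeff_smul, ← coeff_add]
    simp only [key, Finset.sum_add_distrib, Finset.sum_mul, Finset.mul_sum, Finset.smul_sum]
    rfl
  continuous := finDep_iff.1 hg.finDep_field

end LocallyFiniteComponents

end Components

/-! ## Structure constants -/

section StructureConstants

open FormalFun

variable {K ι : Type*} [CommRing K]

/-- The left hand side of the Jacobi identity on basis vectors. -/
noncomputable def jacobiator (p : ι → ZMod 2) (c : (n : ℕ) → (Fin n → ι) → ι →₀ K) (n : ℕ)
    (I : Fin n → ι) : ι →₀ K :=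
  ∑ r : Fin (n + 1), ∑ σ ∈ shuffles n (r : ℕ), sg K (koszulExp (fun i => p (I i)) σ) •
    (c (r : ℕ) fun i : Fin (r : ℕ) => I (σ ⟨i, by omega⟩)).sum fun l a =>
      a • c (n - (r : ℕ) + 1)
        (Fin.cons l fun j : Fin (n - (r : ℕ)) => I (σ ⟨(r : ℕ) + (j : ℕ), by omega⟩))

/-- Structure constants of symmetric odd brackets of weight one on a graded superspace with
coordinates of parities `p` and weights `w`. -/
@[ext] structure SymmetricConstants (K : Type*) [CommRing K] {ι : Type*} (p : ι → ZMod 2)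
    (w : ι → ℤ) where
  const : (n : ℕ) → (Fin n → ι) → ι →₀ K
  symm : ∀ (n : ℕ) (I : Fin n → ι) (σ : Equiv.Perm (Fin n)),
    const n (fun i => I (σ i)) = sg K (koszulExp (fun i => p (I i)) σ) • const n I
  parity : ∀ (n : ℕ) (I : Fin n → ι) (j : ι), const n I j ≠ 0 → ∑ i, p (I i) = p j + 1
  weight : ∀ (n : ℕ) (I : Fin n → ι) (j : ι), const n I j ≠ 0 → ∑ i, w (I i) = w j + 1
  jacobi : ∀ (n : ℕ) (I : Fin n → ι), jacobiator p const n I = 0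

variable [LinearOrder ι] {p : ι → ZMod 2}

/-- The values at the origin of the iterated commutators of `X` with coordinate vector fields. -/
noncomputable def commutatorConst {X : FormalFun K p →ₗ[K] FormalFun K p} {c : ZMod 2}
    (hX : IsFormalVectorField X c) (n : ℕ) (I : Fin n → ι) : ι →₀ K :=
  Finsupp.ofSupportFinite (valueAtZero (coordCommutator X c I))
    ((hX.coordCommutator I).finDep.finite_valueAtZero 0)

variable {X : FormalFun K p →ₗ[K] FormalFun K p} {c : ZMod 2} (hX : IsFormalVectorField X c)

theorem commutatorConst_apply {n : ℕ} (I : Fin n → ι) (j : ι) :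
    commutatorConst hX n I j = (coordCommutator X c I (coord K p j)).coeff 0 := rfl

theorem commutatorConst_eq {n : ℕ} (I : Fin n → ι) (j : ι) : commutatorConst hX n I j =
    sg K (commExp c fun k => p (I k)) * (iterDeriv K p n I (X (coord K p j))).coeff 0 := by
  rw [commutatorConst_apply, hX.coordCommutator_coord, coeff_smul]

theorem commutatorConst_perm {n : ℕ} (I : Fin n → ι) (σ : Equiv.Perm (Fin n)) :
    commutatorConst hX n (fun i => I (σ i)) =
      sg K (koszulExp (fun i => p (I i)) σ) • commutatorConst hX n I := by
  ext j
  rw [Finsupp.smul_apply, commutatorConst_eq, commutatorConst_eq, iterDeriv_perm, coeff_smul,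
    commExp_perm c fun k => p (I k), smul_eq_mul]
  ring

theorem commutatorConst_hasDeg [Algebra ℚ K] {R : Type*} [CommRing R] {w : ι → R} {b : R} {j : ι}
    (hw : (X (coord K p j)).HasDeg w b) {n : ℕ} {I : Fin n → ι} (h : commutatorConst hX n I j ≠ 0) :
    ∑ i, w (I i) = b := by
  rw [commutatorConst_eq] at h
  obtain ⟨κ, _, hκ⟩ := exists_coeff_zero_iterDeriv (K := K) (p := p) I
  rw [← monoDeg_indexMono]
  refine hw _ fun h0 => h ?_
  rw [hκ, h0]; simp

/-- With l in the last slot the constant is the linear coefficient up to sign; moving l to the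
front, where the Jacobi identity has its inner bracket, costs a Koszul sign that cancels the part of
the sign involving T. -/
theorem commutatorConst_cons {n : ℕ} (l : ι) (T : Fin n → ι) (j : ι) :
    commutatorConst hX (n + 1) (Fin.cons l T) j =
      -(sg K (c * p l) * (coordCommutator X c T (coord K p j)).coeff (Finsupp.single l 1)) := by
  have h1 : (Fin.cons l T : Fin (n + 1) → ι) =
      fun i => (Fin.snoc T l : Fin (n + 1) → ι) (lastToFront n i) := by
    funext i
    induction i using Fin.cases with
    | zero => simp
    | succ i => simp
  have h2 : (coordCommutator X c (Fin.snoc T l : Fin (n + 1) → ι) (coord K p j)).coeff 0 =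
      -(sg K ((c + ∑ i, p (T i)) * p l) *
        (coordCommutator X c T (coord K p j)).coeff (Finsupp.single l 1)) := by
    rw [coordCommutator_succ, superCommutator_eq]
    simp only [LinearMap.sub_apply, LinearMap.comp_apply, LinearMap.smul_apply, Fin.snoc_castSucc,
      Fin.snoc_last]
    rw [(hX.coordCommutator _).map_partialDeriv_coord, zero_sub, ← neg_smul, coeff_smul,
      coeff_partialDeriv]
    simp
  rw [h1, commutatorConst_perm, Finsupp.smul_apply, commutatorConst_apply, h2, koszulExp_lastToFront,
    smul_eq_mul, add_mul, sg_add]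
  simp only [Fin.snoc_castSucc, Fin.snoc_last]
  rw [mul_comm (p l)]
  linear_combination -(sg K (c * p l) *
    (coordCommutator X c T (coord K p j)).coeff (Finsupp.single l 1)) *
    sg_mul_self (K := K) ((∑ i, p (T i)) * p l)

/-- The Jacobiator of the brackets defined by an odd vector field is given by its square. -/
theorem jacobiator_commutatorConst [Algebra ℚ K] (hX : IsFormalVectorField X 1) {n : ℕ}
    (I : Fin n → ι) (j : ι) :
    jacobiator p (commutatorConst hX) n I j = commutatorConst hX.square n I j := by
  have hpar : ∀ {n : ℕ} (I : Fin n → ι) (l : ι), commutatorConst hX n I l ≠ 0 →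
      p l = ∑ i, p (I i) + 1 := by
    intro n I l h
    rw [commutatorConst_hasDeg hX (hasParity_iff.1 (hX.parity _ _
      (hasParity_iff.2 (hasDeg_coord l)))) h, add_assoc, ZMod.two_add_self, add_zero]
  rw [commutatorConst_apply, coordCommutator]
  -- The parity 0 of the square is read as 1 + 1, to match the expansion of a composite of two odd
  -- fields.
  change _ = ((iteratedCommutator (X ∘ₗ X) (1 + 1) n _ _) _).coeff 0
  rw [iteratedCommutator_comp, LinearMap.sum_apply, coeff_sum, jacobiator]
  simp only [Finsupp.finsetSum_apply]
  refine sum_shuffles_eq_sum_masks _ _ fun r σ hσ => ?_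
  have hr : (r : ℕ) ≤ n := Nat.lt_succ_iff.1 r.2
  have hσ' := mem_shuffles.1 hσ
  have hφ : StrictMono fun i : Fin (r : ℕ) => σ ⟨i, by omega⟩ :=
    fun x y hxy => hσ' _ _ hxy (Or.inl y.2)
  have hψ : StrictMono fun i : Fin (n - (r : ℕ)) => σ ⟨(r : ℕ) + (i : ℕ), by omega⟩ :=
    fun x y hxy => hσ' _ _ (Nat.add_lt_add_left hxy _) (Or.inr (by simp))
  have hsφ : ∀ i, shuffleMask (r : ℕ) σ i = true ↔
      i ∈ Set.range fun i : Fin (r : ℕ) => σ ⟨i, by omega⟩ := by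
    intro i
    obtain ⟨i, rfl⟩ := σ.surjective i
    rw [shuffleMask_apply]
    simp only [decide_eq_true_eq, Set.mem_range, EmbeddingLike.apply_eq_iff_eq]
    exact ⟨fun h => ⟨⟨i, h⟩, rfl⟩, fun ⟨k, hk⟩ => by rw [← hk]; exact k.2⟩
  have hsψ : ∀ i, (!shuffleMask (r : ℕ) σ i) = true ↔
      i ∈ Set.range fun i : Fin (n - (r : ℕ)) => σ ⟨(r : ℕ) + (i : ℕ), by omega⟩ := by
    intro i
    obtain ⟨i, rfl⟩ := σ.surjective i
    rw [shuffleMask_apply]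
    simp only [Bool.not_eq_true', decide_eq_false_iff_not, not_lt, Set.mem_range,
      EmbeddingLike.apply_eq_iff_eq]
    exact ⟨fun h => ⟨⟨i - r, by omega⟩, Fin.ext (by simp; omega)⟩,
      fun ⟨k, hk⟩ => by rw [← hk]; simp⟩
  rw [maskCommutator_eq X 1 _ _ _ hφ hsφ, maskCommutator_eq X 1 _ _ _ hψ hsψ,
    sum_mask_eq _ _ hφ.injective hsφ, ← koszulExp_eq_maskExp _ hσ, LinearMap.smul_apply,
    LinearMap.comp_apply, coeff_smul, Finsupp.smul_apply, smul_eq_mul,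
    add_comm (1 * _), sg_add, mul_assoc]
  congr 1
  set S : Fin (r : ℕ) → ι := fun i => I (σ ⟨i, by omega⟩) with hS
  set T : Fin (n - (r : ℕ)) → ι := fun i => I (σ ⟨(r : ℕ) + (i : ℕ), by omega⟩) with hT
  change _ = _ * (coordCommutator X 1 S (coordCommutator X 1 T (coord K p j))).coeff 0
  -- At the origin the outer field acts only through its tangent vector, the inner bracket, on the
  -- linear coefficients of the other component.
  rw [(hX.coordCommutator S).evalZero_apply (commutatorConst hX _ S) (fun _ => rfl), Finsupp.sum_apply,
    Finsupp.sum, Finsupp.sum, Finset.mul_sum]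
  refine Finset.sum_congr rfl fun l hl => ?_
  -- The inner bracket is odd, so the parity of y l is one more than that of its arguments; the
  -- minus sign of `commutatorConst_cons` then leaves exactly the sign of moving the arguments S
  -- past the second X.
  rw [Finsupp.smul_apply, smul_eq_mul, commutatorConst_cons, hpar S l (Finsupp.mem_support_iff.1 hl),
    one_mul, one_mul, sg_add, sg_one]
  ring

variable {w : ι → ℤ}

/-- The structure constants defined by a homological vector field. -/
noncomputable def HomologicalVectorField.constants [Algebra ℚ K] (Q : HomologicalVectorField K p w) :
    SymmetricConstants K p w where
  const := commutatorConst Q.isVectorField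
  symm _ I σ := commutatorConst_perm _ I σ
  parity _ I j h := commutatorConst_hasDeg Q.isVectorField (hasParity_iff.1
    (Q.isVectorField.parity _ _ (hasParity_iff.2 (hasDeg_coord j)))) h
  weight _ I j h := commutatorConst_hasDeg Q.isVectorField (hasWeight_iff.1
    (Q.weight _ _ (hasWeight_iff.2 (hasDeg_coord j)))) h
  jacobi n I := by
    ext j
    rw [jacobiator_commutatorConst, commutatorConst_eq]
    simp [Q.square, coeff_zero]

theorem HomologicalVectorField.ext_field {Q Q' : HomologicalVectorField K p w}
    (h : Q.field = Q'.field) : Q = Q' := by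
  cases Q; cases Q'; cases h; rfl

theorem HomologicalVectorField.constants_injective [Algebra ℚ K] :
    Function.Injective (constants : HomologicalVectorField K p w → SymmetricConstants K p w) := by
  intro Q Q' h
  refine ext_field (Q.isVectorField.ext Q'.isVectorField fun j => ext_iterDeriv fun n I => ?_)
  have h1 : commutatorConst Q.isVectorField n I j = commutatorConst Q'.isVectorField n I j :=
    DFunLike.congr_fun (congrFun (congrFun (congrArg SymmetricConstants.const h) n) I) j
  rw [commutatorConst_eq, commutatorConst_eq] at h1
  exact (isUnit_sg _).mul_left_cancel h1

theorem HomologicalVectorField.constants_surjective [Algebra ℚ K] :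
    Function.Surjective (constants : HomologicalVectorField K p w → SymmetricConstants K p w) := by
  intro C
  choose g hg using fun j => exists_iterDeriv_eq (K := K) (p := p)
    (fun n I => sg K (commExp 1 fun k => p (I k)) * C.const n I j) fun n I σ => by
      rw [C.symm, commExp_perm 1 fun k => p (I k), Finsupp.smul_apply, smul_eq_mul]; ring
  have hne : ∀ (n : ℕ) (I : Fin n → ι) (j : ι), (g j).coeff (indexMono I) ≠ 0 →
      C.const n I j ≠ 0 := by
    intro n I j h h0
    obtain ⟨κ, hκ, hκ'⟩ := exists_coeff_zero_iterDeriv (K := K) (p := p) I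
    have h1 := hg j n I
    rw [hκ', h0, mul_zero] at h1
    exact h (hκ.mul_left_cancel (h1.trans (mul_zero κ).symm))
  -- A monomial y ^ indexMono I can occur in g j only for j in the finite support of the constants
  -- at I.
  have hfin : LocallyFiniteComponents g := by
    intro m
    obtain ⟨n, I, rfl⟩ := exists_indexMono_eq m
    exact (C.const n I).support.finite_toSet.subset fun j hj =>
      Finsupp.mem_support_iff.2 (hne n I j hj)
  have hp : ∀ j, (g j).HasDeg p (p j + 1) := by
    intro j m hm
    obtain ⟨n, I, rfl⟩ := exists_indexMono_eq m
    rw [monoDeg_indexMono]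
    exact C.parity n I j (hne n I j hm)
  have hw : ∀ j, (g j).HasDeg w (w j + 1) := by
    intro j m hm
    obtain ⟨n, I, rfl⟩ := exists_indexMono_eq m
    rw [monoDeg_indexMono]
    exact C.weight n I j (hne n I j hm)
  have hV := hfin.isFormalVectorField hp
  have hconst : commutatorConst hV = C.const := by
    funext n I
    ext j
    rw [commutatorConst_eq, hfin.field_coord, hg, ← mul_assoc, sg_mul_self, one_mul]
  have hzero : IsFormalVectorField (0 : FormalFun K p →ₗ[K] FormalFun K p) 0 :=
    { parity := fun f a _ m hm => absurd rfl hm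
      leibniz := fun f g a _ => by simp
      continuous := fun m => ⟨∅, fun f _ => rfl⟩ }
  refine ⟨⟨hfin.field, hV, fun f b hf =>
    hasWeight_iff.2 (hfin.hasDeg_field hw (hasWeight_iff.1 hf)), ?_⟩, ?_⟩
  -- The square is itself a vector field, and its Taylor coefficients are, up to sign, the
  -- Jacobiators, which vanish.
  · refine hV.square.ext hzero fun j => ext_iterDeriv fun n I => ?_
    have h1 := jacobiator_commutatorConst hV I j
    rw [hconst, C.jacobi, commutatorConst_eq] at h1
    rw [LinearMap.zero_apply, map_zero, coeff_zero]
    exact (isUnit_sg _).mul_left_cancel (h1.symm.trans (mul_zero _).symm)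
  · exact SymmetricConstants.ext hconst

/-- Homological vector fields correspond to their structure constants. -/
noncomputable def homologicalEquivConstants [Algebra ℚ K] :
    HomologicalVectorField K p w ≃ SymmetricConstants K p w :=
  Equiv.ofBijective HomologicalVectorField.constants
    ⟨HomologicalVectorField.constants_injective, HomologicalVectorField.constants_surjective⟩

end StructureConstants

/-! ## Multilinear maps on graded modules -/

section GradedMultilinear

variable {K ι V N : Type*} [CommRing K] [AddCommGroup V] [Module K V] [AddCommGroup N] [Module K N]
  {𝒱 : ZMod 2 × ℤ → Submodule K V} (h𝒱 : DirectSum.IsInternal 𝒱) (e : Module.Basis ι K V)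
  {p : ι → ZMod 2} {w : ι → ℤ} (he : ∀ i, e i ∈ 𝒱 (p i, w i))

/-- The projection onto the span of the basis vectors of degree `d`. -/
noncomputable def degreeProj (p : ι → ZMod 2) (w : ι → ℤ) (d : ZMod 2 × ℤ) : V →ₗ[K] V :=
  e.constr K fun l => if (p l, w l) = d then e l else 0

theorem degreeProj_basis (d : ZMod 2 × ℤ) (l : ι) :
    degreeProj e p w d (e l) = if (p l, w l) = d then e l else 0 :=
  e.constr_basis K _ l

-- The difference x - degreeProj x lies both in 𝒱 d and in the sum of the other components, so it is
-- zero by independence.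
include h𝒱 he in
theorem degreeProj_eq {d : ZMod 2 × ℤ} {x : V} (hx : x ∈ 𝒱 d) : degreeProj e p w d x = x := by
  have h1 : ∀ y, degreeProj e p w d y ∈ 𝒱 d := by
    intro y
    have : (⊤ : Submodule K V) ≤ (𝒱 d).comap (degreeProj e p w d) := by
      rw [← e.span_eq, Submodule.span_le]
      rintro _ ⟨l, rfl⟩
      rw [SetLike.mem_coe, Submodule.mem_comap, degreeProj_basis]
      split_ifs with h
      · exact h ▸ he l
      · exact Submodule.zero_mem _
    exact this trivial
  have h2 : ∀ y, y - degreeProj e p w d y ∈ ⨆ d' ≠ d, 𝒱 d' := by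
    intro y
    have : (⊤ : Submodule K V) ≤ (⨆ d' ≠ d, 𝒱 d').comap (LinearMap.id - degreeProj e p w d) := by
      rw [← e.span_eq, Submodule.span_le]
      rintro _ ⟨l, rfl⟩
      rw [SetLike.mem_coe, Submodule.mem_comap, LinearMap.sub_apply, degreeProj_basis,
        LinearMap.id_apply]
      split_ifs with h
      · rw [sub_self]; exact Submodule.zero_mem _
      · rw [sub_zero]
        exact Submodule.mem_iSup_of_mem _ (Submodule.mem_iSup_of_mem h (he l))
    exact this trivial
  have h3 := Submodule.disjoint_def.1 (h𝒱.submodule_iSupIndep d) (x - degreeProj e p w d x)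
    (Submodule.sub_mem _ hx (h1 x)) (h2 x)
  exact (sub_eq_zero.1 h3).symm

include h𝒱 he in
theorem repr_eq_zero_of_mem {d : ZMod 2 × ℤ} {x : V} (hx : x ∈ 𝒱 d) {l : ι}
    (hl : (p l, w l) ≠ d) : e.repr x l = 0 := by
  have h : e.coord l ∘ₗ degreeProj e p w d = 0 := by
    refine e.ext fun i => ?_
    rw [LinearMap.comp_apply, degreeProj_basis]
    split_ifs with hi
    · have : i ≠ l := by rintro rfl; exact hl hi
      simp [this]
    · simp
  have := LinearMap.congr_fun h x
  rw [LinearMap.comp_apply, degreeProj_eq h𝒱 e he hx] at this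
  simpa using this

include he in
theorem mem_of_repr {d : ZMod 2 × ℤ} {x : V} (hx : ∀ l, e.repr x l ≠ 0 → (p l, w l) = d) :
    x ∈ 𝒱 d := by
  rw [← e.linearCombination_repr x, Finsupp.linearCombination_apply]
  refine Submodule.sum_mem _ fun l hl => Submodule.smul_mem _ _ ?_
  rw [← hx l (Finsupp.mem_support_iff.1 hl)]
  exact he l

include h𝒱 he in
/-- A multilinear map vanishes on homogeneous vectors if it does on homogeneous basis vectors. -/
theorem MultilinearMap.eq_zero_of_basis {n : ℕ} (F : MultilinearMap K (fun _ : Fin n => V) N)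
    (d : Fin n → ZMod 2 × ℤ)
    (hF : ∀ I : Fin n → ι, (∀ i, (p (I i), w (I i)) = d i) → F (fun i => e (I i)) = 0)
    (x : Fin n → V) (hx : ∀ i, x i ∈ 𝒱 (d i)) : F x = 0 := by
  -- The signs in F may depend on the prescribed degrees d, so F need not vanish on other basis
  -- vectors; the projections remove these and fix the given x.
  have h : F.compLinearMap (fun i => degreeProj e p w (d i)) = 0 := by
    refine Module.Basis.ext_multilinear (fun _ => e) fun I => ?_
    rw [MultilinearMap.compLinearMap_apply, zero_apply]
    by_cases hI : ∀ i, (p (I i), w (I i)) = d i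
    · simp only [degreeProj_basis, hI, if_true]
      exact hF I hI
    · push Not at hI
      obtain ⟨i, hi⟩ := hI
      refine MultilinearMap.map_coord_zero F i ?_
      rw [degreeProj_basis, if_neg hi]
  have h1 := congrArg (fun G => G x) h
  simp only [MultilinearMap.compLinearMap_apply, degreeProj_eq h𝒱 e he (hx _)] at h1
  exact h1

/-- The multilinear map with given values on basis vectors. -/
noncomputable def basisMultilinear : (n : ℕ) → ((Fin n → ι) → N) →
    MultilinearMap K (fun _ : Fin n => V) N
  | 0, c => MultilinearMap.constOfIsEmpty K _ (c Fin.elim0)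
  | n + 1, c => LinearMap.uncurryLeft
      (e.constr K fun i => basisMultilinear n fun I => c (Fin.cons i I))

theorem basisMultilinear_basis {n : ℕ} (c : (Fin n → ι) → N) (I : Fin n → ι) :
    basisMultilinear e n c (fun i => e (I i)) = c I := by
  induction n with
  | zero =>
    change c _ = c I
    congr 1
    exact Subsingleton.elim _ _
  | succ n ih =>
    rw [basisMultilinear, LinearMap.uncurryLeft_apply, e.constr_basis]
    change basisMultilinear e n _ (fun i => e (I i.succ)) = _
    rw [ih]
    congr
    exact Fin.cons_self_tail I

/-- `nestedBracket` as a multilinear map. -/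
noncomputable def nestedMultilinear (br : (n : ℕ) → MultilinearMap K (fun _ : Fin n => V) V) {n : ℕ}
    (r : Fin (n + 1)) (σ : Equiv.Perm (Fin n)) : MultilinearMap K (fun _ : Fin n => V) V :=
  MultilinearMap.domDomCongr
    ((finSumFinEquiv.trans (finCongr (by omega : (r : ℕ) + (n - (r : ℕ)) = n))).trans σ)
    (MultilinearMap.uncurrySum (N := fun _ : Fin (r : ℕ) ⊕ Fin (n - (r : ℕ)) => V)
      ((br (n - (r : ℕ) + 1)).curryLeft.compMultilinearMap (br (r : ℕ))))

theorem nestedMultilinear_apply (br : (n : ℕ) → MultilinearMap K (fun _ : Fin n => V) V) {n : ℕ}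
    (r : Fin (n + 1)) (σ : Equiv.Perm (Fin n)) (x : Fin n → V) :
    nestedMultilinear br r σ x = nestedBracket br r σ x := rfl

end GradedMultilinear

/-! ## Décalage -/

section Decalage

/-- Each entry is weighted by the number of entries to its right, and entries of the first block
have s more of them in the whole sequence. -/
theorem decalageExp_split {n r s : ℕ} (h : r + s = n) (a : Fin n → ZMod 2) :
    decalageExp a = decalageExp (fun i : Fin r => a ⟨i, by omega⟩) +
      (s : ZMod 2) * ∑ i : Fin r, a ⟨i, by omega⟩ +
      decalageExp fun j : Fin s => a ⟨r + j, by omega⟩ := by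
  subst h
  simp only [decalageExp, Fin.sum_univ_add]
  rw [Finset.mul_sum, ← Finset.sum_add_distrib]
  congr 1
  · refine Finset.sum_congr rfl fun i _ => ?_
    change a (Fin.castAdd s i) * (((r + s : ℕ) : ZMod 2) - 1 - ((i : ℕ) : ZMod 2)) =
      a (Fin.castAdd s i) * _ + _ * a (Fin.castAdd s i)
    push_cast
    ring
  · refine Finset.sum_congr rfl fun i _ => ?_
    change a (Fin.natAdd r i) * (((r + s : ℕ) : ZMod 2) - 1 - ((r + i : ℕ) : ZMod 2)) =
      a (Fin.natAdd r i) * _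
    push_cast
    ring

theorem decalageExp_cons {s : ℕ} (x : ZMod 2) (a : Fin s → ZMod 2) :
    decalageExp (Fin.cons x a : Fin (s + 1) → ZMod 2) = x * s + decalageExp a := by
  simp only [decalageExp, Fin.sum_univ_succ, Fin.cons_zero, Fin.cons_succ]
  congr 1
  · push_cast; simp
  · refine Finset.sum_congr rfl fun i _ => ?_
    rw [Fin.val_succ]
    push_cast; ring

/-- The exponent of the sign in the (anti)symmetry of the brackets. -/
def symmExp {n : ℕ} (ε : ZMod 2) (a : Fin n → ZMod 2) (σ : Equiv.Perm (Fin n)) : ZMod 2 :=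
  koszulExp (fun i => a i + (1 + ε)) σ +
    (1 + ε) * (decalageExp (fun i => a (σ i)) + decalageExp a)

theorem symmExp_one {n : ℕ} {ε : ZMod 2} (hε : ε = 1) (a : Fin n → ZMod 2)
    (σ : Equiv.Perm (Fin n)) : (-1 : ℤˣ) ^ symmExp ε a σ = koszulSign a σ := by
  subst hε
  have : (1 : ZMod 2) + 1 = 0 := rfl
  simp only [symmExp, this, add_zero, zero_mul, koszulSign_eq]

theorem symmExp_zero {n : ℕ} {ε : ZMod 2} (hε : ε = 0) (a : Fin n → ZMod 2)
    (σ : Equiv.Perm (Fin n)) :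
    (-1 : ℤˣ) ^ symmExp ε a σ = Equiv.Perm.sign σ * koszulSign a σ := by
  subst hε
  simp only [symmExp, add_zero, one_mul]
  rw [koszulExp_add_one, add_assoc, ZMod.two_add_self, add_zero, uzpow_add, sign_eq_koszulExp,
    koszulSign_eq]

/-- The exponent of the sign in the Jacobi identity. -/
def jacobiExp {n : ℕ} (ε : ZMod 2) (a : Fin n → ZMod 2) (r : ℕ) (σ : Equiv.Perm (Fin n)) : ZMod 2 :=
  (1 + ε) * ((r * (n - r) : ℕ) : ZMod 2) + symmExp ε a σ

theorem jacobiExp_one {n : ℕ} {ε : ZMod 2} (hε : ε = 1) (a : Fin n → ZMod 2) (r : ℕ)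
    (σ : Equiv.Perm (Fin n)) : (-1 : ℤˣ) ^ jacobiExp ε a r σ = koszulSign a σ := by
  rw [jacobiExp, uzpow_add, symmExp_one hε, hε, show (1 : ZMod 2) + 1 = 0 from rfl, zero_mul,
    uzpow_zero, one_mul]

theorem jacobiExp_zero {n : ℕ} {ε : ZMod 2} (hε : ε = 0) (a : Fin n → ZMod 2) (r : ℕ)
    (σ : Equiv.Perm (Fin n)) : (-1 : ℤˣ) ^ jacobiExp ε a r σ =
      (-1 : ℤˣ) ^ (r * (n - r)) * Equiv.Perm.sign σ * koszulSign a σ := by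
  rw [jacobiExp, uzpow_add, symmExp_zero hε, hε, add_zero, one_mul, uzpow_natCast, mul_assoc]

/-- The exponent of the sign between brackets of basis vectors and structure constants. -/
def bracketExp {n : ℕ} (ε : ZMod 2) (a : Fin n → ZMod 2) : ZMod 2 :=
  -- For ε = 0 the summand n compares the sign of i_u for the output with those for the inputs,
  -- since the parity of the output is the sum of the input parities plus n.
  (1 + ε) * (decalageExp a + n)

theorem bracketExp_perm {n : ℕ} (ε : ZMod 2) (a : Fin n → ZMod 2) (σ : Equiv.Perm (Fin n)) :
    bracketExp ε (fun i => a (σ i)) + koszulExp (fun i => a i + (1 + ε)) σ =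
      symmExp ε a σ + bracketExp ε a := by
  unfold symmExp bracketExp
  generalize koszulExp (fun i => a i + (1 + ε)) σ = t1
  generalize decalageExp (fun i => a (σ i)) = t2
  generalize decalageExp a = t3
  generalize (n : ZMod 2) = t5
  revert ε t1 t2 t3 t5
  decide

theorem bracketExp_perm' {n : ℕ} (ε : ZMod 2) (a : Fin n → ZMod 2) (σ : Equiv.Perm (Fin n)) :
    bracketExp ε (fun i => a (σ i)) + symmExp ε a σ =
      koszulExp (fun i => a i + (1 + ε)) σ + bracketExp ε a := by
  have h := bracketExp_perm ε a σ
  generalize koszulExp (fun i => a i + (1 + ε)) σ = t1 at *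
  generalize bracketExp ε (fun i => a (σ i)) = t2 at *
  generalize bracketExp ε a = t3 at *
  generalize symmExp ε a σ = t5 at *
  clear a
  revert t1 t2 t3 t5
  decide

/-- Here x is the parity of the inner bracket. Apart from the décalage of the whole sequence, the
only dependence on the splitting is r * s, the exponent required in the antisymmetric Jacobi
identity. -/
theorem bracketExp_nested {n r s : ℕ} (h : r + s = n) (ε : ZMod 2) (a : Fin n → ZMod 2) (x : ZMod 2)
    (hx : x = ∑ i : Fin r, a ⟨i, by omega⟩ + (ε * ((r : ZMod 2) + 1) + r)) :
    bracketExp ε (fun i : Fin r => a ⟨i, by omega⟩) +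
      bracketExp ε (Fin.cons x fun j : Fin s => a ⟨r + j, by omega⟩ : Fin (s + 1) → ZMod 2) =
    (1 + ε) * (decalageExp a + (r * s : ℕ) + n + 1) := by
  rw [decalageExp_split h a]
  unfold bracketExp
  have hn : (n : ZMod 2) = r + s := by rw [← h]; push_cast; rfl
  rw [decalageExp_cons, hx, hn]
  push_cast
  generalize decalageExp (fun i : Fin r => a ⟨i, _⟩) = t1
  generalize decalageExp (fun j : Fin s => a ⟨r + j, _⟩) = t2
  generalize (∑ i : Fin r, a ⟨i, _⟩) = t3
  generalize (r : ZMod 2) = t4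
  generalize (s : ZMod 2) = t5
  clear hx
  revert ε t1 t2 t3 t4 t5
  decide

end Decalage

/-! ## Brackets and structure constants -/

section BracketConstants

variable {K ι V : Type*} [CommRing K] [AddCommGroup V] [Module K V]
  {𝒱 : ZMod 2 × ℤ → Submodule K V} {ε : ZMod 2} {k : ℤ}

theorem ShiftedLInfinity.ext_bracket {L L' : ShiftedLInfinity 𝒱 ε k}
    (h : L.bracket = L'.bracket) : L = L' := by
  cases L; cases L'; cases h; rfl

theorem ShiftedLInfinity.bracket_perm (L : ShiftedLInfinity 𝒱 ε k) {n : ℕ} (x : Fin n → V)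
    (d : Fin n → ZMod 2 × ℤ) (hx : ∀ i, x i ∈ 𝒱 (d i)) (σ : Equiv.Perm (Fin n)) :
    L.bracket n (fun i => x (σ i)) = sg K (symmExp ε (fun i => (d i).1) σ) • L.bracket n x := by
  rw [← uzpow_smul]
  rcases ZMod.two_eq_zero_or_one ε with h | h
  · rw [symmExp_zero h, L.antisymm h n x d hx]
  · rw [symmExp_one h, L.symm h n x d hx]

theorem ShiftedLInfinity.jacobi (L : ShiftedLInfinity 𝒱 ε k) {n : ℕ} (x : Fin n → V)
    (d : Fin n → ZMod 2 × ℤ) (hx : ∀ i, x i ∈ 𝒱 (d i)) :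
    ∑ r : Fin (n + 1), ∑ σ ∈ shuffles n (r : ℕ),
      sg K (jacobiExp ε (fun i => (d i).1) (r : ℕ) σ) • nestedBracket L.bracket r σ x = 0 := by
  simp only [← uzpow_smul]
  rcases ZMod.two_eq_zero_or_one ε with h | h
  · simp only [jacobiExp_zero h]
    exact L.jacobi_even h n x d hx
  · simp only [jacobiExp_one h]
    exact L.jacobi_odd h n x d hx

/-- The degrees of an (ε, k)-shifted bracket are those for which, after the shift of coordinates,
the corresponding vector field is odd of weight +1. -/
theorem degree_iff (ε : ZMod 2) (k : ℤ) (p : ι → ZMod 2) (w : ι → ℤ) {n : ℕ} (I : Fin n → ι) (j : ι) :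
    (p j, w j) = (∑ i, (p (I i), w (I i))) +
      (ε * ((n : ZMod 2) + 1) + (n : ZMod 2), 2 - (n : ℤ) + k * ((n : ℤ) - 1)) ↔
    ∑ i, shiftedParity ε p (I i) = shiftedParity ε p j + 1 ∧
      ∑ i, shiftedWeight k w (I i) = shiftedWeight k w j + 1 := by
  have h1 : (∑ i, (p (I i), w (I i)) : ZMod 2 × ℤ) = (∑ i, p (I i), ∑ i, w (I i)) := by
    ext <;> simp [Prod.fst_sum, Prod.snd_sum]
  simp only [h1, Prod.mk_add_mk, Prod.mk.injEq, shiftedParity, shiftedWeight, Finset.sum_add_distrib,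
    Finset.sum_const, Finset.card_univ, Fintype.card_fin, nsmul_eq_mul, Finset.sum_neg_distrib]
  refine and_congr ?_ ?_
  · generalize ∑ i, p (I i) = x
    generalize p j = y
    generalize (n : ZMod 2) = z
    revert x y z ε; decide
  · constructor <;> intro h <;> linarith

variable (e : Module.Basis ι K V) {p : ι → ZMod 2} {w : ι → ℤ}

/-- The brackets `br` have structure constants `c`. -/
def HasConstants (p : ι → ZMod 2) (ε : ZMod 2)
    (br : (n : ℕ) → MultilinearMap K (fun _ : Fin n => V) V)
    (c : (n : ℕ) → (Fin n → ι) → ι →₀ K) : Prop :=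
  ∀ (n : ℕ) (I : Fin n → ι), e.repr (br n fun i => e (I i)) =
    sg K (bracketExp ε fun i => p (I i)) • c n I

variable {e} {br : (n : ℕ) → MultilinearMap K (fun _ : Fin n => V) V}
  {c : (n : ℕ) → (Fin n → ι) → ι →₀ K}

theorem HasConstants.repr_nestedBracket (h : HasConstants e p ε br c)
    (hc : ∀ (n : ℕ) (I : Fin n → ι) (j : ι), c n I j ≠ 0 →
      p j = ∑ i, p (I i) + (ε * ((n : ZMod 2) + 1) + n)) {n : ℕ} (r : Fin (n + 1))
    (σ : Equiv.Perm (Fin n)) (I : Fin n → ι) :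
    e.repr (nestedBracket br r σ fun i => e (I i)) =
      sg K ((1 + ε) * (decalageExp (fun i => p (I (σ i))) +
        (((r : ℕ) * (n - (r : ℕ)) : ℕ) : ZMod 2) + n + 1)) •
      (c (r : ℕ) fun i : Fin (r : ℕ) => I (σ ⟨i, by omega⟩)).sum fun l a =>
        a • c (n - (r : ℕ) + 1)
          (Fin.cons l fun j : Fin (n - (r : ℕ)) => I (σ ⟨(r : ℕ) + (j : ℕ), by omega⟩)) := by
  set S : Fin (r : ℕ) → ι := fun i => I (σ ⟨i, by omega⟩) with hS
  set T : Fin (n - (r : ℕ)) → ι := fun i => I (σ ⟨(r : ℕ) + (i : ℕ), by omega⟩) with hT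
  have hT' : ∀ l, (Fin.cons (e l) fun j => e (T j) : Fin (n - (r : ℕ) + 1) → V) =
      fun i => e ((Fin.cons l T : Fin (n - (r : ℕ) + 1) → ι) i) := by
    intro l
    funext i
    induction i using Fin.cases <;> simp
  -- The outer bracket as a linear function of its first slot, so that the inner bracket can be
  -- expanded in the basis.
  let lin : V →ₗ[K] ι →₀ K :=
    { toFun := fun v => e.repr ((br (n - (r : ℕ) + 1)).curryLeft v fun j => e (T j))
      map_add' := fun v v' => by rw [map_add, add_apply, map_add]
      map_smul' := fun a v => by rw [map_smul, smul_apply, map_smul]; rfl }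
  have hlin : ∀ v, lin v = (e.repr v).sum fun l a => a • lin (e l) := by
    intro v
    conv_lhs => rw [← e.linearCombination_repr v, Finsupp.linearCombination_apply, map_finsuppSum]
    simp only [map_smul]
  have hlin' : ∀ l, lin (e l) = sg K (bracketExp ε fun i =>
      p ((Fin.cons l T : Fin (n - (r : ℕ) + 1) → ι) i)) • c (n - (r : ℕ) + 1) (Fin.cons l T) := by
    intro l
    rw [← h]
    change e.repr (br _ (Fin.cons (e l) fun j => e (T j))) = _
    rw [hT']
  change lin (br (r : ℕ) fun i => e (S i)) = _
  rw [hlin, h, Finsupp.sum_smul_index (fun i => by simp), Finsupp.smul_sum]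
  refine Finsupp.sum_congr fun l hl => ?_
  rw [hlin', mul_smul, smul_comm _ (sg K _) (c _ _), smul_smul, ← sg_add]
  congr 2
  rw [← bracketExp_nested (by omega : (r : ℕ) + (n - (r : ℕ)) = n) ε (fun i => p (I (σ i))) (p l)
    (hc _ S l (Finsupp.mem_support_iff.1 hl))]
  congr 2
  funext i
  induction i using Fin.cases <;> simp [hT]

/-- The Jacobi identity on basis vectors. -/
theorem HasConstants.repr_jacobi (h : HasConstants e p ε br c)
    (hc : ∀ (n : ℕ) (I : Fin n → ι) (j : ι), c n I j ≠ 0 →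
      p j = ∑ i, p (I i) + (ε * ((n : ZMod 2) + 1) + n)) {n : ℕ} (I : Fin n → ι) :
    e.repr (∑ r : Fin (n + 1), ∑ σ ∈ shuffles n (r : ℕ),
      sg K (jacobiExp ε (fun i => p (I i)) (r : ℕ) σ) •
        nestedBracket br r σ fun i => e (I i)) =
    sg K ((1 + ε) * (decalageExp (fun i => p (I i)) + n + 1)) •
      jacobiator (shiftedParity ε p) c n I := by
  simp only [jacobiator, map_sum, map_smul, Finset.smul_sum]
  refine Finset.sum_congr rfl fun r _ => Finset.sum_congr rfl fun σ _ => ?_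
  rw [h.repr_nestedBracket hc, smul_smul, smul_smul, ← sg_add, ← sg_add, jacobiExp, symmExp]
  congr 2
  -- The exponent r(n - r) and the décalage of the permuted sequence each occur twice and cancel, so
  -- besides the Koszul sign only a factor independent of r and σ remains.
  change _ = _ + koszulExp (fun i => p (I i) + (1 + ε)) σ
  generalize koszulExp (fun i => p (I i) + (1 + ε)) σ = t1
  generalize decalageExp (fun i => p (I (σ i))) = t2
  generalize decalageExp (fun i => p (I i)) = t3
  generalize (((r : ℕ) * (n - (r : ℕ)) : ℕ) : ZMod 2) = t4
  generalize (n : ZMod 2) = t5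
  clear h hc
  revert ε t1 t2 t3 t4 t5
  decide

end BracketConstants

/-! ### Shifted `L∞`-structures and symmetric structure constants -/

section BracketEquiv

variable {K ι V : Type*} [CommRing K] [AddCommGroup V] [Module K V]
  {𝒱 : ZMod 2 × ℤ → Submodule K V} {ε : ZMod 2} {k : ℤ}
  (h𝒱 : DirectSum.IsInternal 𝒱) (e : Module.Basis ι K V)
  {p : ι → ZMod 2} {w : ι → ℤ} (he : ∀ i, e i ∈ 𝒱 (p i, w i))

namespace SymmetricConstants

variable (C : SymmetricConstants K (shiftedParity ε p) (shiftedWeight k w))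

theorem degree_eq {n : ℕ} {I : Fin n → ι} {j : ι} (h : C.const n I j ≠ 0) :
    (p j, w j) = (∑ i, (p (I i), w (I i))) +
      (ε * ((n : ZMod 2) + 1) + (n : ZMod 2), 2 - (n : ℤ) + k * ((n : ℤ) - 1)) :=
  (degree_iff ε k p w I j).2 ⟨C.parity n I j h, C.weight n I j h⟩

theorem parity_eq {n : ℕ} {I : Fin n → ι} {j : ι} (h : C.const n I j ≠ 0) :
    p j = ∑ i, p (I i) + (ε * ((n : ZMod 2) + 1) + n) := by
  have := congrArg Prod.fst (C.degree_eq h)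
  simpa [Prod.fst_sum] using this

/-- The brackets with structure constants `C`. -/
noncomputable def bracket (n : ℕ) : MultilinearMap K (fun _ : Fin n => V) V :=
  basisMultilinear e n fun I =>
    e.repr.symm (sg K (bracketExp ε fun i => p (I i)) • C.const n I)

theorem hasConstants : HasConstants e p ε (C.bracket e) C.const := fun n I => by
  rw [bracket, basisMultilinear_basis, LinearEquiv.apply_symm_apply]

include h𝒱 he in
theorem bracket_mem {n : ℕ} (x : Fin n → V) (d : Fin n → ZMod 2 × ℤ) (hx : ∀ i, x i ∈ 𝒱 (d i)) :
    C.bracket e n x ∈ 𝒱 ((∑ i, d i) +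
      (ε * ((n : ZMod 2) + 1) + (n : ZMod 2), 2 - (n : ℤ) + k * ((n : ℤ) - 1))) := by
  set D := (∑ i, d i) +
      (ε * ((n : ZMod 2) + 1) + (n : ZMod 2), 2 - (n : ℤ) + k * ((n : ℤ) - 1)) with hD
  -- Membership becomes the vanishing of a multilinear map into the quotient, which can be tested on
  -- basis vectors.
  rw [← Submodule.Quotient.mk_eq_zero (𝒱 D)]
  refine MultilinearMap.eq_zero_of_basis h𝒱 e he
    ((𝒱 D).mkQ.compMultilinearMap (C.bracket e n)) d (fun I hI => ?_) x hx
  rw [LinearMap.compMultilinearMap_apply, Submodule.mkQ_apply, Submodule.Quotient.mk_eq_zero]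
  refine mem_of_repr e he fun l hl => ?_
  rw [C.hasConstants e, Finsupp.smul_apply] at hl
  rw [C.degree_eq (right_ne_zero_of_smul hl), hD]
  simp only [hI]

include h𝒱 he in
theorem bracket_perm {n : ℕ} (x : Fin n → V) (d : Fin n → ZMod 2 × ℤ) (hx : ∀ i, x i ∈ 𝒱 (d i))
    (σ : Equiv.Perm (Fin n)) : C.bracket e n (fun i => x (σ i)) =
      sg K (symmExp ε (fun i => (d i).1) σ) • C.bracket e n x := by
  rw [← sub_eq_zero]
  refine MultilinearMap.eq_zero_of_basis h𝒱 e he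
    ((C.bracket e n).domDomCongr σ - sg K (symmExp ε (fun i => (d i).1) σ) • C.bracket e n) d
    (fun I hI => ?_) x hx
  refine e.repr.injective ?_
  have hd : ∀ i, (d i).1 = p (I i) := fun i => by rw [← hI i]
  rw [sub_apply, smul_apply, MultilinearMap.domDomCongr_apply,
    map_sub, map_smul, map_zero, C.hasConstants e n I, C.hasConstants e n fun i => I (σ i), C.symm,
    sub_eq_zero, smul_smul, smul_smul, ← sg_add, ← sg_add]
  congr 2
  simp only [hd]
  exact bracketExp_perm ε (fun i => p (I i)) σ

include h𝒱 he in
theorem bracket_jacobi {n : ℕ} (x : Fin n → V) (d : Fin n → ZMod 2 × ℤ)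
    (hx : ∀ i, x i ∈ 𝒱 (d i)) :
    ∑ r : Fin (n + 1), ∑ σ ∈ shuffles n (r : ℕ),
      sg K (jacobiExp ε (fun i => (d i).1) (r : ℕ) σ) • nestedBracket (C.bracket e) r σ x = 0 := by
  have happ : ∀ y, (∑ r : Fin (n + 1), ∑ σ ∈ shuffles n (r : ℕ),
      sg K (jacobiExp ε (fun i => (d i).1) (r : ℕ) σ) • nestedMultilinear (C.bracket e) r σ) y =
      ∑ r : Fin (n + 1), ∑ σ ∈ shuffles n (r : ℕ),
      sg K (jacobiExp ε (fun i => (d i).1) (r : ℕ) σ) • nestedBracket (C.bracket e) r σ y := by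
    intro y
    simp only [sum_apply, smul_apply, nestedMultilinear_apply]
  rw [← happ]
  refine MultilinearMap.eq_zero_of_basis h𝒱 e he _ d (fun I hI => ?_) x hx
  have hd : ∀ i, (d i).1 = p (I i) := fun i => by rw [← hI i]
  refine e.repr.injective ?_
  rw [happ, map_zero]
  simp only [hd]
  rw [(C.hasConstants e).repr_jacobi fun n I j h => C.parity_eq h, C.jacobi, smul_zero]

/-- The shifted `L∞`-algebra with structure constants `C`. -/
noncomputable def toShiftedLInfinity : ShiftedLInfinity 𝒱 ε k where
  bracket := C.bracket e
  degree _ x d hx := C.bracket_mem h𝒱 e he x d hx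
  antisymm hε n x d hx σ := by
    rw [C.bracket_perm h𝒱 e he x d hx σ, ← uzpow_smul, symmExp_zero hε]
  symm hε n x d hx σ := by
    rw [C.bracket_perm h𝒱 e he x d hx σ, ← uzpow_smul, symmExp_one hε]
  jacobi_even hε n x d hx := by
    simpa only [← uzpow_smul, jacobiExp_zero hε] using C.bracket_jacobi h𝒱 e he x d hx
  jacobi_odd hε n x d hx := by
    simpa only [← uzpow_smul, jacobiExp_one hε] using C.bracket_jacobi h𝒱 e he x d hx

end SymmetricConstants

namespace ShiftedLInfinity

variable (L : ShiftedLInfinity 𝒱 ε k)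

/-- The structure constants of a shifted `L∞`-algebra. -/
noncomputable def const (p : ι → ZMod 2) (n : ℕ) (I : Fin n → ι) : ι →₀ K :=
  sg K (bracketExp ε fun i => p (I i)) • e.repr (L.bracket n fun i => e (I i))

theorem hasConstants : HasConstants e p ε L.bracket (L.const e p) := fun n I => by
  rw [const, sg_smul_smul_self]

include h𝒱 he in
theorem const_degree {n : ℕ} {I : Fin n → ι} {j : ι} (h : L.const e p n I j ≠ 0) :
    (p j, w j) = (∑ i, (p (I i), w (I i))) +
      (ε * ((n : ZMod 2) + 1) + (n : ZMod 2), 2 - (n : ℤ) + k * ((n : ℤ) - 1)) := by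
  by_contra hne
  refine h ?_
  rw [const, Finsupp.smul_apply, repr_eq_zero_of_mem h𝒱 e he
    (L.degree n (fun i => e (I i)) (fun i => (p (I i), w (I i))) fun i => he _) hne, smul_zero]

/-- The structure constants of a shifted `L∞`-algebra. -/
noncomputable def constants : SymmetricConstants K (shiftedParity ε p) (shiftedWeight k w) where
  const := L.const e p
  symm n I σ := by
    rw [const, L.bracket_perm (fun i => e (I i)) (fun i => (p (I i), w (I i))) (fun i => he _) σ,
      map_smul, const, smul_smul, smul_smul, ← sg_add, ← sg_add]
    congr 2
    exact bracketExp_perm' ε (fun i => p (I i)) σ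
  parity n I j h := ((degree_iff ε k p w I j).1 (L.const_degree h𝒱 e he h)).1
  weight n I j h := ((degree_iff ε k p w I j).1 (L.const_degree h𝒱 e he h)).2
  jacobi n I := by
    have h := (L.hasConstants e (p := p)).repr_jacobi (fun n I j h => by
      have := congrArg Prod.fst (L.const_degree h𝒱 e he h)
      simpa [Prod.fst_sum] using this) I
    rw [L.jacobi (fun i => e (I i)) (fun i => (p (I i), w (I i))) fun i => he _, map_zero] at h
    rw [← sg_smul_smul_self (K := K) ((1 + ε) * (decalageExp (fun i => p (I i)) + n + 1))
      (jacobiator (shiftedParity ε p) (L.const e p) n I), ← h, smul_zero]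

end ShiftedLInfinity

/-- Shifted `L∞`-algebra structures correspond to their structure constants. -/
noncomputable def constantsEquivShiftedLInfinity :
    SymmetricConstants K (shiftedParity ε p) (shiftedWeight k w) ≃ ShiftedLInfinity 𝒱 ε k where
  toFun C := C.toShiftedLInfinity h𝒱 e he
  invFun L := L.constants h𝒱 e he
  left_inv C := by
    refine SymmetricConstants.ext ?_
    funext n I
    change sg K _ • e.repr (C.bracket e n fun i => e (I i)) = _
    rw [C.hasConstants e, sg_smul_smul_self]
  right_inv L := by
    refine ShiftedLInfinity.ext_bracket ?_
    funext n
    refine Module.Basis.ext_multilinear (fun _ => e) fun I => e.repr.injective ?_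
    change e.repr ((L.constants h𝒱 e he).bracket e n _) = _
    rw [(L.constants h𝒱 e he).hasConstants e, L.hasConstants e n I]
    rfl

end BracketEquiv

/-! ## The derived bracket formula -/

section DerivedBrackets

open FormalFun

variable {K ι V : Type*} [CommRing K] [LinearOrder ι] [AddCommGroup V] [Module K V]

/-- `valueAtZero` as a linear map. -/
noncomputable def valueAtZeroLin (K : Type*) [CommRing K] (p : ι → ZMod 2) :
    (FormalFun K p →ₗ[K] FormalFun K p) →ₗ[K] ι → K where
  toFun := valueAtZero
  map_add' X Y := by
    funext j
    exact coeff_add _ _ _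
  map_smul' a X := by
    funext j
    exact coeff_smul _ _ _

/-- `superCommutator` as a bilinear map. -/
noncomputable def superCommutatorLin (K : Type*) [CommRing K] (p : ι → ZMod 2) (c d : ZMod 2) :
    (FormalFun K p →ₗ[K] FormalFun K p) →ₗ[K] (FormalFun K p →ₗ[K] FormalFun K p) →ₗ[K]
      (FormalFun K p →ₗ[K] FormalFun K p) :=
  LinearMap.mk₂ K (fun X Y => superCommutator X c Y d)
    (fun X X' Y => by
      simp only [superCommutator_eq, LinearMap.add_comp, LinearMap.comp_add]; module)
    (fun a X Y => by
      simp only [superCommutator_eq, LinearMap.smul_comp, LinearMap.comp_smul]; module)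
    (fun X Y Y' => by
      simp only [superCommutator_eq, LinearMap.add_comp, LinearMap.comp_add]; module)
    (fun a X Y => by
      simp only [superCommutator_eq, LinearMap.smul_comp, LinearMap.comp_smul]; module)

/-- `iteratedCommutator` as a multilinear map. -/
noncomputable def iteratedCommutatorLin {p : ι → ZMod 2} (X : FormalFun K p →ₗ[K] FormalFun K p)
    (c : ZMod 2) : (n : ℕ) → (Fin n → ZMod 2) →
      MultilinearMap K (fun _ : Fin n => FormalFun K p →ₗ[K] FormalFun K p)
        (FormalFun K p →ₗ[K] FormalFun K p)
  | 0, _ => MultilinearMap.constOfIsEmpty K _ X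
  | n + 1, d => MultilinearMap.uncurryRight
      ((superCommutatorLin K p (c + ∑ i : Fin n, d i.castSucc) (d (Fin.last n))).compMultilinearMap
        (iteratedCommutatorLin X c n fun i => d i.castSucc))

theorem iteratedCommutatorLin_apply {p : ι → ZMod 2} (X : FormalFun K p →ₗ[K] FormalFun K p)
    (c : ZMod 2) {n : ℕ} (d : Fin n → ZMod 2)
    (Y : Fin n → (FormalFun K p →ₗ[K] FormalFun K p)) :
    iteratedCommutatorLin X c n d Y = iteratedCommutator X c n Y d := by
  induction n with
  | zero => rfl
  | succ n ih =>
    rw [iteratedCommutatorLin, MultilinearMap.uncurryRight_apply, LinearMap.compMultilinearMap_apply,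
      ih]
    rfl

variable (e : Module.Basis ι K V) (ε : ZMod 2) (p : ι → ZMod 2)

/-- `constantField` as a linear map. -/
noncomputable def constantFieldLin :
    V →ₗ[K] (FormalFun K (shiftedParity ε p) →ₗ[K] FormalFun K (shiftedParity ε p)) :=
  e.constr K fun i => sg K ((1 + ε) * p i) • partialDeriv K (shiftedParity ε p) i

theorem constantFieldLin_apply (u : V) : constantFieldLin e ε p u = constantField e ε p u := by
  rw [constantFieldLin, Module.Basis.constr_apply, constantField]
  refine Finsupp.sum_congr fun i _ => ?_
  rw [uzpow_smul (K := K), smul_comm]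

theorem valueAtZero_constantField (u : V) (j : ι) :
    valueAtZero (constantField e ε p u) j = sg K ((1 + ε) * p j) * e.repr u j := by
  let F : V →ₗ[K] K := LinearMap.proj j ∘ₗ valueAtZeroLin K (shiftedParity ε p) ∘ₗ
    constantFieldLin e ε p
  have h : F = sg K ((1 + ε) * p j) • e.coord j := by
    refine e.ext fun i => ?_
    simp only [F, LinearMap.comp_apply, constantFieldLin, Module.Basis.constr_basis, map_smul,
      LinearMap.smul_apply, LinearMap.proj_apply, Module.Basis.coord_apply,
      Module.Basis.repr_self]
    change sg K _ • (partialDeriv K (shiftedParity ε p) i (coord K (shiftedParity ε p) j)).coeff 0 = _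
    classical
    rw [partialDeriv_coord, coeff_smul, coeff_mono (isSuper_zero _), if_pos rfl, mul_one,
      Finsupp.single_apply]
    split_ifs with hij
    · rw [hij]
    · simp
  have := LinearMap.congr_fun h u
  simp only [F, LinearMap.comp_apply, constantFieldLin_apply] at this
  exact this

theorem constantField_injective {u v : V}
    (h : valueAtZero (constantField e ε p u) = valueAtZero (constantField e ε p v)) : u = v := by
  refine e.repr.injective (Finsupp.ext fun j => ?_)
  have := congrFun h j
  rw [valueAtZero_constantField, valueAtZero_constantField] at this
  exact (isUnit_sg _).mul_left_cancel this

/-- The signs in i_u for u = e_i come out of the iterated commutator by multilinearity, leaving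
coordinate fields only. -/
theorem higherDerivedField_basis (Q : FormalFun K (shiftedParity ε p) →ₗ[K]
    FormalFun K (shiftedParity ε p)) {n : ℕ} (I : Fin n → ι) :
    higherDerivedField e ε p Q (fun i => e (I i)) (fun i => p (I i)) =
      sg K ((1 + ε) * ∑ i, p (I i)) • coordCommutator Q 1 I := by
  have h : ∀ i, constantField e ε p (e (I i)) =
      sg K ((1 + ε) * p (I i)) • partialDeriv K (shiftedParity ε p) (I i) := fun i => by
    rw [← constantFieldLin_apply, constantFieldLin, Module.Basis.constr_basis]
  rw [higherDerivedField, ← iteratedCommutatorLin_apply]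
  simp only [h]
  rw [MultilinearMap.map_smul_univ, ← sg_sum, ← Finset.mul_sum, iteratedCommutatorLin_apply]
  rfl

variable {ε p} {𝒱 : ZMod 2 × ℤ → Submodule K V} (h𝒱 : DirectSum.IsInternal 𝒱)
  {w : ι → ℤ} (he : ∀ i, e i ∈ 𝒱 (p i, w i)) {k : ℤ}

-- The derived bracket formula for both values of ε at once, since the décalage sign is trivial for
-- ε = 1. For fixed degrees both sides are multilinear in u, so basis vectors suffice.
include h𝒱 he in
theorem valueAtZero_constantField_bracket [Algebra ℚ K]
    (Q : HomologicalVectorField K (shiftedParity ε p) (shiftedWeight k w)) {n : ℕ} (u : Fin n → V)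
    (d : Fin n → ZMod 2 × ℤ) (hu : ∀ i, u i ∈ 𝒱 (d i)) :
    valueAtZero (constantField e ε p (Q.constants.bracket e n u)) =
      sg K ((1 + ε) * decalageExp fun i => (d i).1) •
        valueAtZero (higherDerivedField e ε p Q.field u fun i => (d i).1) := by
  let F : MultilinearMap K (fun _ : Fin n => V) (ι → K) :=
    (valueAtZeroLin K (shiftedParity ε p) ∘ₗ constantFieldLin e ε p).compMultilinearMap
        (Q.constants.bracket e n) -
      sg K ((1 + ε) * decalageExp fun i => (d i).1) •
        (valueAtZeroLin K (shiftedParity ε p)).compMultilinearMap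
          ((iteratedCommutatorLin Q.field 1 n fun i => (d i).1 + (1 + ε)).compLinearMap
            fun _ => constantFieldLin e ε p)
  have hF : ∀ u, F u = valueAtZero (constantField e ε p (Q.constants.bracket e n u)) -
      sg K ((1 + ε) * decalageExp fun i => (d i).1) •
        valueAtZero (higherDerivedField e ε p Q.field u fun i => (d i).1) := by
    intro u
    simp only [F, sub_apply, smul_apply, LinearMap.compMultilinearMap_apply,
      LinearMap.comp_apply, MultilinearMap.compLinearMap_apply, constantFieldLin_apply,
      iteratedCommutatorLin_apply]
    rfl
  rw [← sub_eq_zero, ← hF]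
  refine MultilinearMap.eq_zero_of_basis h𝒱 e he F d (fun I hI => ?_) u hu
  have hd : ∀ i, (d i).1 = p (I i) := fun i => by rw [← hI i]
  rw [hF, sub_eq_zero]
  simp only [hd]
  rw [higherDerivedField_basis]
  funext j
  rw [valueAtZero_constantField, Q.constants.hasConstants e, Finsupp.smul_apply, smul_eq_mul]
  change _ = sg K _ * (sg K _ • coordCommutator Q.field 1 I (coord K (shiftedParity ε p) j)).coeff 0
  rw [coeff_smul, ← commutatorConst_apply Q.isVectorField, ← mul_assoc, ← mul_assoc, ← sg_add,
    ← sg_add]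
  change _ * commutatorConst Q.isVectorField n I j = _
  -- The signs agree only when the parity of e_j is the one prescribed for the bracket, and this is
  -- known only where the constant is nonzero; elsewhere both sides vanish.
  by_cases h0 : commutatorConst Q.isVectorField n I j = 0
  · rw [h0, mul_zero, mul_zero]
  · rw [Q.constants.parity_eq h0, bracketExp]
    congr 2
    generalize decalageExp (fun i => p (I i)) = t1
    generalize ∑ i, p (I i) = t2
    generalize (n : ZMod 2) = t3
    clear hF hd h0 F Q
    revert ε t1 t2 t3
    decide

end DerivedBrackets

/-! ### Existence and uniqueness of the bijection -/

theorem mainTheorem3 {K ι V : Type*} [CommRing K] [Algebra ℚ K] [AddCommGroup V] [Module K V]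
    [LinearOrder ι] (𝒱 : ZMod 2 × ℤ → Submodule K V) (h𝒱 : DirectSum.IsInternal 𝒱)
    (e : Module.Basis ι K V) (p : ι → ZMod 2) (w : ι → ℤ) (he : ∀ i, e i ∈ 𝒱 (p i, w i))
    (ε : ZMod 2) (k : ℤ) :
    ∃! Φ : HomologicalVectorField K (shiftedParity ε p) (shiftedWeight k w) ≃
        ShiftedLInfinity 𝒱 ε k,
      ∀ (Q : HomologicalVectorField K (shiftedParity ε p) (shiftedWeight k w)) (n : ℕ)
        (u : Fin n → V) (d : Fin n → ZMod 2 × ℤ), (∀ i, u i ∈ 𝒱 (d i)) →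
        (ε = 0 →
          valueAtZero (constantField e ε p ((Φ Q).bracket n u)) =
            ((-1 : ℤˣ) ^ (∑ i : Fin n, (d i).1 * ((n : ZMod 2) - 1 - ((i : ℕ) : ZMod 2)))) •
              valueAtZero (higherDerivedField e ε p Q.field u (fun i => (d i).1))) ∧
        (ε = 1 →
          valueAtZero (constantField e ε p ((Φ Q).bracket n u)) =
            valueAtZero (higherDerivedField e ε p Q.field u (fun i => (d i).1))) := by
  let Φ : HomologicalVectorField K (shiftedParity ε p) (shiftedWeight k w) ≃
      ShiftedLInfinity 𝒱 ε k :=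
    homologicalEquivConstants.trans (constantsEquivShiftedLInfinity h𝒱 e he)
  refine ⟨Φ, fun Q n u d hu => ?_, fun Ψ hΨ => ?_⟩
  · have h := valueAtZero_constantField_bracket e h𝒱 he Q u d hu
    constructor
    · rintro hε
      rw [uzpow_smul (K := K)]
      have h1 : (1 + ε) * decalageExp (fun i => (d i).1) =
          ∑ i : Fin n, (d i).1 * ((n : ZMod 2) - 1 - ((i : ℕ) : ZMod 2)) := by
        rw [hε, add_zero, one_mul, decalageExp]
      rw [← h1]
      exact h
    · rintro hε
      have h1 : (1 + ε) * decalageExp (fun i => (d i).1) = 0 := by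
        rw [hε, show (1 : ZMod 2) + 1 = 0 from rfl, zero_mul]
      rw [h1, sg_zero, one_smul] at h
      exact h
  -- Uniqueness: the formula prescribes i of every bracket of basis vectors, and i is injective.
  · refine Equiv.ext fun Q => ShiftedLInfinity.ext_bracket ?_
    funext n
    refine Module.Basis.ext_multilinear (fun _ => e) fun I => ?_
    refine constantField_injective e ε p ?_
    have h := valueAtZero_constantField_bracket e h𝒱 he Q (fun i => e (I i))
      (fun i => (p (I i), w (I i))) fun i => he _
    have hQ := hΨ Q n (fun i => e (I i)) (fun i => (p (I i), w (I i))) fun i => he _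
    refine Eq.trans ?_ h.symm
    rcases ZMod.two_eq_zero_or_one ε with hε | hε
    · rw [hQ.1 hε, uzpow_smul (K := K)]
      have h1 : (1 + ε) * decalageExp (fun i => p (I i)) =
          ∑ i : Fin n, p (I i) * ((n : ZMod 2) - 1 - ((i : ℕ) : ZMod 2)) := by
        rw [hε, add_zero, one_mul, decalageExp]
      rw [h1]
    · rw [hQ.2 hε]
      have h1 : (1 + ε) * decalageExp (fun i => p (I i)) = 0 := by
        rw [hε, show (1 : ZMod 2) + 1 = 0 from rfl, zero_mul]
      rw [h1, sg_zero, one_smul]
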